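/- Let $n\ge 0$ and $r>0$, and let $(L,g)$ be either the sphere $S^n$ with the round metric of radius $r$ (that is, $r^2$ times the metric of the unit sphere in $\mathbb R^{n+1}$), or $\mathbb RP^n=S^n/\{\pm1\}$ with the metric for which the quotient map from that round sphere is a local isometry. Put $T=2\pi r$ if $L=S^n$ and $T=\pi r$ if $L=\mathbb RP^n$ (the length of the closed geodesics when $n\ge1$). Let $\lambda$ be the canonical (Liouville) one-form on $T^*L$, given by $\lambda=\sum_i y_i\,dx_i$ in canonical coordinates, let $w_L=-d\lambda=\sum_i dx_i\wedge dy_i$, let $L_0\subset T^*L$ be the zero section, and let $h:T^*L\to\mathbb R$ be the length function $h(x,\alpha)=\|\alpha\|_{g}$ (dual norm). Then $h$ is smooth on $T^*L\setminus L_0$, there is a unique vector field $X_h$ on $T^*L\setminus L_0$ with $dh=-i_{X_h}w_L$, and $X_h$ has a complete smooth flow $\phi_h(t)$ on $T^*L\setminus L_0$ with the following properties. (0) The flow is periodic with constant period $T$: for every $p\in T^*L\setminus L_0$ and $t\in\mathbb R$ one has $\phi_h(t)(p)=p$ if and only if $t\in T\mathbb Z$. Hence it defines a smooth action of the circle $S^1=\mathbb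 R/T\mathbb Z$ on $T^*L\setminus L_0$; this action is by symplectomorphisms and is Hamiltonian with invariant moment map $h$. (When $g$ is normalised so that all geodesics have length one, $T=1$.) (1) The orbits are reparametrised cogeodesics. Call a curve $\Gamma(s)=(\gamma(s),g(\gamma'(s),\cdot))$, $s\in\mathbb R$, with $\gamma$ a geodesic of $(L,g)$, a trajectory of the cogeodesic flow. Through every $p\in T^*L\setminus L_0$ there is such a trajectory $\Gamma$ with $\Gamma(0)=p$, and for every trajectory $\Gamma$ with $\Gamma(0)=p\in T^*L\setminus L_0$ one has $\phi_h(t)(p)=\Gamma(-t/h(p))$ for all $t\in\mathbb R$. (The minus sign comes from the sign convention $dh=-i_{X_h}w_L$.) (2) For every $a>0$ the level set $V_a=h^{-1}(a)$ is invariant under the flow and under the $S^1$-action, and $V_a$ is a smooth embedded hypersurface of $T^*L$ on which $\lambda|_{V_a}$ is a contact form. -/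

import Mathlib

open scoped Manifold ContDiff Topology

noncomputable section

section Manifold

variable {E : Type*} [NormedAddCommGroup E] [NormedSpace ℝ E] {H : Type*} [TopologicalSpace H]
  {N : Type*} [TopologicalSpace N] [ChartedSpace H N]

/-- The exterior derivative `dθ(v, w)` of a 1-form on a manifold without boundary, computed in the
chart at `p`: with `θc` the coordinate expression of `θ`, it is `D_v θc (w) - D_w θc (v)`. -/
def exteriorDerivative (I : ModelWithCorners ℝ E H) [I.Boundaryless]
    (θ : ∀ p : N, TangentSpace I p →L[ℝ] ℝ) (p : N) (v w : TangentSpace I p) : ℝ :=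
  let θc : E → E →L[ℝ] ℝ := fun u =>
    (θ ((extChartAt I p).symm u)).comp (mfderiv 𝓘(ℝ, E) I (extChartAt I p).symm u)
  let D : TangentSpace I p →L[ℝ] E := mfderiv I 𝓘(ℝ, E) (extChartAt I p) p
  fderiv ℝ θc (extChartAt I p p) (D v) (D w) - fderiv ℝ θc (extChartAt I p p) (D w) (D v)

/-- On the open set `U` the function `f` is smooth and `df = - i_X Ω`. -/
structure IsHamiltonianVectorField (I : ModelWithCorners ℝ E H)
    (Ω : ∀ p : N, TangentSpace I p → TangentSpace I p → ℝ) (U : Set N) (f : N → ℝ)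
    (X : ∀ p : N, TangentSpace I p) : Prop where
  smooth : ContMDiffOn I 𝓘(ℝ, ℝ) ∞ f U
  eq : ∀ p ∈ U, ∀ v : TangentSpace I p, mfderiv I 𝓘(ℝ, ℝ) f p v = - Ω p (X p) v

/-- `φ` is a complete smooth flow on the open set `U` whose trajectories are integral curves
of `X`. -/
structure IsCompleteFlowOn (I : ModelWithCorners ℝ E H) (U : Set N)
    (X : ∀ p : N, TangentSpace I p) (φ : ℝ → N → N) : Prop where
  mapsTo : ∀ t, Set.MapsTo (φ t) U U
  zero : ∀ p ∈ U, φ 0 p = p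
  add : ∀ s t, ∀ p ∈ U, φ (s + t) p = φ s (φ t p)
  smooth : ContMDiffOn (𝓘(ℝ, ℝ).prod I) I ∞ (fun q : ℝ × N => φ q.1 q.2) (Set.univ ×ˢ U)
  integral : ∀ p ∈ U, IsMIntegralCurve (I := I) (fun t => φ t p) X

/-- `ρ` is a smooth action of the circle on the open set `U`, by symplectomorphisms of `Ω`, which
is Hamiltonian with invariant moment map `μ`. The circle is identified with `ℝ / Tℤ` through
`t ↦ exp (2 π i t / T)`, so that the Hamiltonian vector field of `μ` generates the `T`-periodic
flow `t ↦ ρ (exp (2 π i t / T))`. -/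
structure IsHamiltonianCircleAction (I : ModelWithCorners ℝ E H)
    (Ω : ∀ p : N, TangentSpace I p → TangentSpace I p → ℝ) (U : Set N) (T : ℝ) (μ : N → ℝ)
    (ρ : Circle → N → N) : Prop where
  mapsTo : ∀ z, Set.MapsTo (ρ z) U U
  one : ∀ p ∈ U, ρ 1 p = p
  mul : ∀ z w, ∀ p ∈ U, ρ (z * w) p = ρ z (ρ w p)
  smooth : ContMDiffOn ((𝓡 1).prod I) I ∞ (fun q : Circle × N => ρ q.1 q.2) (Set.univ ×ˢ U)
  symplectic : ∀ z, ∀ p ∈ U, ∀ v w : TangentSpace I p,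
    Ω (ρ z p) (mfderiv I I (ρ z) p v) (mfderiv I I (ρ z) p w) = Ω p v w
  invariant : ∀ z, ∀ p ∈ U, μ (ρ z p) = μ p
  moment : ∃ X : ∀ p : N, TangentSpace I p, IsHamiltonianVectorField I Ω U μ X ∧
    ∀ p ∈ U, IsMIntegralCurve (I := I) (fun t : ℝ => ρ (Circle.exp (2 * Real.pi * t / T)) p) X

/-- `V` is a smooth embedded hypersurface and the restriction of the 1-form `θ` to it is a contact
form. Near each of its points `V` is the zero set of a smooth function `f` with `df ≠ 0`, so that
`T_q V = ker df_q`; being a contact form means that `θ` does not vanish on `T_q V` and that `dθ`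
is nondegenerate on `T_q V ∩ ker θ_q`. -/
def IsContactHypersurface (I : ModelWithCorners ℝ E H) [I.Boundaryless]
    (θ : ∀ p : N, TangentSpace I p →L[ℝ] ℝ) (V : Set N) : Prop :=
  ∀ p ∈ V, ∃ (W : Set N) (f : N → ℝ), IsOpen W ∧ p ∈ W ∧ ContMDiffOn I 𝓘(ℝ, ℝ) ∞ f W ∧
    (∀ q ∈ W, mfderiv I 𝓘(ℝ, ℝ) f q ≠ 0) ∧ (∀ q ∈ W, q ∈ V ↔ f q = 0) ∧
    ∀ q ∈ V ∩ W,
      (∃ v : TangentSpace I q, mfderiv I 𝓘(ℝ, ℝ) f q v = 0 ∧ θ q v ≠ 0) ∧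
      ∀ v : TangentSpace I q, mfderiv I 𝓘(ℝ, ℝ) f q v = 0 → θ q v = 0 →
        (∀ w : TangentSpace I q, mfderiv I 𝓘(ℝ, ℝ) f q w = 0 → θ q w = 0 →
          exteriorDerivative I θ q v w = 0) → v = 0

end Manifold

section Cotangent

variable {E : Type*} [NormedAddCommGroup E] [NormedSpace ℝ E]
  {L : Type*} [TopologicalSpace L] [ChartedSpace E L]

/-- The cotangent bundle `T^*L`, as the bundle of continuous linear maps from the tangent bundle
to the trivial line bundle (with Mathlib's manifold structure on it). Its points are
`⟨x, α⟩` with `α` a covector at `x`. -/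
abbrev CotangentBundle (E : Type*) [NormedAddCommGroup E] [NormedSpace ℝ E]
    (L : Type*) [TopologicalSpace L] [ChartedSpace E L] : Type _ :=
  Bundle.TotalSpace (E →L[ℝ] ℝ) (fun x : L => TangentSpace 𝓘(ℝ, E) x →L[ℝ] ℝ)

/-- The model with corners of `T^*L`. -/
abbrev cotangentModel (E : Type*) [NormedAddCommGroup E] [NormedSpace ℝ E] :
    ModelWithCorners ℝ (E × (E →L[ℝ] ℝ)) (ModelProd E (E →L[ℝ] ℝ)) :=
  𝓘(ℝ, E).prod 𝓘(ℝ, E →L[ℝ] ℝ)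

/-- `T^*L ∖ L_0`, the complement of the zero section. -/
def nonzeroCovectors (E : Type*) [NormedAddCommGroup E] [NormedSpace ℝ E]
    (L : Type*) [TopologicalSpace L] [ChartedSpace E L] : Set (CotangentBundle E L) :=
  {p | p.2 ≠ 0}

/-- The Liouville form on `T^*L`: `λ_(x, α) (v) = α (dπ v)`, where `π : T^*L → L`. -/
def liouvilleForm [IsManifold 𝓘(ℝ, E) ∞ L] (p : CotangentBundle E L) :
    TangentSpace (cotangentModel E) p →L[ℝ] ℝ :=
  p.2.comp (mfderiv (cotangentModel E) 𝓘(ℝ, E)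
    (fun q : CotangentBundle E L => q.proj) p)

/-- The canonical symplectic form `- dλ` on `T^*L`, which is `∑ dx_i ∧ dy_i` in coordinates
`(x, y)` with `λ = ∑ y_i dx_i`. -/
def canonicalForm [IsManifold 𝓘(ℝ, E) ∞ L] (p : CotangentBundle E L)
    (v w : TangentSpace (cotangentModel E) p) : ℝ :=
  - exteriorDerivative (cotangentModel E) liouvilleForm p v w

/-- The length of a covector for a Riemannian metric `g`, that is, its dual norm. -/
def covectorLength (g : ∀ x : L, TangentSpace 𝓘(ℝ, E) x → TangentSpace 𝓘(ℝ, E) x → ℝ)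
    (p : CotangentBundle E L) : ℝ :=
  sSup {s : ℝ | ∃ v : TangentSpace 𝓘(ℝ, E) p.proj, g p.proj v v ≤ 1 ∧ p.2 v = s}

/-- The velocity of a curve. -/
def curveVelocity (γ : ℝ → L) (t : ℝ) : TangentSpace 𝓘(ℝ, E) (γ t) :=
  mfderiv 𝓘(ℝ, ℝ) 𝓘(ℝ, E) γ t (1 : ℝ)

/-- The coordinate expression of a metric `g` in the chart at `x₀`. -/
def metricInChart (g : ∀ x : L, TangentSpace 𝓘(ℝ, E) x → TangentSpace 𝓘(ℝ, E) x → ℝ)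
    (x₀ : L) (u a b : E) : ℝ :=
  g ((extChartAt 𝓘(ℝ, E) x₀).symm u)
    (mfderiv 𝓘(ℝ, E) 𝓘(ℝ, E) (extChartAt 𝓘(ℝ, E) x₀).symm u a)
    (mfderiv 𝓘(ℝ, E) 𝓘(ℝ, E) (extChartAt 𝓘(ℝ, E) x₀).symm u b)

/-- A geodesic of the metric `g`, parametrised by `ℝ` with constant speed: a smooth curve which at
each time satisfies the geodesic equation in a chart, here in its Euler-Lagrange form
`d/dt (g_u(u', b)) = (1/2) (D_b g)_u(u', u')` for all `b`. -/
def IsGeodesicLine (g : ∀ x : L, TangentSpace 𝓘(ℝ, E) x → TangentSpace 𝓘(ℝ, E) x → ℝ)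
    (γ : ℝ → L) : Prop :=
  ContMDiff 𝓘(ℝ, ℝ) 𝓘(ℝ, E) ∞ γ ∧ ∀ t₀ : ℝ,
    let u : ℝ → E := fun t => extChartAt 𝓘(ℝ, E) (γ t₀) (γ t)
    ∀ b : E, deriv (fun t => metricInChart g (γ t₀) (u t) (deriv u t) b) t₀ =
      (1 / 2) * fderiv ℝ (fun y => metricInChart g (γ t₀) y (deriv u t₀) (deriv u t₀)) (u t₀) b

/-- A trajectory of the cogeodesic flow: `t ↦ (γ t, g (γ' t, ·))` for a geodesic `γ`, i.e. the
image of a trajectory of the geodesic flow under the identification `TL = T^*L` given by `g`. -/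
def IsCogeodesic (g : ∀ x : L, TangentSpace 𝓘(ℝ, E) x → TangentSpace 𝓘(ℝ, E) x → ℝ)
    (Γ : ℝ → CotangentBundle E L) : Prop :=
  IsGeodesicLine g (fun t => (Γ t).proj) ∧
    ∀ (t : ℝ) (v : TangentSpace 𝓘(ℝ, E) (Γ t).proj),
      (Γ t).2 v = g (Γ t).proj (curveVelocity (fun s => (Γ s).proj) t) v

/-- On `T^*L ∖ L_0`, with the canonical symplectic form, let `h` be the length function of `g`.
Then `X` is the Hamiltonian vector field of `h`, `φ` is its flow, and this flow is periodic with
minimal period `T` at every point and induces the Hamiltonian action `ρ` of the circle `ℝ / Tℤ`;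
its orbits are the reparametrised cogeodesics; and the level sets of `h` are invariant and of
contact type. -/
structure LengthFlowIsCircleAction [IsManifold 𝓘(ℝ, E) ∞ L]
    (g : ∀ x : L, TangentSpace 𝓘(ℝ, E) x → TangentSpace 𝓘(ℝ, E) x → ℝ) (T : ℝ)
    (X : ∀ p : CotangentBundle E L, TangentSpace (cotangentModel E) p)
    (φ : ℝ → CotangentBundle E L → CotangentBundle E L)
    (ρ : Circle → CotangentBundle E L → CotangentBundle E L) : Prop where
  hamiltonian : IsHamiltonianVectorField (cotangentModel E) canonicalForm
    (nonzeroCovectors E L) (covectorLength g) X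
  unique : ∀ Y, IsHamiltonianVectorField (cotangentModel E) canonicalForm
    (nonzeroCovectors E L) (covectorLength g) Y → ∀ p ∈ nonzeroCovectors E L, Y p = X p
  flow : IsCompleteFlowOn (cotangentModel E) (nonzeroCovectors E L) X φ
  period : ∀ p ∈ nonzeroCovectors E L, ∀ t : ℝ, φ t p = p ↔ ∃ k : ℤ, t = k * T
  action : IsHamiltonianCircleAction (cotangentModel E) canonicalForm
    (nonzeroCovectors E L) T (covectorLength g) ρ
  action_eq_flow : ∀ t : ℝ, ∀ p ∈ nonzeroCovectors E L,
    ρ (Circle.exp (2 * Real.pi * t / T)) p = φ t p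
  exists_cogeodesic : ∀ p ∈ nonzeroCovectors E L, ∃ Γ, IsCogeodesic g Γ ∧ Γ 0 = p
  eq_cogeodesic : ∀ Γ, IsCogeodesic g Γ → Γ 0 ∈ nonzeroCovectors E L →
    ∀ t : ℝ, φ t (Γ 0) = Γ (- (t / covectorLength g (Γ 0)))
  level_invariant : ∀ a : ℝ, 0 < a →
    (∀ t : ℝ, φ t '' {p | covectorLength g p = a} = {p | covectorLength g p = a}) ∧
    ∀ z : Circle, ρ z '' {p | covectorLength g p = a} = {p | covectorLength g p = a}
  level_contact : ∀ a : ℝ, 0 < a →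
    IsContactHypersurface (cotangentModel E) liouvilleForm {p | covectorLength g p = a}

end Cotangent

section Round

open Metric

/-- The unit sphere `S^n` in `ℝ^(n+1)`, with Mathlib's manifold structure. -/
abbrev RoundSphere (n : ℕ) : Type := sphere (0 : EuclideanSpace ℝ (Fin (n + 1))) 1

instance signGroup_finite : Finite (sphere (0 : ℝ) 1) := by
  have h : sphere (0 : ℝ) 1 = {-1, 1} := by
    ext x; simp [abs_eq]; tauto
  rw [h]; infer_instance

instance signGroup_isCancelSMul (n : ℕ) : IsCancelSMul (sphere (0 : ℝ) 1) (RoundSphere n) where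
  left_cancel' a b c h := by simpa using congrArg (fun x => a⁻¹ • x) h
  right_cancel' a b c h := by
    have hc : (c : EuclideanSpace ℝ (Fin (n + 1))) ≠ 0 := ne_zero_of_mem_unit_sphere c
    have h' : (a : ℝ) • (c : EuclideanSpace ℝ (Fin (n + 1))) = (b : ℝ) • (c : EuclideanSpace ℝ (Fin (n + 1))) :=
      congrArg Subtype.val h
    exact Subtype.ext (smul_left_injective ℝ hc h')

/-- `ℝP^n = S^n / {±1}`; the group `{±1}` is the unit sphere of `ℝ`, acting on `S^n` by scalar
multiplication, and the charted space structure is Mathlib's one on such a quotient. -/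
abbrev RealProjectiveSpace (n : ℕ) : Type :=
  MulAction.orbitRel.Quotient (sphere (0 : ℝ) 1) (RoundSphere n)

/-- The quotient map `S^n → ℝP^n`. -/
def antipodalProj (n : ℕ) : RoundSphere n → RealProjectiveSpace n :=
  fun x => Quotient.mk _ x

theorem contMDiff_sign_smul (n : ℕ) (σ : sphere (0 : ℝ) 1) :
    ContMDiff (𝓡 n) (𝓡 n) ω (fun x : RoundSphere n => σ • x) := by
  have := Fact.mk (@finrank_euclideanSpace_fin ℝ _ (n + 1))
  have h : (σ : ℝ) = 1 ∨ (σ : ℝ) = -1 := by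
    have := σ.2
    rw [mem_sphere_zero_iff_norm, Real.norm_eq_abs, abs_eq zero_le_one] at this
    exact this
  rcases h with h | h
  · have : (fun x : RoundSphere n => σ • x) = id := by
      funext x; apply Subtype.ext
      change (σ : ℝ) • (x : EuclideanSpace ℝ (Fin (n + 1))) = x
      rw [h, one_smul]
    rw [this]; exact contMDiff_id
  · have : (fun x : RoundSphere n => σ • x) = fun x => -x := by
      funext x; apply Subtype.ext
      change (σ : ℝ) • (x : EuclideanSpace ℝ (Fin (n + 1))) = -x
      rw [h, neg_one_smul]
    rw [this]; exact contMDiff_neg_sphere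

theorem isLocalHomeomorph_antipodalProj (n : ℕ) : IsLocalHomeomorph (antipodalProj n) :=
  isQuotientCoveringMap_quotientMk_of_properlyDiscontinuousSMul.isCoveringMap.isLocalHomeomorph

theorem antipodalProj_eq_iff (n : ℕ) (x y : RoundSphere n) :
    antipodalProj n x = antipodalProj n y ↔ ∃ σ : sphere (0 : ℝ) 1, σ • y = x :=
  Quotient.eq''.trans Iff.rfl

theorem localInverse_antipodalProj (n : ℕ) (z y : RoundSphere n)
    (hy : antipodalProj n y ∈ ((isLocalHomeomorph_antipodalProj n).localInverseAt z).source) :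
    ∃ σ : sphere (0 : ℝ) 1,
      (fun y' => (isLocalHomeomorph_antipodalProj n).localInverseAt z (antipodalProj n y'))
        =ᶠ[𝓝 y] fun y' => σ • y' := by
  set hf := isLocalHomeomorph_antipodalProj n
  set s := hf.localInverseAt z
  obtain ⟨σ, hσ⟩ := (antipodalProj_eq_iff n _ _).1 (hf.apply_localInverseAt_of_mem hy)
  refine ⟨σ, ?_⟩
  have h1 : ∀ᶠ y' in 𝓝 y, antipodalProj n y' ∈ s.source :=
    hf.continuous.continuousAt.eventually (s.open_source.mem_nhds hy)
  have h2 : ∀ᶠ y' in 𝓝 y, σ • y' ∈ s.target := by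
    refine (continuous_const_smul σ).continuousAt.eventually (s.open_target.mem_nhds ?_)
    change σ • y ∈ s.target
    rw [hσ]; exact s.map_source hy
  filter_upwards [h1, h2] with y' hy1 hy2
  refine hf.injOn_localInverseAt_target (s.map_source hy1) hy2 ?_
  rw [hf.apply_localInverseAt_of_mem hy1]
  exact ((antipodalProj_eq_iff n _ _).2 ⟨σ, rfl⟩).symm


theorem realProjectiveSpace_atlas (n : ℕ)
    {e : OpenPartialHomeomorph (RealProjectiveSpace n) (EuclideanSpace ℝ (Fin n))}
    (he : e ∈ atlas (EuclideanSpace ℝ (Fin n)) (RealProjectiveSpace n)) :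
    ∃ x : RoundSphere n, e = ((isLocalHomeomorph_antipodalProj n).localInverseAt x).trans
        (chartAt (EuclideanSpace ℝ (Fin n)) x) := by
  obtain ⟨q, hq⟩ := he
  exact ⟨_, hq.symm⟩

instance realProjectiveSpace_isManifold (n : ℕ) : IsManifold (𝓡 n) ω (RealProjectiveSpace n) := by
  refine isManifold_of_contDiffOn (𝓡 n) ω _ ?_
  intro e e' he he'
  obtain ⟨x, rfl⟩ := realProjectiveSpace_atlas n he
  obtain ⟨x', rfl⟩ := realProjectiveSpace_atlas n he'
  set hf := isLocalHomeomorph_antipodalProj n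
  intro u hu
  simp only [modelWithCornersSelf_coe, modelWithCornersSelf_coe_symm, Set.range_id, Set.inter_univ,
    Set.preimage_id_eq, id_eq, CompTriple.comp_eq] at hu ⊢
  simp only [OpenPartialHomeomorph.trans_source, OpenPartialHomeomorph.symm_source,
    OpenPartialHomeomorph.trans_target, OpenPartialHomeomorph.coe_trans_symm, hf.localInverseAt_symm,
    Set.mem_inter_iff, Set.mem_preimage, Function.comp_apply] at hu
  obtain ⟨⟨hu1, hu2⟩, hu3, hu4⟩ := hu
  set c := chartAt (EuclideanSpace ℝ (Fin n)) x
  set c' := chartAt (EuclideanSpace ℝ (Fin n)) x'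
  obtain ⟨σ, hσ⟩ := localInverse_antipodalProj n x' (c.symm u) hu3
  have hc : ContMDiffAt (𝓡 n) (𝓡 n) ω c.symm u :=
    (contMDiffOn_chart_symm (I := 𝓡 n) (x := x)).contMDiffAt (c.open_target.mem_nhds hu1)
  have hmem : σ • c.symm u ∈ c'.source := by
    have h0 : _ = σ • c.symm u := hσ.self_of_nhds
    rw [← h0]; exact hu4
  have hc' : ContMDiffAt (𝓡 n) (𝓡 n) ω c' (σ • c.symm u) :=
    (contMDiffOn_chart (I := 𝓡 n) (x := x')).contMDiffAt (c'.open_source.mem_nhds hmem)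
  have h1 : ContMDiffAt (𝓡 n) (𝓡 n) ω (fun v => c' (σ • c.symm v)) u :=
    ContMDiffAt.comp u (g := c') (f := fun v => σ • c.symm v) hc'
      (ContMDiffAt.comp u (g := fun y => σ • y) (contMDiff_sign_smul n σ _) hc)
  refine (ContDiffAt.congr_of_eventuallyEq h1.contDiffAt ?_).contDiffWithinAt
  filter_upwards [(c.symm.continuousAt hu1).eventually hσ] with v hv
  simp only [OpenPartialHomeomorph.coe_trans, OpenPartialHomeomorph.coe_trans_symm,
    hf.localInverseAt_symm, Function.comp_apply]
  exact congrArg c' hv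

theorem contMDiff_antipodalProj (n : ℕ) : ContMDiff (𝓡 n) (𝓡 n) ω (antipodalProj n) := by
  intro x
  set hf := isLocalHomeomorph_antipodalProj n
  rw [contMDiffAt_iff_target]
  refine ⟨hf.continuous.continuousAt, ?_⟩
  obtain ⟨z, hz⟩ := realProjectiveSpace_atlas n
    (chart_mem_atlas (EuclideanSpace ℝ (Fin n)) (antipodalProj n x))
  have hx := mem_chart_source (EuclideanSpace ℝ (Fin n)) (antipodalProj n x)
  simp only [extChartAt, hz, OpenPartialHomeomorph.extend, modelWithCornersSelf_partialEquiv,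
    PartialEquiv.trans_refl, OpenPartialHomeomorph.toFun_eq_coe] at hx ⊢
  rw [OpenPartialHomeomorph.trans_source] at hx
  set c := chartAt (EuclideanSpace ℝ (Fin n)) z
  obtain ⟨σ, hσ⟩ := localInverse_antipodalProj n z x hx.1
  have h0 : _ = σ • x := hσ.self_of_nhds
  have hmem : σ • x ∈ c.source := by rw [← h0]; exact hx.2
  have hc : ContMDiffAt (𝓡 n) (𝓡 n) ω c (σ • x) :=
    (contMDiffOn_chart (I := 𝓡 n) (x := z)).contMDiffAt (c.open_source.mem_nhds hmem)
  refine ContMDiffAt.congr_of_eventuallyEq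
    (ContMDiffAt.comp x (g := c) (f := fun y => σ • y) hc (contMDiff_sign_smul n σ x)) ?_
  filter_upwards [hσ] with y hy
  exact congrArg c hy

theorem contMDiffAt_localInverse (n : ℕ) (z : RoundSphere n) {q : RealProjectiveSpace n}
    (hq : q ∈ ((isLocalHomeomorph_antipodalProj n).localInverseAt z).source) :
    ContMDiffAt (𝓡 n) (𝓡 n) ω ((isLocalHomeomorph_antipodalProj n).localInverseAt z) q := by
  set hf := isLocalHomeomorph_antipodalProj n
  have hE : ContMDiffAt (𝓡 n) (𝓡 n) ω (chartAt (EuclideanSpace ℝ (Fin n)) q) q :=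
    (contMDiffOn_chart (I := 𝓡 n) (x := q)).contMDiffAt
      ((chartAt _ q).open_source.mem_nhds (mem_chart_source _ q))
  have hx := mem_chart_source (EuclideanSpace ℝ (Fin n)) q
  obtain ⟨z', hz⟩ := realProjectiveSpace_atlas n (chart_mem_atlas (EuclideanSpace ℝ (Fin n)) q)
  rw [hz] at hE hx
  set e := hf.localInverseAt z'
  set c := chartAt (EuclideanSpace ℝ (Fin n)) z'
  have hx' := hx
  rw [OpenPartialHomeomorph.trans_source] at hx'
  have hq' : antipodalProj n (e q) = q := hf.apply_localInverseAt_of_mem hx'.1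
  obtain ⟨σ, hσ⟩ := localInverse_antipodalProj n z (e q) (by rw [hq']; exact hq)
  have hc : ContMDiffAt (𝓡 n) (𝓡 n) ω c.symm ((e.trans c) q) :=
    (contMDiffOn_chart_symm (I := 𝓡 n) (x := z')).contMDiffAt
      (c.open_target.mem_nhds (c.map_source hx'.2))
  refine ContMDiffAt.congr_of_eventuallyEq (ContMDiffAt.comp q (g := fun y => σ • y)
    (f := fun p => c.symm ((e.trans c) p)) (contMDiff_sign_smul n σ _)
      (ContMDiffAt.comp q (g := c.symm) hc hE)) ?_
  filter_upwards [(e.continuousAt hx'.1).eventually hσ,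
    (e.trans c).open_source.mem_nhds hx] with p hp hp'
  rw [OpenPartialHomeomorph.trans_source] at hp'
  have hp2 : antipodalProj n (e p) = p := hf.apply_localInverseAt_of_mem hp'.1
  rw [hp2] at hp
  rw [hp]
  exact congrArg (fun y => σ • y) (c.left_inv hp'.2).symm

theorem isLocalDiffeomorph_antipodalProj (n : ℕ) :
    IsLocalDiffeomorph (𝓡 n) (𝓡 n) ω (antipodalProj n) := by
  intro x
  set hf := isLocalHomeomorph_antipodalProj n
  set e := hf.localInverseAt x
  have hs : (e.symm : RoundSphere n → RealProjectiveSpace n) = antipodalProj n :=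
    hf.localInverseAt_symm x
  refine ⟨⟨e.symm.toPartialEquiv, e.symm.open_source, e.symm.open_target, ?_, ?_⟩,
    hf.self_mem_localInverseAt_target, ?_⟩
  · exact ((contMDiff_antipodalProj n).contMDiffOn).congr fun y _ => congrFun hs y
  · intro q hq
    exact (contMDiffAt_localInverse n x hq).contMDiffWithinAt
  · intro y _
    exact (congrFun hs y).symm

/-- The differential at `x` of the inclusion `S^n → ℝ^(n+1)`. -/
def sphereDifferential (n : ℕ) (x : RoundSphere n) :
    TangentSpace (𝓡 n) x →L[ℝ] EuclideanSpace ℝ (Fin (n + 1)) :=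
  mfderiv (𝓡 n) 𝓘(ℝ, EuclideanSpace ℝ (Fin (n + 1))) (fun y : RoundSphere n => y.1) x

/-- The round metric on `S^n` as a sphere of radius `r`: `r^2` times the metric induced by the
inclusion of the unit sphere in `ℝ^(n+1)`. -/
def sphereMetric (n : ℕ) (r : ℝ) (x : RoundSphere n) (v w : TangentSpace (𝓡 n) x) : ℝ :=
  r ^ 2 * inner ℝ (sphereDifferential n x v) (sphereDifferential n x w)

/-- The round metric on `ℝP^n`, descended from `sphereMetric n r`: it is evaluated after
inverting the differential of the quotient map at a representative. `projectiveMetric_pullback`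
shows that it is the metric for which the quotient map is a local isometry. -/
def projectiveMetric (n : ℕ) (r : ℝ) (q : RealProjectiveSpace n) (v w : TangentSpace (𝓡 n) q) : ℝ :=
  let x : RoundSphere n := Quotient.out q
  let A : TangentSpace (𝓡 n) q →L[ℝ] TangentSpace (𝓡 n) x :=
    (mfderiv (𝓡 n) (𝓡 n) (antipodalProj n) x).inverse
  sphereMetric n r x (A v) (A w)

theorem sphereMetric_sign (n : ℕ) (r : ℝ) (σ : sphere (0 : ℝ) 1) (x : RoundSphere n)
    (v w : TangentSpace (𝓡 n) x) :
    sphereMetric n r (σ • x) (mfderiv (𝓡 n) (𝓡 n) (fun y : RoundSphere n => σ • y) x v)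
      (mfderiv (𝓡 n) (𝓡 n) (fun y : RoundSphere n => σ • y) x w) = sphereMetric n r x v w := by
  have := Fact.mk (@finrank_euclideanSpace_fin ℝ _ (n + 1))
  have hd : ∀ y : RoundSphere n, MDifferentiableAt (𝓡 n) 𝓘(ℝ, EuclideanSpace ℝ (Fin (n + 1)))
      (fun y : RoundSphere n => y.1) y := fun y =>
    (contMDiff_coe_sphere (m := ω) y).mdifferentiableAt (by simp)
  have hσ : MDifferentiableAt (𝓡 n) (𝓡 n) (fun y : RoundSphere n => σ • y) x :=
    (contMDiff_sign_smul n σ x).mdifferentiableAt (by simp)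
  have h1 := mfderiv_comp x (hd (σ • x)) hσ
  have h2 : ((fun y : RoundSphere n => y.1) ∘ fun y : RoundSphere n => σ • y) =
      (σ : ℝ) • (fun y : RoundSphere n => y.1) := rfl
  rw [h2, const_smul_mfderiv (hd x)] at h1
  have key : ∀ u : TangentSpace (𝓡 n) x,
      sphereDifferential n (σ • x) (mfderiv (𝓡 n) (𝓡 n) (fun y : RoundSphere n => σ • y) x u) =
      (σ : ℝ) • sphereDifferential n x u := fun u => (DFunLike.congr_fun h1 u).symm
  have hs : (σ : ℝ) * σ = 1 := by
    have h3 := σ.2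
    rw [mem_sphere_zero_iff_norm] at h3
    rw [← abs_mul_abs_self, ← Real.norm_eq_abs, h3, one_mul]
  rw [sphereMetric, key v, key w, real_inner_smul_left, real_inner_smul_right, ← mul_assoc (σ : ℝ),
    hs, one_mul, sphereMetric]

theorem projectiveMetric_pullback (n : ℕ) (r : ℝ) (x : RoundSphere n) (v w : TangentSpace (𝓡 n) x) :
    projectiveMetric n r (antipodalProj n x) (mfderiv (𝓡 n) (𝓡 n) (antipodalProj n) x v)
      (mfderiv (𝓡 n) (𝓡 n) (antipodalProj n) x w) = sphereMetric n r x v w := by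
  have hout : antipodalProj n (Quotient.out (antipodalProj n x)) = antipodalProj n x :=
    Quotient.out_eq _
  obtain ⟨σ, hσ⟩ := (antipodalProj_eq_iff n _ _).1 hout
  have hA : ∀ u : TangentSpace (𝓡 n) x,
      ((mfderiv (𝓡 n) (𝓡 n) (antipodalProj n) (σ • x)).inverse :
        EuclideanSpace ℝ (Fin n) →L[ℝ] EuclideanSpace ℝ (Fin n))
        (mfderiv (𝓡 n) (𝓡 n) (antipodalProj n) x u) =
      mfderiv (𝓡 n) (𝓡 n) (fun y : RoundSphere n => σ • y) x u := by
    intro u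
    have hd : ∀ y, MDifferentiableAt (𝓡 n) (𝓡 n) (antipodalProj n) y := fun y =>
      (contMDiff_antipodalProj n y).mdifferentiableAt (by simp)
    have hs : MDifferentiableAt (𝓡 n) (𝓡 n) (fun y : RoundSphere n => σ • y) x :=
      (contMDiff_sign_smul n σ x).mdifferentiableAt (by simp)
    have h1 := mfderiv_comp x (hd (σ • x)) hs
    have h2 : (antipodalProj n ∘ fun y : RoundSphere n => σ • y) = antipodalProj n :=
      funext fun y => (antipodalProj_eq_iff n _ _).2 ⟨σ, rfl⟩
    rw [h2] at h1
    have h3 : mfderiv (𝓡 n) (𝓡 n) (antipodalProj n) x u =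
        mfderiv (𝓡 n) (𝓡 n) (antipodalProj n) (σ • x)
          (mfderiv (𝓡 n) (𝓡 n) (fun y : RoundSphere n => σ • y) x u) := DFunLike.congr_fun h1 u
    let A : EuclideanSpace ℝ (Fin n) ≃L[ℝ] EuclideanSpace ℝ (Fin n) :=
      (isLocalDiffeomorph_antipodalProj n (σ • x)).mfderivToContinuousLinearEquiv (by simp)
    rw [h3]
    have h4 : ∀ z : EuclideanSpace ℝ (Fin n),
        ContinuousLinearMap.inverse A.toContinuousLinearMap (A z) = z := by
      intro z
      rw [ContinuousLinearMap.inverse_equiv]; exact A.symm_apply_apply z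
    exact h4 _
  rw [← sphereMetric_sign n r σ x v w]
  simp only [projectiveMetric]
  rw [← hσ]
  exact congrArg₂ (sphereMetric n r (σ • x)) (hA v) (hA w)

end Round

end

/-!
Both manifolds are quotients `L` of the unit sphere of a Euclidean space `V` by a group `G` of
signs, `G = {1}` for `S^n` and `G = {1, -1}` for `ℝP^n`, and everything is computed upstairs. With
covectors identified with vectors by the inner product, the cotangent bundle of the sphere is the
set of pairs `(x, y)` in `V × V` with `|x| = 1` and `y ⟂ x`. In these terms the Liouville form is
`⟨y, dx⟩`, the length of a covector for the metric of radius `r` is `|y| / r`, and its Hamiltonian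
flow (`lengthFlow`) is the rotation by the angle `t / r` in the oriented plane spanned by `x` and
`y`, with `x` moving towards `-y`. The flow properties, the invariance of the symplectic form
(`lengthFlow_symplectic`) and the periods are then identities in linear algebra: the rotation maps
`(x, y)` to `ε (x, y)` exactly when `cos (t / r) = ε` and `sin (t / r) = 0`, so that the period is
`2 π r` if only `ε = 1` is allowed, and `π r` if `ε = -1` is allowed as well.

To pass from the sphere to `L`, the quotient map is extended to a map `ϖ` on `V ∖ {0}` which is
constant on rays, and the properties of `L` that are used are collected in `IsRoundQuotient`: the
fibres of `ϖ` on unit vectors are the orbits of `G`, and `ϖ` has smooth local sections `S` for which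
the metric of `L` is `r ^ 2` times the metric induced by `S`. The induced map of cotangent bundles
(`cotangentProj`) has smooth local inverses (`IsCotangentLift`) that pull `⟨y, dx⟩` back to the
Liouville form of `T^*L`. Hence the flow, its vector field and the symplectic form of `T^*L` are
read in `V × V`; the Hamiltonian equation, the nondegeneracy of the symplectic form and the contact
condition on the level sets become statements about explicit tangent vectors.

For the cogeodesics, the Euler-Lagrange equation of a metric induced by an immersion says that the
acceleration in the ambient space is normal (`eulerLagrange_eq_inner_acceleration`). So a curve
`γ` in `L` is a geodesic if and only if its local lifts `c` to the sphere satisfy `c'' ∥ c`. Great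
circles provide a cogeodesic through every covector. Conversely, if `c'' ∥ c` then the length of
the covector `(c, r ^ 2 c')` is constant, and so is the point obtained by applying the flow
for time `t h` to the value of the cogeodesic at time `t`, where `h` is this length
(`eventually_lengthFlow_eq_of_acceleration`); as `ℝ` is connected, this determines the cogeodesic.
-/

noncomputable section

/-! ### Covectors in charts -/

section CotangentCoordinates

variable {E : Type*} [NormedAddCommGroup E] [NormedSpace ℝ E]
  {L : Type*} [TopologicalSpace L] [ChartedSpace E L]

/-- The components of the covector `p.2` in the chart of `L` at `x₀`. -/
def covectorComponents (x₀ : L) (p : CotangentBundle E L) : E →L[ℝ] ℝ :=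
  p.2.comp (mfderiv 𝓘(ℝ, E) 𝓘(ℝ, E) (extChartAt 𝓘(ℝ, E) x₀).symm (extChartAt 𝓘(ℝ, E) x₀ p.proj))

variable [IsManifold 𝓘(ℝ, E) ∞ L]

theorem inCoordinates_eq_covectorComponents {x₀ : L} {p : CotangentBundle E L}
    (hp : p.proj ∈ (chartAt E x₀).source) :
    ContinuousLinearMap.inCoordinates E (TangentSpace 𝓘(ℝ, E)) ℝ (Bundle.Trivial L ℝ)
      x₀ p.proj x₀ p.proj p.2 = covectorComponents x₀ p := by
  have h := TangentBundle.symmL_trivializationAt (I := 𝓘(ℝ, E)) hp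
  simp only [modelWithCornersSelf_coe, Set.range_id, mfderivWithin_univ] at h
  refine ContinuousLinearMap.ext fun v => ?_
  have h0 := Bundle.Trivial.continuousLinearMapAt_trivialization ℝ L ℝ p.proj
  exact (DFunLike.congr_fun h0 _).trans (congrArg p.2 (DFunLike.congr_fun h v))

/-- A map to the cotangent bundle is smooth if its base point and its components in a chart are. -/
theorem contMDiffAt_cotangentBundle_iff {F H N : Type*} [NormedAddCommGroup F] [NormedSpace ℝ F]
    [TopologicalSpace H] {J : ModelWithCorners ℝ F H} [TopologicalSpace N] [ChartedSpace H N]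
    {m : ℕ∞ω} {f : N → CotangentBundle E L} {a : N} :
    ContMDiffAt J (cotangentModel E) m f a ↔
      ContMDiffAt J 𝓘(ℝ, E) m (fun x => (f x).proj) a ∧
      ContMDiffAt J 𝓘(ℝ, E →L[ℝ] ℝ) m (fun x => covectorComponents (f a).proj (f x)) a := by
  rw [contMDiffAt_hom_bundle]
  refine and_congr_right fun h => ?_
  apply Filter.EventuallyEq.contMDiffAt_iff
  filter_upwards [h.continuousAt.eventually ((chartAt E (f a).proj).open_source.mem_nhds
    (mem_chart_source E (f a).proj))] with x hx
  exact inCoordinates_eq_covectorComponents hx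

theorem contMDiff_cotangentProj :
    ContMDiff (cotangentModel E) 𝓘(ℝ, E) ∞ (fun p : CotangentBundle E L => p.proj) :=
  fun p => (contMDiffAt_cotangentBundle_iff.1 (contMDiffAt_id (x := p))).1

theorem contMDiffAt_covectorComponents (p : CotangentBundle E L) :
    ContMDiffAt (cotangentModel E) 𝓘(ℝ, E →L[ℝ] ℝ) ∞ (covectorComponents p.proj) p :=
  (contMDiffAt_cotangentBundle_iff.1 (contMDiffAt_id (x := p))).2

theorem mdifferentiableAt_extChartAt_symm {x₀ x : L} (hx : x ∈ (chartAt E x₀).source) :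
    MDifferentiableAt 𝓘(ℝ, E) 𝓘(ℝ, E) (extChartAt 𝓘(ℝ, E) x₀).symm
      (extChartAt 𝓘(ℝ, E) x₀ x) := by
  have h : x ∈ (extChartAt 𝓘(ℝ, E) x₀).source := by rwa [extChartAt_source]
  have h1 := mdifferentiableWithinAt_extChartAt_symm (I := 𝓘(ℝ, E))
    ((extChartAt 𝓘(ℝ, E) x₀).map_source h)
  rwa [modelWithCornersSelf_coe, Set.range_id, mdifferentiableWithinAt_univ] at h1

/-- A covector is evaluated on `dK(v)` through its components, `K` being read in the chart. -/
theorem covectorComponents_fderiv {V : Type*} [NormedAddCommGroup V] [NormedSpace ℝ V]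
    {x₀ : L} {p : CotangentBundle E L} (hp : p.proj ∈ (chartAt E x₀).source) {K : V → L} {x : V}
    (hx : K x = p.proj) (hK : MDifferentiableAt 𝓘(ℝ, V) 𝓘(ℝ, E) K x) (v : V) :
    covectorComponents x₀ p (fderiv ℝ (fun y => extChartAt 𝓘(ℝ, E) x₀ (K y)) x v) =
      p.2 (mfderiv 𝓘(ℝ, V) 𝓘(ℝ, E) K x v) := by
  obtain ⟨q, α⟩ := p
  subst hx
  have h1 : MDifferentiableAt 𝓘(ℝ, E) 𝓘(ℝ, E) (extChartAt 𝓘(ℝ, E) x₀) (K x) :=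
    mdifferentiableAt_extChartAt hp
  have h0 : MDifferentiableAt 𝓘(ℝ, V) 𝓘(ℝ, E) (extChartAt 𝓘(ℝ, E) x₀ ∘ K) x := h1.comp x hK
  have h2 := mfderiv_comp x (I' := 𝓘(ℝ, E)) (g := (extChartAt 𝓘(ℝ, E) x₀).symm)
    (mdifferentiableAt_extChartAt_symm (E := E) hp) h0
  have h3 : (extChartAt 𝓘(ℝ, E) x₀).symm ∘ (extChartAt 𝓘(ℝ, E) x₀ ∘ K) =ᶠ[𝓝 x] K := by
    filter_upwards [hK.continuousAt.eventually ((chartAt E x₀).open_source.mem_nhds hp)] with y hy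
    exact (extChartAt 𝓘(ℝ, E) x₀).left_inv (by rwa [extChartAt_source])
  rw [h3.mfderiv_eq] at h2
  have h4 := DFunLike.congr_fun h2 v
  rw [mfderiv_eq_fderiv] at h4
  exact congrArg α h4.symm

/-- The components of a covector obtained by pulling back along a map `S`, which is read in the
chart. -/
theorem covectorComponents_comp_mfderiv {V : Type*} [NormedAddCommGroup V] [NormedSpace ℝ V]
    {x₀ q : L} (hq : q ∈ (chartAt E x₀).source) {S : L → V}
    (hS : MDifferentiableAt 𝓘(ℝ, E) 𝓘(ℝ, V) S q) (β : V →L[ℝ] ℝ) :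
    covectorComponents x₀
      (⟨q, β.comp (mfderiv 𝓘(ℝ, E) 𝓘(ℝ, V) S q)⟩ : CotangentBundle E L) =
      β.comp (fderiv ℝ (fun u => S ((extChartAt 𝓘(ℝ, E) x₀).symm u))
        (extChartAt 𝓘(ℝ, E) x₀ q)) := by
  have h0 : (extChartAt 𝓘(ℝ, E) x₀).symm (extChartAt 𝓘(ℝ, E) x₀ q) = q :=
    (extChartAt 𝓘(ℝ, E) x₀).left_inv (by rwa [extChartAt_source])
  have h1 := mfderiv_comp_of_eq hS (mdifferentiableAt_extChartAt_symm (E := E) hq) h0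
  rw [mfderiv_eq_fderiv] at h1
  have h2 : ∀ q' : L, q' = q → ∀ w : E,
      (mfderiv 𝓘(ℝ, E) 𝓘(ℝ, V) S q : E →L[ℝ] V) w = (mfderiv 𝓘(ℝ, E) 𝓘(ℝ, V) S q' : E →L[ℝ] V) w := by
    rintro q' rfl w; rfl
  ext v
  exact congrArg β ((h2 _ h0 _).trans (DFunLike.congr_fun h1 v).symm)

end CotangentCoordinates

/-! ### The exterior derivative of a pulled-back Liouville form -/

section PullbackLiouville

open scoped RealInnerProductSpace

variable {V : Type*} [NormedAddCommGroup V] [InnerProductSpace ℝ V]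
  {E : Type*} [NormedAddCommGroup E] [NormedSpace ℝ E]

/-- The derivative of the pullback of the 1-form `⟨y, dx⟩` by `G`. Its second summand is symmetric in
`a` and `b`, so that it does not contribute to the exterior derivative. -/
theorem fderiv_inner_comp_fderiv {G : E → V × V} {u : E} (hG : ContDiffAt ℝ ∞ G u) (a b : E) :
    fderiv ℝ (fun y => (innerSL ℝ (G y).2).comp
        ((ContinuousLinearMap.fst ℝ V V).comp (fderiv ℝ G y))) u a b =
      ⟪(fderiv ℝ G u a).2, (fderiv ℝ G u b).1⟫ +
        ⟪(G u).2, (fderiv ℝ (fderiv ℝ G) u a b).1⟫ := by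
  have h1 : DifferentiableAt ℝ G u := hG.differentiableAt (by simp)
  have h2 : DifferentiableAt ℝ (fderiv ℝ G) u :=
    (hG.fderiv_right (m := ∞) (by simp)).differentiableAt (by simp)
  have h3 : HasFDerivAt (fun y => innerSL ℝ (G y).2)
      ((innerSL ℝ (E := V)).comp ((ContinuousLinearMap.snd ℝ V V).comp (fderiv ℝ G u))) u :=
    (innerSL ℝ (E := V)).hasFDerivAt.comp u
      ((ContinuousLinearMap.snd ℝ V V).hasFDerivAt.comp u h1.hasFDerivAt)
  have h4 : HasFDerivAt (fun y => (ContinuousLinearMap.fst ℝ V V).comp (fderiv ℝ G y))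
      (((ContinuousLinearMap.compL ℝ E (V × V) V) (ContinuousLinearMap.fst ℝ V V)).comp
        (fderiv ℝ (fderiv ℝ G) u)) u :=
    ((ContinuousLinearMap.compL ℝ E (V × V) V)
      (ContinuousLinearMap.fst ℝ V V)).hasFDerivAt.comp u h2.hasFDerivAt
  rw [(h3.clm_comp h4).fderiv]
  simp [add_comm]

variable {H : Type*} [TopologicalSpace H] {N : Type*} [TopologicalSpace N] [ChartedSpace H N]

/-- The exterior derivative of a 1-form which is the pullback of `∑ y_i dx_i` under a smooth map
`Φ` into `V × V` is the pullback of `∑ dy_i ∧ dx_i`. -/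
theorem exteriorDerivative_eq_of_pullback (I : ModelWithCorners ℝ E H) [I.Boundaryless]
    [IsManifold I ∞ N] {θ : ∀ p : N, TangentSpace I p →L[ℝ] ℝ} {Φ : N → V × V} {p : N}
    (hΦ : ContMDiffAt I 𝓘(ℝ, V × V) ∞ Φ p)
    (hθ : ∀ᶠ q in 𝓝 p, ∀ v : TangentSpace I q,
      θ q v = ⟪(Φ q).2, ((mfderiv I 𝓘(ℝ, V × V) Φ q : TangentSpace I q →L[ℝ] V × V) v).1⟫)
    (v w : TangentSpace I p) :
    exteriorDerivative I θ p v w =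
      ⟪((mfderiv I 𝓘(ℝ, V × V) Φ p : TangentSpace I p →L[ℝ] V × V) v).2,
        ((mfderiv I 𝓘(ℝ, V × V) Φ p : TangentSpace I p →L[ℝ] V × V) w).1⟫ -
      ⟪((mfderiv I 𝓘(ℝ, V × V) Φ p : TangentSpace I p →L[ℝ] V × V) w).2,
        ((mfderiv I 𝓘(ℝ, V × V) Φ p : TangentSpace I p →L[ℝ] V × V) v).1⟫ := by
  set ψ := extChartAt I p with hψ
  set u₀ : E := ψ p
  set G : E → V × V := fun u => Φ (ψ.symm u)
  have hinv : ψ.symm u₀ = p := extChartAt_to_inv p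
  have htgt : ψ.target ∈ 𝓝 u₀ := extChartAt_target_mem_nhds p
  have hsm : ∀ᶠ u in 𝓝 u₀, ContMDiffAt 𝓘(ℝ, E) I ∞ ψ.symm u := by
    filter_upwards [eventually_mem_nhds_iff.2 htgt] with u hu
    exact (contMDiffOn_extChartAt_symm p).contMDiffAt hu
  have hcont : Filter.Tendsto ψ.symm (𝓝 u₀) (𝓝 p) := by
    have := hsm.self_of_nhds.continuousAt
    rwa [ContinuousAt, hinv] at this
  have hG : ContDiffAt ℝ ∞ G u₀ := by
    rw [← contMDiffAt_iff_contDiffAt]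
    exact ContMDiffAt.comp_of_eq hΦ hsm.self_of_nhds hinv
  have hΦ' : ∀ᶠ q in 𝓝 p, MDifferentiableAt I 𝓘(ℝ, V × V) Φ q := by
    have h1 : ContMDiffAt I 𝓘(ℝ, V × V) 1 Φ p := hΦ.of_le (by simp)
    filter_upwards [(contMDiffAt_iff_contMDiffAt_nhds (by simp)).1 h1] with q hq
    exact hq.mdifferentiableAt (by simp)
  have hDG : ∀ᶠ u in 𝓝 u₀, ∀ a : E, fderiv ℝ G u a =
      (mfderiv I 𝓘(ℝ, V × V) Φ (ψ.symm u) : TangentSpace I (ψ.symm u) →L[ℝ] V × V)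
        (mfderiv 𝓘(ℝ, E) I ψ.symm u a) := by
    filter_upwards [hsm, hcont.eventually hΦ'] with u hu hu' a
    have := mfderiv_comp u hu' (hu.mdifferentiableAt (by simp))
    rw [mfderiv_eq_fderiv] at this
    exact DFunLike.congr_fun this a
  let θc : E → E →L[ℝ] ℝ := fun u => (θ (ψ.symm u)).comp (mfderiv 𝓘(ℝ, E) I ψ.symm u)
  have hθc : θc =ᶠ[𝓝 u₀]
      fun y => (innerSL ℝ (G y).2).comp
        ((ContinuousLinearMap.fst ℝ V V).comp (fderiv ℝ G y)) := by
    filter_upwards [hDG, hcont.eventually hθ] with u hu hu'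
    refine ContinuousLinearMap.ext fun a => ?_
    refine (hu' _).trans (.trans ?_ (congrArg (fun z : V × V => ⟪(G u).2, z.1⟫) (hu a).symm))
    rfl
  let D : TangentSpace I p →L[ℝ] E := mfderiv I 𝓘(ℝ, E) ψ p
  have hD : ∀ a : TangentSpace I p, fderiv ℝ G u₀ (D a) =
      (mfderiv I 𝓘(ℝ, V × V) Φ p : TangentSpace I p →L[ℝ] V × V) a := by
    intro a
    have h1 : MDifferentiableAt 𝓘(ℝ, E) 𝓘(ℝ, V × V) G (ψ p) :=
      (hG.differentiableAt (by simp)).mdifferentiableAt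
    have h2 := mfderiv_comp p h1 (mdifferentiableAt_extChartAt (mem_chart_source H p))
    have h3 : G ∘ extChartAt I p =ᶠ[𝓝 p] Φ := by
      filter_upwards [extChartAt_source_mem_nhds (I := I) p] with q hq
      simp only [G, Function.comp, ψ, (extChartAt I p).left_inv hq]
    rw [h3.mfderiv_eq, mfderiv_eq_fderiv] at h2
    exact (DFunLike.congr_fun h2 a).symm
  have hsymm := hG.isSymmSndFDerivAt
    (by simpa using (WithTop.coe_le_coe.2 le_top : ((2 : ℕ∞) : ℕ∞ω) ≤ ∞))
  change fderiv ℝ θc u₀ (D v) (D w) - fderiv ℝ θc u₀ (D w) (D v) = _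
  rw [hθc.fderiv_eq, fderiv_inner_comp_fderiv hG, fderiv_inner_comp_fderiv hG, hD, hD,
    hsymm (D v)]
  ring

end PullbackLiouville

/-! ### The flow on the cotangent bundle of the sphere -/

section FlatGeodesics

open scoped RealInnerProductSpace

variable {V : Type*} [NormedAddCommGroup V] [InnerProductSpace ℝ V]
  {E : Type*} [NormedAddCommGroup E] [NormedSpace ℝ E]

/-- The Euler-Lagrange expression of the energy of a metric induced by an immersion `F` into `V`
is the tangential part of the acceleration in `V`. -/
theorem eulerLagrange_eq_inner_acceleration {F : E → V} {u : ℝ → E} {t₀ : ℝ}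
    (hF : ContDiffAt ℝ ∞ F (u t₀)) (hu : ContDiffAt ℝ ∞ u t₀) (b : E) :
    deriv (fun t => ⟪fderiv ℝ F (u t) (deriv u t), fderiv ℝ F (u t) b⟫) t₀ -
      (1 / 2) * fderiv ℝ (fun y => ⟪fderiv ℝ F y (deriv u t₀), fderiv ℝ F y (deriv u t₀)⟫)
        (u t₀) b =
      ⟪deriv (deriv (fun t => F (u t))) t₀, fderiv ℝ F (u t₀) b⟫ := by
  have hF2 : DifferentiableAt ℝ (fderiv ℝ F) (u t₀) :=
    (hF.fderiv_right (m := ∞) (by simp)).differentiableAt (by simp)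
  have hu1 : HasDerivAt u (deriv u t₀) t₀ := (hu.differentiableAt (by simp)).hasDerivAt
  have hc : ContDiffAt ℝ ∞ (fun t => F (u t)) t₀ := hF.comp t₀ hu
  have hc1 : HasDerivAt (deriv (fun t => F (u t))) (deriv (deriv (fun t => F (u t))) t₀) t₀ :=
    ((ContDiffAt.derivWithin (m := ∞) hc (by simp)).differentiableAt (by simp)).hasDerivAt
  have hFev : ∀ᶠ t in 𝓝 t₀, fderiv ℝ F (u t) (deriv u t) = deriv (fun t => F (u t)) t := by
    have h1 : ∀ᶠ y in 𝓝 (u t₀), DifferentiableAt ℝ F y := by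
      filter_upwards [(hF.of_le (m := 1) (by simp)).eventually (by simp)] with y hy
      exact hy.differentiableAt (by simp)
    have h2 : ∀ᶠ t in 𝓝 t₀, DifferentiableAt ℝ u t := by
      filter_upwards [(hu.of_le (m := 1) (by simp)).eventually (by simp)] with y hy
      exact hy.differentiableAt (by simp)
    filter_upwards [hu.continuousAt.eventually h1, h2] with t ht1 ht2
    exact (ht1.hasFDerivAt.comp_hasDerivAt t ht2.hasDerivAt).deriv.symm
  have hFb : HasDerivAt (fun t => fderiv ℝ F (u t) b)
      (fderiv ℝ (fderiv ℝ F) (u t₀) (deriv u t₀) b) t₀ := by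
    have := hF2.hasFDerivAt.comp_hasDerivAt t₀ hu1
    simpa using this.clm_apply (hasDerivAt_const t₀ b)
  have h1 : deriv (fun t => ⟪fderiv ℝ F (u t) (deriv u t), fderiv ℝ F (u t) b⟫) t₀ =
      ⟪deriv (fun t => F (u t)) t₀, fderiv ℝ (fderiv ℝ F) (u t₀) (deriv u t₀) b⟫ +
      ⟪deriv (deriv (fun t => F (u t))) t₀, fderiv ℝ F (u t₀) b⟫ := by
    rw [Filter.EventuallyEq.deriv_eq (f := fun t => ⟪deriv (fun t => F (u t)) t, fderiv ℝ F (u t) b⟫)]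
    · exact (hc1.inner ℝ hFb).deriv
    · filter_upwards [hFev] with t ht
      rw [ht]
  have hFv : HasFDerivAt (fun y => fderiv ℝ F y (deriv u t₀))
      ((fderiv ℝ (fderiv ℝ F) (u t₀)).flip (deriv u t₀)) (u t₀) := by
    simpa using hF2.hasFDerivAt.clm_apply (hasFDerivAt_const (deriv u t₀) (u t₀))
  have h2 : fderiv ℝ (fun y => ⟪fderiv ℝ F y (deriv u t₀), fderiv ℝ F y (deriv u t₀)⟫)
      (u t₀) b = 2 * ⟪deriv (fun t => F (u t)) t₀, fderiv ℝ (fderiv ℝ F) (u t₀) (deriv u t₀) b⟫ := by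
    rw [(hFv.inner ℝ hFv).fderiv, ← hFev.self_of_nhds,
      hF.isSymmSndFDerivAt (by simpa using (WithTop.coe_le_coe.2 le_top : ((2 : ℕ∞) : ℕ∞ω) ≤ ∞))
        (deriv u t₀) b]
    simp [fderivInnerCLM_apply, real_inner_comm, two_mul]
  rw [h1, h2]
  ring

end FlatGeodesics

section SphereCotangent

open scoped RealInnerProductSpace

variable {V : Type*} [NormedAddCommGroup V] [InnerProductSpace ℝ V]

/-- The cotangent bundle of the unit sphere of `V`, as the set of pairs `(x, y)` with `|x| = 1`
and `y ⟂ x`, covectors being identified with vectors by the inner product. -/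
def sphereCotangent (V : Type*) [NormedAddCommGroup V] [InnerProductSpace ℝ V] : Set (V × V) :=
  {z | ‖z.1‖ = 1 ∧ ⟪z.1, z.2⟫ = 0}

/-- The tangent space of `sphereCotangent V` at `z`, obtained by differentiating the equations
`⟨x, x⟩ = 1` and `⟨x, y⟩ = 0`. -/
def sphereCotangentTangent (z : V × V) : Set (V × V) :=
  {a | ⟪z.1, a.1⟫ = 0 ∧ ⟪z.1, a.2⟫ + ⟪z.2, a.1⟫ = 0}

/-- The Hamiltonian flow of `(x, y) ↦ |y| / r` on the cotangent bundle of the unit sphere, for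
`y ≠ 0`: the rotation by the angle `t / r` which moves `x` towards `-y / |y|`. -/
def lengthFlow (r t : ℝ) (z : V × V) : V × V :=
  (Real.cos (t / r) • z.1 - (Real.sin (t / r) / ‖z.2‖) • z.2,
    Real.cos (t / r) • z.2 + (Real.sin (t / r) * ‖z.2‖) • z.1)

/-- The vector field generating `lengthFlow`. -/
def lengthField (r : ℝ) (z : V × V) : V × V :=
  (-(1 / (r * ‖z.2‖)) • z.2, (‖z.2‖ / r) • z.1)

variable {r : ℝ} {z : V × V}

theorem norm_lengthFlow_snd (hz : z ∈ sphereCotangent V) (t : ℝ) :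
    ‖(lengthFlow r t z).2‖ = ‖z.2‖ := by
  obtain ⟨h1, h2⟩ := hz
  have hx : ⟪z.1, z.1⟫ = 1 := by rw [real_inner_self_eq_norm_sq, h1, one_pow]
  have hy : ⟪z.2, z.2⟫ = ‖z.2‖ ^ 2 := real_inner_self_eq_norm_sq _
  rw [← sq_eq_sq₀ (norm_nonneg _) (norm_nonneg _), ← real_inner_self_eq_norm_sq]
  simp only [lengthFlow, inner_add_left, inner_add_right, real_inner_smul_left,
    real_inner_smul_right, hx, hy, real_inner_comm z.1 z.2, h2]
  linear_combination ‖z.2‖ ^ 2 * Real.sin_sq_add_cos_sq (t / r)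

theorem lengthFlow_mem (hz : z ∈ sphereCotangent V) (h0 : z.2 ≠ 0) (t : ℝ) :
    lengthFlow r t z ∈ sphereCotangent V := by
  obtain ⟨h1, h2⟩ := hz
  have h3 : ‖z.2‖ ≠ 0 := norm_ne_zero_iff.2 h0
  have h2' : ⟪z.2, z.1⟫ = 0 := by rw [real_inner_comm, h2]
  have hx : ⟪z.1, z.1⟫ = 1 := by rw [real_inner_self_eq_norm_sq, h1, one_pow]
  have hy : ⟪z.2, z.2⟫ = ‖z.2‖ ^ 2 := real_inner_self_eq_norm_sq _
  constructor
  · rw [← sq_eq_sq₀ (norm_nonneg _) zero_le_one, ← real_inner_self_eq_norm_sq]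
    simp only [lengthFlow, inner_sub_left, inner_sub_right, real_inner_smul_left,
      real_inner_smul_right, hx, hy, h2', h2]
    field_simp
    linear_combination ‖z.2‖ * Real.sin_sq_add_cos_sq (t / r)
  · simp only [lengthFlow, inner_sub_left, inner_add_right, real_inner_smul_left,
      real_inner_smul_right, hx, hy, h2', h2]
    field_simp
    ring

theorem lengthFlow_zero (r : ℝ) (z : V × V) : lengthFlow r 0 z = z := by
  simp [lengthFlow]

theorem lengthFlow_add (hz : z ∈ sphereCotangent V) (h0 : z.2 ≠ 0) (s t : ℝ) :
    lengthFlow r (s + t) z = lengthFlow r s (lengthFlow r t z) := by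
  have h3 : ‖z.2‖ ≠ 0 := norm_ne_zero_iff.2 h0
  have h4 := norm_lengthFlow_snd (r := r) hz t
  rw [lengthFlow, lengthFlow, h4]
  simp only [lengthFlow, add_div, Real.cos_add, Real.sin_add]
  ext1
  · match_scalars <;> field_simp
    ring
  · match_scalars <;> field_simp
    all_goals ring

theorem lengthFlow_smul {ε : ℝ} (hε : ε = 1 ∨ ε = -1) (t : ℝ) (z : V × V) :
    lengthFlow r t (ε • z) = ε • lengthFlow r t z := by
  rcases hε with rfl | rfl
  · simp
  · simp [lengthFlow, sub_eq_add_neg, add_comm]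

/-- As `x` and `y` are orthogonal, the flow multiplies `(x, y)` by a scalar only if its angle is a
multiple of `π`. -/
theorem lengthFlow_eq_smul_iff (hz : z ∈ sphereCotangent V) (h0 : z.2 ≠ 0) (t ε : ℝ) :
    lengthFlow r t z = ε • z ↔ Real.cos (t / r) = ε ∧ Real.sin (t / r) = 0 := by
  obtain ⟨h1, h2⟩ := hz
  have h3 : ‖z.2‖ ≠ 0 := norm_ne_zero_iff.2 h0
  constructor
  · intro h
    have h5 := congrArg (fun w => ⟪z.1, w.1⟫) h
    have h6 := congrArg (fun w => ⟪z.1, w.2⟫) h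
    simp only [lengthFlow, inner_sub_right, inner_add_right, real_inner_smul_right, Prod.smul_fst,
      Prod.smul_snd, real_inner_self_eq_norm_sq, h1, h2] at h5 h6
    refine ⟨by linarith, ?_⟩
    have : Real.sin (t / r) * ‖z.2‖ = 0 := by linarith
    simpa [h3] using this
  · rintro ⟨hc, hs⟩
    ext1 <;> simp [lengthFlow, hc, hs]

theorem contDiffAt_lengthFlow (r t : ℝ) (h0 : z.2 ≠ 0) :
    ContDiffAt ℝ ∞ (fun q : ℝ × (V × V) => lengthFlow r q.1 q.2) (t, z) := by
  have h1 : ContDiffAt ℝ ∞ (fun q : ℝ × (V × V) => ‖q.2.2‖) (t, z) :=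
    ContDiffAt.norm ℝ (by fun_prop) h0
  have h3 : ‖z.2‖ ≠ 0 := norm_ne_zero_iff.2 h0
  have h4 : ContDiffAt ℝ ∞ (fun q : ℝ × (V × V) => Real.sin (q.1 / r)) (t, z) := by fun_prop
  have h5 : ContDiffAt ℝ ∞ (fun q : ℝ × (V × V) => Real.cos (q.1 / r)) (t, z) := by fun_prop
  refine ContDiffAt.prodMk ?_ ?_
  · exact (h5.smul (by fun_prop)).sub ((h4.div h1 h3).smul (by fun_prop))
  · exact (h5.smul (by fun_prop)).add ((h4.mul h1).smul (by fun_prop))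

theorem hasDerivAt_lengthFlow (hz : z ∈ sphereCotangent V) (h0 : z.2 ≠ 0) (t : ℝ) :
    HasDerivAt (fun t => lengthFlow r t z) (lengthField r (lengthFlow r t z)) t := by
  have h3 : ‖z.2‖ ≠ 0 := norm_ne_zero_iff.2 h0
  have hd : HasDerivAt (fun t : ℝ => t / r) (1 / r) t := (hasDerivAt_id t).div_const r
  have h1 := ((hd.cos.smul_const z.1).sub ((hd.sin.div_const ‖z.2‖).smul_const z.2)).prodMk
    ((hd.cos.smul_const z.2).add ((hd.sin.mul_const ‖z.2‖).smul_const z.1))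
  refine h1.congr_deriv ?_
  rw [lengthField, norm_lengthFlow_snd hz]
  simp only [lengthFlow]
  ext1
  · match_scalars <;> field_simp
  · match_scalars <;> field_simp

theorem lengthField_mem (hz : z ∈ sphereCotangent V) (h0 : z.2 ≠ 0) :
    lengthField r z ∈ sphereCotangentTangent z := by
  obtain ⟨h1, h2⟩ := hz
  have h3 : ‖z.2‖ ≠ 0 := norm_ne_zero_iff.2 h0
  constructor
  · simp [lengthField, real_inner_smul_right, h2]
  · simp only [lengthField, real_inner_smul_right, real_inner_self_eq_norm_sq, h1]
    field_simp
    ring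

theorem hasDerivAt_norm_line {y : V} (hy : y ≠ 0) (b : V) :
    HasDerivAt (fun τ : ℝ => ‖y + τ • b‖) (⟪y, b⟫ / ‖y‖) 0 := by
  have h1 : HasDerivAt (fun τ : ℝ => y + τ • b) b 0 := by
    simpa using ((hasDerivAt_id (0 : ℝ)).smul_const b).const_add y
  have h2 := h1.norm_sq.sqrt (by simpa using hy)
  simp only [zero_smul, add_zero, Real.sqrt_sq (norm_nonneg _)] at h2
  refine h2.congr_deriv ?_
  have h3 : ‖y‖ ≠ 0 := norm_ne_zero_iff.2 hy
  field_simp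

theorem hasDerivAt_lengthFlow_line (r t : ℝ) (h0 : z.2 ≠ 0) (a : V × V) :
    HasDerivAt (fun τ : ℝ => lengthFlow r t (z + τ • a))
      (Real.cos (t / r) • a.1 - ((Real.sin (t / r) / ‖z.2‖) • a.2 -
          (Real.sin (t / r) * ⟪z.2, a.2⟫ / ‖z.2‖ ^ 3) • z.2),
        Real.cos (t / r) • a.2 + ((Real.sin (t / r) * ‖z.2‖) • a.1 +
          (Real.sin (t / r) * ⟪z.2, a.2⟫ / ‖z.2‖) • z.1)) 0 := by
  have h3 : ‖z.2‖ ≠ 0 := norm_ne_zero_iff.2 h0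
  have hl : ∀ y b : V, HasDerivAt (fun τ : ℝ => y + τ • b) b 0 := fun y b => by
    simpa using ((hasDerivAt_id (0 : ℝ)).smul_const b).const_add y
  have hn := hasDerivAt_norm_line h0 a.2
  have h1 := (((hl z.1 a.1).const_smul (Real.cos (t / r))).sub
    ((hn.fun_inv (by simpa using h3)).const_mul (Real.sin (t / r)) |>.smul (hl z.2 a.2))).prodMk
    (((hl z.2 a.2).const_smul (Real.cos (t / r))).add
      ((hn.const_mul (Real.sin (t / r))).smul (hl z.1 a.1)))
  refine h1.congr_deriv ?_
  simp only [zero_smul, add_zero]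
  ext1
  · match_scalars <;> field_simp
  · match_scalars <;> field_simp

/-- The flow `lengthFlow` preserves the canonical symplectic form of the sphere. -/
theorem lengthFlow_symplectic (hz : z ∈ sphereCotangent V) (h0 : z.2 ≠ 0) (t : ℝ) {a b : V × V}
    (ha : a ∈ sphereCotangentTangent z) (hb : b ∈ sphereCotangentTangent z) :
    ⟪(fderiv ℝ (lengthFlow r t) z a).2, (fderiv ℝ (lengthFlow r t) z b).1⟫ -
      ⟪(fderiv ℝ (lengthFlow r t) z b).2, (fderiv ℝ (lengthFlow r t) z a).1⟫ =
    ⟪a.2, b.1⟫ - ⟪b.2, a.1⟫ := by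
  have hD : ∀ c : V × V, fderiv ℝ (lengthFlow r t) z c =
      (Real.cos (t / r) • c.1 - ((Real.sin (t / r) / ‖z.2‖) • c.2 -
          (Real.sin (t / r) * ⟪z.2, c.2⟫ / ‖z.2‖ ^ 3) • z.2),
        Real.cos (t / r) • c.2 + ((Real.sin (t / r) * ‖z.2‖) • c.1 +
          (Real.sin (t / r) * ⟪z.2, c.2⟫ / ‖z.2‖) • z.1)) := by
    intro c
    have hd : DifferentiableAt ℝ (lengthFlow r t) z :=
      ((contDiffAt_lengthFlow r t h0).comp z (f := fun z => (t, z))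
        (by fun_prop)).differentiableAt (by simp)
    have hl : HasDerivAt (fun τ : ℝ => z + τ • c) c 0 := by
      simpa using ((hasDerivAt_id (0 : ℝ)).smul_const c).const_add z
    exact (HasFDerivAt.comp_hasDerivAt_of_eq (0 : ℝ) hd.hasFDerivAt hl (by simp)).unique
      (hasDerivAt_lengthFlow_line r t h0 c)
  have h3 : ‖z.2‖ ≠ 0 := norm_ne_zero_iff.2 h0
  obtain ⟨h1, h2⟩ := hz
  obtain ⟨a1, a2⟩ := ha
  obtain ⟨b1, b2⟩ := hb
  have h2' : ⟪z.2, z.1⟫ = 0 := by rw [real_inner_comm, h2]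
  have a2' : ⟪z.1, a.2⟫ = - ⟪z.2, a.1⟫ := by linarith
  have b2' : ⟪z.1, b.2⟫ = - ⟪z.2, b.1⟫ := by linarith
  rw [hD, hD]
  simp only [inner_add_left, inner_sub_right,
    real_inner_smul_left, real_inner_smul_right, h2, real_inner_comm z.2 a.2,
    real_inner_comm z.2 a.1, real_inner_comm z.2 b.2, real_inner_comm z.2 b.1, a1, b1, a2', b2',
    real_inner_comm b.1 a.1, real_inner_comm b.2 a.2, real_inner_comm b.1 a.2,
    real_inner_comm b.2 a.1]
  field_simp
  linear_combination (‖z.2‖ ^ 4 * (⟪b.1, a.2⟫ - ⟪b.2, a.1⟫)) * Real.sin_sq_add_cos_sq (t / r)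

theorem eventually_eq_of_hasDerivAt_zero {f : ℝ → V} {t₀ : ℝ}
    (hf : ∀ᶠ t in 𝓝 t₀, HasDerivAt f 0 t) : ∀ᶠ t in 𝓝 t₀, f t = f t₀ := by
  obtain ⟨δ, hδ, h⟩ := Metric.eventually_nhds_iff_ball.1 hf
  filter_upwards [Metric.ball_mem_nhds t₀ hδ] with t ht
  exact Metric.isOpen_ball.is_const_of_deriv_eq_zero (convex_ball t₀ δ).isPreconnected
    (fun s hs => (h s hs).differentiableAt.differentiableWithinAt)
    (fun s hs => (h s hs).deriv) ht (Metric.mem_ball_self hδ)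

/-- A curve on the unit sphere without tangential acceleration has constant speed, and flowing its
lift to the cotangent bundle backwards along `lengthFlow` for the elapsed time gives a constant
curve: locally it is a great circle. -/
theorem eventually_lengthFlow_eq_of_acceleration {c : ℝ → V} {t₀ : ℝ} (hr : r ≠ 0)
    (hc : ∀ᶠ t in 𝓝 t₀, ContDiffAt ℝ ∞ c t) (hn : ∀ᶠ t in 𝓝 t₀, ‖c t‖ = 1)
    (hgeo : ∀ᶠ t in 𝓝 t₀, ∀ b, ⟪c t, b⟫ = 0 → ⟪deriv (deriv c) t, b⟫ = 0) :
    ∀ᶠ t in 𝓝 t₀, ‖deriv c t‖ = ‖deriv c t₀‖ ∧ (deriv c t₀ ≠ 0 →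
      lengthFlow r (t * (r * ‖deriv c t‖)) (c t, r ^ 2 • deriv c t) =
        lengthFlow r (t₀ * (r * ‖deriv c t₀‖)) (c t₀, r ^ 2 • deriv c t₀)) := by
  have hc1 : ∀ᶠ t in 𝓝 t₀, HasDerivAt c (deriv c t) t := by
    filter_upwards [hc] with t ht using (ht.differentiableAt (by simp)).hasDerivAt
  have hc2 : ∀ᶠ t in 𝓝 t₀, HasDerivAt (deriv c) (deriv (deriv c) t) t := by
    filter_upwards [hc] with t ht
    exact ((ContDiffAt.derivWithin (m := ∞) ht (by simp)).differentiableAt (by simp)).hasDerivAt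
  have hcc : ∀ᶠ t in 𝓝 t₀, ⟪c t, c t⟫ = 1 := by
    filter_upwards [hn] with t ht
    rw [real_inner_self_eq_norm_sq, ht, one_pow]
  have h1 : ∀ᶠ t in 𝓝 t₀, ⟪c t, deriv c t⟫ = 0 := by
    filter_upwards [hc1, hcc.eventually_nhds] with t ht ht'
    have h := (ht.inner ℝ ht).unique
      ((hasDerivAt_const t (1 : ℝ)).congr_of_eventuallyEq ht')
    rw [real_inner_comm (c t)] at h
    linarith
  -- The acceleration is normal, and its normal part is determined by `⟨c, c'⟩ = 0`.
  have h2 : ∀ᶠ t in 𝓝 t₀, deriv (deriv c) t = -(‖deriv c t‖ ^ 2) • c t := by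
    filter_upwards [hc1, hc2, hcc, h1.eventually_nhds, hgeo] with t ht ht2 ht3 ht4 ht5
    have h := (ht.inner ℝ ht2).unique
      ((hasDerivAt_const t (0 : ℝ)).congr_of_eventuallyEq ht4)
    rw [real_inner_self_eq_norm_sq] at h
    set b := deriv (deriv c) t + (‖deriv c t‖ ^ 2) • c t with hb
    have hb1 : ⟪c t, b⟫ = 0 := by
      rw [hb, inner_add_right, real_inner_smul_right, ht3]; linarith
    have hb2 : ⟪b, b⟫ = 0 := by
      nth_rw 1 [hb]
      rw [inner_add_left, real_inner_smul_left, ht5 b hb1, hb1, mul_zero, add_zero]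
    rw [neg_smul]
    exact eq_neg_of_add_eq_zero_left (inner_self_eq_zero.1 hb2)
  have h3 : ∀ᶠ t in 𝓝 t₀, ‖deriv c t‖ = ‖deriv c t₀‖ := by
    have h : ∀ᶠ t in 𝓝 t₀, ⟪deriv c t, deriv c t⟫ = ⟪deriv c t₀, deriv c t₀⟫ := by
      apply eventually_eq_of_hasDerivAt_zero
      filter_upwards [hc2, h1, h2] with t ht ht1 ht2
      refine (ht.inner ℝ ht).congr_deriv ?_
      rw [ht2, real_inner_smul_left, real_inner_smul_right, real_inner_comm, ht1]
      simp
    filter_upwards [h] with t ht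
    rw [real_inner_self_eq_norm_sq, real_inner_self_eq_norm_sq] at ht
    exact (sq_eq_sq₀ (norm_nonneg _) (norm_nonneg _)).1 ht
  by_cases h0 : deriv c t₀ = 0
  · filter_upwards [h3] with t ht using ⟨ht, fun h => absurd h0 h⟩
  set k := ‖deriv c t₀‖ with hk
  have hk0 : k ≠ 0 := norm_ne_zero_iff.2 h0
  -- Rotating the position and the velocity back by the angle `t k` gives constant vectors.
  have h4 : ∀ᶠ t in 𝓝 t₀, Real.cos (t * k) • c t - (Real.sin (t * k) / k) • deriv c t =
      Real.cos (t₀ * k) • c t₀ - (Real.sin (t₀ * k) / k) • deriv c t₀ := by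
    refine eventually_eq_of_hasDerivAt_zero
      (f := fun t => Real.cos (t * k) • c t - (Real.sin (t * k) / k) • deriv c t) ?_
    filter_upwards [hc1, hc2, h2, h3] with t ht1 ht2 ht3 ht4
    have hd : HasDerivAt (fun t : ℝ => t * k) k t := by simpa using (hasDerivAt_id t).mul_const k
    refine ((hd.cos.smul ht1).sub ((hd.sin.div_const k).smul ht2)).congr_deriv ?_
    rw [ht3, ht4]
    match_scalars <;> field_simp <;> ring
  have h5 : ∀ᶠ t in 𝓝 t₀, Real.cos (t * k) • deriv c t + (Real.sin (t * k) * k) • c t =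
      Real.cos (t₀ * k) • deriv c t₀ + (Real.sin (t₀ * k) * k) • c t₀ := by
    refine eventually_eq_of_hasDerivAt_zero
      (f := fun t => Real.cos (t * k) • deriv c t + (Real.sin (t * k) * k) • c t) ?_
    filter_upwards [hc1, hc2, h2, h3] with t ht1 ht2 ht3 ht4
    have hd : HasDerivAt (fun t : ℝ => t * k) k t := by simpa using (hasDerivAt_id t).mul_const k
    refine ((hd.cos.smul ht2).add ((hd.sin.mul_const k).smul ht1)).congr_deriv ?_
    rw [ht3, ht4]
    match_scalars <;> ring
  filter_upwards [h3, h4, h5] with t ht3 ht4 ht5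
  refine ⟨ht3, fun _ => ?_⟩
  have key : ∀ (s : ℝ), ‖deriv c s‖ = k →
      lengthFlow r (s * (r * k)) (c s, r ^ 2 • deriv c s) =
        (Real.cos (s * k) • c s - (Real.sin (s * k) / k) • deriv c s,
          r ^ 2 • (Real.cos (s * k) • deriv c s + (Real.sin (s * k) * k) • c s)) := by
    intro s hs
    have he : s * (r * k) / r = s * k := by field_simp
    simp only [lengthFlow, he, norm_smul, norm_pow, Real.norm_eq_abs, sq_abs, hs]
    ext1
    · match_scalars <;> field_simp
    · match_scalars <;> ring
  rw [ht3, key t ht3, key t₀ hk.symm, ht4, ht5]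

end SphereCotangent

/-! ### Quotients of the round sphere and their local sections -/

section Retraction

open scoped RealInnerProductSpace

variable {V : Type*} [NormedAddCommGroup V] [InnerProductSpace ℝ V]

/-- The retraction `(x, y) ↦ (x', y - ⟨x', y⟩ x')`, `x' = x / |x|`, onto `sphereCotangent V`. -/
def sphereRetraction (z : V × V) : V × V :=
  (‖z.1‖⁻¹ • z.1, z.2 - ⟪‖z.1‖⁻¹ • z.1, z.2⟫ • (‖z.1‖⁻¹ • z.1))

theorem sphereRetraction_of_mem {z : V × V} (hz : z ∈ sphereCotangent V) :
    sphereRetraction z = z := by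
  obtain ⟨h1, h2⟩ := hz
  simp [sphereRetraction, h1, h2]

theorem contDiffAt_normalize {x : V} (hx : x ≠ 0) :
    ContDiffAt ℝ ∞ (fun x : V => ‖x‖⁻¹ • x) x :=
  ((contDiffAt_id.norm ℝ hx).inv (norm_ne_zero_iff.2 hx)).smul contDiffAt_id

theorem hasDerivAt_normalize_line {x : V} (hx : ‖x‖ = 1) (a : V) :
    HasDerivAt (fun τ : ℝ => ‖x + τ • a‖⁻¹ • (x + τ • a)) (a - ⟪x, a⟫ • x) 0 := by
  have h0 : x ≠ 0 := by rintro rfl; simp at hx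
  have hl : HasDerivAt (fun τ : ℝ => x + τ • a) a 0 := by
    simpa using ((hasDerivAt_id (0 : ℝ)).smul_const a).const_add x
  have h1 := ((hasDerivAt_norm_line h0 a).fun_inv (by simp [hx])).smul hl
  refine h1.congr_deriv ?_
  simp only [zero_smul, add_zero, hx]
  match_scalars <;> simp

theorem fderiv_normalize {x : V} (hx : ‖x‖ = 1) (a : V) :
    fderiv ℝ (fun x : V => ‖x‖⁻¹ • x) x a = a - ⟪x, a⟫ • x := by
  have h0 : x ≠ 0 := by rintro rfl; simp at hx
  have hl : HasDerivAt (fun τ : ℝ => x + τ • a) a 0 := by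
    simpa using ((hasDerivAt_id (0 : ℝ)).smul_const a).const_add x
  exact (HasFDerivAt.comp_hasDerivAt_of_eq (0 : ℝ)
    ((contDiffAt_normalize h0).differentiableAt (by simp)).hasFDerivAt hl (by simp)).unique
    (hasDerivAt_normalize_line hx a)

theorem contDiffAt_sphereRetraction {z : V × V} (hz : z.1 ≠ 0) :
    ContDiffAt ℝ ∞ (sphereRetraction (V := V)) z := by
  have h1 : ContDiffAt ℝ ∞ (fun z : V × V => ‖z.1‖⁻¹ • z.1) z :=
    (contDiffAt_normalize hz).comp z contDiffAt_fst
  exact h1.prodMk (contDiffAt_snd.sub ((h1.inner ℝ contDiffAt_snd).smul h1))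

/-- `sphereRetraction` is the identity to first order along `sphereCotangent V`. -/
theorem fderiv_sphereRetraction {z : V × V} (hz : z ∈ sphereCotangent V) {a : V × V}
    (ha : a ∈ sphereCotangentTangent z) : fderiv ℝ (sphereRetraction (V := V)) z a = a := by
  obtain ⟨hz1, hz2⟩ := hz
  obtain ⟨ha1, ha2⟩ := ha
  have h0 : z.1 ≠ 0 := by intro h; simp [h] at hz1
  have hl : ∀ y b : V, HasDerivAt (fun τ : ℝ => y + τ • b) b 0 := fun y b => by
    simpa using ((hasDerivAt_id (0 : ℝ)).smul_const b).const_add y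
  have hl' : HasDerivAt (fun τ : ℝ => z + τ • a) a 0 := by
    simpa using ((hasDerivAt_id (0 : ℝ)).smul_const a).const_add z
  refine (HasFDerivAt.comp_hasDerivAt_of_eq (0 : ℝ)
    ((contDiffAt_sphereRetraction h0).differentiableAt (by simp)).hasFDerivAt hl'
      (by simp)).unique ?_
  have h1 := hasDerivAt_normalize_line hz1 a.1
  have h2 := h1.prodMk ((hl z.2 a.2).sub ((h1.inner ℝ (hl z.2 a.2)).smul h1))
  refine h2.congr_deriv ?_
  ext1
  · simp [ha1]
  · simp only [zero_smul, add_zero, hz1, inv_one, one_smul, ha1, hz2, sub_zero,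
      real_inner_comm z.2 a.1, ha2]

end Retraction

section RoundQuotient

open scoped RealInnerProductSpace

variable {V : Type*} [NormedAddCommGroup V] [InnerProductSpace ℝ V]
  {E : Type*} [NormedAddCommGroup E] [NormedSpace ℝ E]
  {L : Type*} [TopologicalSpace L] [ChartedSpace E L]

/-- The differential at `q` of a map `S` from `L` to a vector space, with values in that space. -/
def ambientDeriv {V : Type*} [NormedAddCommGroup V] [NormedSpace ℝ V] (S : L → V) (q : L) :
    TangentSpace 𝓘(ℝ, E) q →L[ℝ] V :=
  mfderiv 𝓘(ℝ, E) 𝓘(ℝ, V) S q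

/-- The differential at `x` of a map `ϖ` from a vector space to `L`, with values in the model. -/
def modelDeriv {V : Type*} [NormedAddCommGroup V] [NormedSpace ℝ V] (ϖ : V → L) (x : V) :
    V →L[ℝ] TangentSpace 𝓘(ℝ, E) (ϖ x) :=
  mfderiv 𝓘(ℝ, V) 𝓘(ℝ, E) ϖ x

/-- `S` is a smooth local section at `ϖ x` of the map `ϖ` to `L`, with values in the unit sphere
and in the sheet of `x`, for which the metric of `L` is `r ^ 2` times the induced one. -/
structure IsRoundSection (g : ∀ x : L, TangentSpace 𝓘(ℝ, E) x → TangentSpace 𝓘(ℝ, E) x → ℝ)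
    (r : ℝ) (ϖ : V → L) (x : V) (S : L → V) : Prop where
  smooth : ∀ᶠ q in 𝓝 (ϖ x), ContMDiffAt 𝓘(ℝ, E) 𝓘(ℝ, V) ∞ S q
  norm_eq : ∀ᶠ q in 𝓝 (ϖ x), ‖S q‖ = 1
  right_inv : ∀ᶠ q in 𝓝 (ϖ x), ϖ (S q) = q
  left_inv : ∀ᶠ x' in 𝓝 (‖x‖⁻¹ • x), S (ϖ x') = ‖x'‖⁻¹ • x'
  metric : ∀ᶠ q in 𝓝 (ϖ x), ∀ v w : TangentSpace 𝓘(ℝ, E) q,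
    g q v w = r ^ 2 * ⟪ambientDeriv S q v, ambientDeriv S q w⟫

/-- `L` with the metric `g` is the quotient of the round sphere of radius `r` by the group of
signs `G`, and `ϖ` is the quotient map, extended from the unit sphere of `V` to `V ∖ {0}` as a
function which is constant on rays. -/
structure IsRoundQuotient (g : ∀ x : L, TangentSpace 𝓘(ℝ, E) x → TangentSpace 𝓘(ℝ, E) x → ℝ)
    (r : ℝ) (G : Set ℝ) (ϖ : V → L) : Prop where
  sign : ∀ ε ∈ G, ε = 1 ∨ ε = -1
  smooth : ∀ x : V, x ≠ 0 → ContMDiffAt 𝓘(ℝ, V) 𝓘(ℝ, E) ∞ ϖ x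
  homog : ∀ x : V, x ≠ 0 → ϖ (‖x‖⁻¹ • x) = ϖ x
  surj : ∀ q : L, ∃ x : V, ‖x‖ = 1 ∧ ϖ x = q
  fibre : ∀ x y : V, ‖x‖ = 1 → ‖y‖ = 1 → (ϖ x = ϖ y ↔ ∃ ε ∈ G, x = ε • y)
  exists_section : ∀ x : V, x ≠ 0 → ∃ S : L → V, IsRoundSection g r ϖ x S

variable {g : ∀ x : L, TangentSpace 𝓘(ℝ, E) x → TangentSpace 𝓘(ℝ, E) x → ℝ} {r : ℝ} {G : Set ℝ}
  {ϖ : V → L} {x : V} {S S' : L → V}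

theorem IsRoundSection.eventually_nhds (hϖ : IsRoundQuotient g r G ϖ) (hx : x ≠ 0)
    (hS : IsRoundSection g r ϖ x S) : ∀ᶠ x' in 𝓝 x, IsRoundSection g r ϖ x' S := by
  have h1 := (hϖ.smooth x hx).continuousAt
  have h2 : Filter.Tendsto (fun x : V => ‖x‖⁻¹ • x) (𝓝 x) (𝓝 (‖x‖⁻¹ • x)) :=
    (contDiffAt_normalize hx).continuousAt
  filter_upwards [h1.eventually hS.smooth.eventually_nhds,
    h1.eventually hS.norm_eq.eventually_nhds, h1.eventually hS.right_inv.eventually_nhds,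
    h2.eventually hS.left_inv.eventually_nhds, h1.eventually hS.metric.eventually_nhds]
    with x' a b c d e using ⟨a, b, c, d, e⟩

theorem IsRoundSection.normalize (hϖ : IsRoundQuotient g r G ϖ) (hx : x ≠ 0)
    (hS : IsRoundSection g r ϖ x S) : IsRoundSection g r ϖ (‖x‖⁻¹ • x) S := by
  obtain ⟨a, b, c, d, e⟩ := hS
  rw [← hϖ.homog x hx] at a b c e
  refine ⟨a, b, c, ?_, e⟩
  have : ‖‖x‖⁻¹ • x‖ = 1 := norm_smul_inv_norm hx
  rwa [this, inv_one, one_smul]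

theorem IsRoundSection.apply_eq (hϖ : IsRoundQuotient g r G ϖ) (hx : x ≠ 0)
    (hS : IsRoundSection g r ϖ x S) : S (ϖ x) = ‖x‖⁻¹ • x := by
  have h := hS.left_inv.self_of_nhds
  have : ‖‖x‖⁻¹ • x‖ = 1 := norm_smul_inv_norm hx
  rwa [this, inv_one, one_smul, hϖ.homog x hx] at h

theorem IsRoundSection.comp_eventuallyEq (hϖ : IsRoundQuotient g r G ϖ) (hx : x ≠ 0)
    (hS : IsRoundSection g r ϖ x S) : ∀ᶠ x' in 𝓝 x, S (ϖ x') = ‖x'‖⁻¹ • x' := by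
  filter_upwards [hS.eventually_nhds hϖ hx, eventually_ne_nhds hx] with x' h h'
  exact h.apply_eq hϖ h'

theorem ne_zero_of_norm_eq_one {V : Type*} [NormedAddCommGroup V] {x : V} (hx : ‖x‖ = 1) : x ≠ 0 := by
  rintro rfl; simp at hx

/-- On unit vectors `dS ∘ dϖ` is the orthogonal projection to the tangent space of the sphere. -/
theorem IsRoundSection.ambientDeriv_modelDeriv (hϖ : IsRoundQuotient g r G ϖ) (hx : ‖x‖ = 1)
    (hS : IsRoundSection g r ϖ x S) (a : V) :
    ambientDeriv S (ϖ x) (modelDeriv (E := E) ϖ x a) = a - ⟪x, a⟫ • x := by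
  have h0 := ne_zero_of_norm_eq_one hx
  have h1 := mfderiv_comp x (hS.smooth.self_of_nhds.mdifferentiableAt (by simp))
    ((hϖ.smooth x h0).mdifferentiableAt (by simp))
  have h3 := hS.comp_eventuallyEq hϖ h0
  have h2 : S ∘ ϖ =ᶠ[𝓝 x] fun x => ‖x‖⁻¹ • x := h3
  rw [h2.mfderiv_eq, mfderiv_eq_fderiv] at h1
  exact (DFunLike.congr_fun h1 a).symm.trans (fderiv_normalize hx a)

/-- `dϖ ∘ dS` is the identity. -/
theorem IsRoundSection.modelDeriv_ambientDeriv (hϖ : IsRoundQuotient g r G ϖ) (hx : ‖x‖ = 1)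
    (hS : IsRoundSection g r ϖ x S) (v : TangentSpace 𝓘(ℝ, E) (ϖ x)) :
    modelDeriv (E := E) ϖ x (ambientDeriv S (ϖ x) v) = v := by
  have h0 := ne_zero_of_norm_eq_one hx
  have hSx : S (ϖ x) = x := by simpa [hx] using hS.apply_eq hϖ h0
  have h1 := mfderiv_comp_of_eq (I'' := 𝓘(ℝ, E)) ((hϖ.smooth x h0).mdifferentiableAt (by simp))
    (hS.smooth.self_of_nhds.mdifferentiableAt (by simp)) hSx
  have h2 : ϖ ∘ S =ᶠ[𝓝 (ϖ x)] id := hS.right_inv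
  rw [h2.mfderiv_eq, mfderiv_id] at h1
  have h3 : ∀ x' : V, x' = x → ∀ w : V,
      (modelDeriv (E := E) ϖ x w : E) = (modelDeriv (E := E) ϖ x' w : E) := by
    rintro x' rfl w; rfl
  exact (h3 _ hSx _).trans (DFunLike.congr_fun h1 v).symm

theorem IsRoundSection.modelDeriv_self (hϖ : IsRoundQuotient g r G ϖ) (hx : ‖x‖ = 1)
    (hS : IsRoundSection g r ϖ x S) : modelDeriv (E := E) ϖ x x = 0 := by
  rw [← hS.modelDeriv_ambientDeriv hϖ hx (modelDeriv (E := E) ϖ x x),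
    hS.ambientDeriv_modelDeriv hϖ hx, real_inner_self_eq_norm_sq, hx]
  simp

/-- Two sections through the same ray have the same differential, so that the covectors on `L`
defined by means of a section do not depend on it. -/
theorem IsRoundSection.ambientDeriv_unique (hϖ : IsRoundQuotient g r G ϖ) (hx : x ≠ 0)
    (hS : IsRoundSection g r ϖ x S) (hS' : IsRoundSection g r ϖ x S') :
    ambientDeriv (E := E) S (ϖ x) = ambientDeriv S' (ϖ x) := by
  have hn : ‖‖x‖⁻¹ • x‖ = 1 := norm_smul_inv_norm hx
  have hu := hS.normalize hϖ hx
  have hu' := hS'.normalize hϖ hx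
  have key : ambientDeriv (E := E) S (ϖ (‖x‖⁻¹ • x)) = ambientDeriv S' (ϖ (‖x‖⁻¹ • x)) := by
    refine ContinuousLinearMap.ext fun v => ?_
    rw [← hu'.modelDeriv_ambientDeriv hϖ hn v, hu.ambientDeriv_modelDeriv hϖ hn,
      hu'.ambientDeriv_modelDeriv hϖ hn]
  rwa [hϖ.homog x hx] at key

end RoundQuotient

/-! ### The quotient map of cotangent bundles and its local inverses -/

section Lift

open scoped RealInnerProductSpace

variable {V : Type*} [NormedAddCommGroup V] [InnerProductSpace ℝ V] [CompleteSpace V]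
  {E : Type*} [NormedAddCommGroup E] [NormedSpace ℝ E]
  {L : Type*} [TopologicalSpace L] [ChartedSpace E L] [IsManifold 𝓘(ℝ, E) ∞ L]

variable {g : ∀ x : L, TangentSpace 𝓘(ℝ, E) x → TangentSpace 𝓘(ℝ, E) x → ℝ} {r : ℝ} {G : Set ℝ}
  {ϖ : V → L} {x : V} {S S' : L → V} {z : V × V}

omit [IsManifold 𝓘(ℝ, E) ∞ L] in
theorem cotangentBundle_ext {p p' : CotangentBundle E L} (h : p.proj = p'.proj)
    (h' : ∀ v : E, (p.2 : E →L[ℝ] ℝ) v = (p'.2 : E →L[ℝ] ℝ) v) : p = p' := by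
  obtain ⟨q, α⟩ := p
  obtain ⟨q', α'⟩ := p'
  subst h
  exact congrArg (Bundle.TotalSpace.mk q) (ContinuousLinearMap.ext h')

variable (g r ϖ) in
open Classical in
/-- The differential at `ϖ x` of a section of `ϖ` through the ray of `x` (the zero map if there is
no such section). -/
def sectionDeriv (x : V) : TangentSpace 𝓘(ℝ, E) (ϖ x) →L[ℝ] V :=
  if h : ∃ S, IsRoundSection g r ϖ x S then ambientDeriv h.choose (ϖ x) else 0

variable (g r ϖ) in
/-- The map from the cotangent bundle of the sphere to that of its quotient `L` induced by `ϖ`: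
it sends `(x, y)` to the covector `v ↦ ⟨y, v⟩` at `ϖ x`, where `v` is lifted to a tangent vector of
the sphere at `x`. -/
def cotangentProj (z : V × V) : CotangentBundle E L :=
  ⟨ϖ z.1, (innerSL ℝ z.2).comp (sectionDeriv g r ϖ z.1)⟩

/-- The local inverse of `cotangentProj` given by a section `S` of `ϖ`. -/
def cotangentLift (ϖ : V → L) (S : L → V) (p : CotangentBundle E L) : V × V :=
  (S p.proj, (InnerProductSpace.toDual ℝ V).symm
    ((p.2 : E →L[ℝ] ℝ).comp (modelDeriv (E := E) ϖ (S p.proj))))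

omit [IsManifold 𝓘(ℝ, E) ∞ L] [CompleteSpace V] in
theorem IsRoundSection.sectionDeriv_eq (hϖ : IsRoundQuotient g r G ϖ) (hx : x ≠ 0)
    (hS : IsRoundSection g r ϖ x S) : sectionDeriv g r ϖ x = ambientDeriv S (ϖ x) := by
  have h : ∃ S, IsRoundSection g r ϖ x S := ⟨S, hS⟩
  rw [sectionDeriv, dif_pos h]
  exact h.choose_spec.ambientDeriv_unique hϖ hx hS

omit [CompleteSpace V] in
theorem IsRoundQuotient.contMDiffAt_cotangentProj (hϖ : IsRoundQuotient g r G ϖ) (hz : z.1 ≠ 0) :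
    ContMDiffAt 𝓘(ℝ, V × V) (cotangentModel E) ∞ (cotangentProj g r ϖ) z := by
  obtain ⟨S, hS⟩ := hϖ.exists_section z.1 hz
  have hfst : ContMDiffAt 𝓘(ℝ, V × V) 𝓘(ℝ, V) ∞ (fun z : V × V => z.1) z :=
    contDiffAt_fst.contMDiffAt
  have hproj : ContMDiffAt 𝓘(ℝ, V × V) 𝓘(ℝ, E) ∞ (fun z : V × V => ϖ z.1) z :=
    ContMDiffAt.comp z (hϖ.smooth z.1 hz) hfst
  rw [contMDiffAt_cotangentBundle_iff]
  refine ⟨hproj, ?_⟩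
  set e := extChartAt 𝓘(ℝ, E) (ϖ z.1)
  have hchart : ∀ᶠ z' in 𝓝 z, ϖ z'.1 ∈ (chartAt E (ϖ z.1)).source :=
    hproj.continuousAt.eventually ((chartAt E (ϖ z.1)).open_source.mem_nhds (mem_chart_source E _))
  have hev : (fun z' => covectorComponents (ϖ z.1) (cotangentProj g r ϖ z')) =ᶠ[𝓝 z]
      fun z' => (innerSL ℝ z'.2).comp (fderiv ℝ (fun u => S (e.symm u)) (e (ϖ z'.1))) := by
    filter_upwards [hchart, hfst.continuousAt.eventually (hS.eventually_nhds hϖ hz),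
      hfst.continuousAt.eventually (eventually_ne_nhds hz)] with z' h1 h2 h3
    have h4 := covectorComponents_comp_mfderiv h1
      (h2.smooth.self_of_nhds.mdifferentiableAt (by simp)) (innerSL ℝ z'.2)
    rw [← h4, cotangentProj, h2.sectionDeriv_eq hϖ h3]
    rfl
  refine ContMDiffAt.congr_of_eventuallyEq ?_ hev
  have hF : ContDiffAt ℝ ∞ (fun u => S (e.symm u)) (e (ϖ z.1)) := by
    rw [← contMDiffAt_iff_contDiffAt]
    refine ContMDiffAt.comp_of_eq hS.smooth.self_of_nhds ?_ (extChartAt_to_inv (ϖ z.1))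
    exact (contMDiffOn_extChartAt_symm (ϖ z.1)).contMDiffAt (extChartAt_target_mem_nhds (ϖ z.1))
  have he : ContDiffAt ℝ ∞ (fun z' : V × V => e (ϖ z'.1)) z := by
    rw [← contMDiffAt_iff_contDiffAt]
    exact ContMDiffAt.comp z (contMDiffAt_extChartAt (x := ϖ z.1)) hproj
  rw [contMDiffAt_iff_contDiffAt]
  exact ContDiffAt.clm_comp ((innerSL ℝ (E := V)).contDiff.contDiffAt.comp z contDiffAt_snd)
    ((hF.fderiv_right (m := ∞) (by simp)).comp z he)

omit [IsManifold 𝓘(ℝ, E) ∞ L] in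
theorem inner_cotangentLift_snd (p : CotangentBundle E L) (a : V) :
    ⟪(cotangentLift ϖ S p).2, a⟫ =
      (p.2 : E →L[ℝ] ℝ) (modelDeriv (E := E) ϖ (S p.proj) a) := by
  simp only [cotangentLift, InnerProductSpace.toDual_symm_apply]
  rfl

theorem IsRoundSection.contMDiffAt_cotangentLift (hϖ : IsRoundQuotient g r G ϖ) (hx : ‖x‖ = 1)
    (hS : IsRoundSection g r ϖ x S) {p : CotangentBundle E L} (hp : p.proj = ϖ x) :
    ContMDiffAt (cotangentModel E) 𝓘(ℝ, V × V) ∞ (cotangentLift ϖ S) p := by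
  have h0 := ne_zero_of_norm_eq_one hx
  have hSx : S (ϖ x) = x := by simpa [hx] using hS.apply_eq hϖ h0
  have hproj := contMDiff_cotangentProj (E := E) (L := L) p
  have hS1 : ContMDiffAt (cotangentModel E) 𝓘(ℝ, V) ∞ (fun p : CotangentBundle E L => S p.proj) p :=
    ContMDiffAt.comp_of_eq hS.smooth.self_of_nhds hproj hp
  refine hS1.prodMk_space ?_
  set e := extChartAt 𝓘(ℝ, E) p.proj
  have hsource : ∀ᶠ p' : CotangentBundle E L in 𝓝 p, p'.proj ∈ (chartAt E p.proj).source :=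
    hproj.continuousAt.eventually ((chartAt E p.proj).open_source.mem_nhds (mem_chart_source E _))
  have hright : ∀ᶠ p' : CotangentBundle E L in 𝓝 p, ϖ (S p'.proj) = p'.proj := by
    have h := hS.right_inv
    rw [← hp] at h
    exact hproj.continuousAt.eventually h
  have hne : ∀ᶠ p' : CotangentBundle E L in 𝓝 p, S p'.proj ≠ 0 :=
    hS1.continuousAt.eventually (eventually_ne_nhds
      (by change S p.proj ≠ 0; rwa [hp, hSx]))
  have hev : (fun p' : CotangentBundle E L => (InnerProductSpace.toDual ℝ V).symm
      ((p'.2 : E →L[ℝ] ℝ).comp (modelDeriv (E := E) ϖ (S p'.proj)))) =ᶠ[𝓝 p]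
      fun p' => (InnerProductSpace.toDual ℝ V).symm ((covectorComponents p.proj p').comp
        (fderiv ℝ (fun y => e (ϖ y)) (S p'.proj))) := by
    filter_upwards [hsource, hright, hne] with p' h1 h2 h3
    congr 1
    ext a
    exact (covectorComponents_fderiv h1 h2 ((hϖ.smooth _ h3).mdifferentiableAt (by simp)) a).symm
  refine ContMDiffAt.congr_of_eventuallyEq ?_ hev
  have hK : ContDiffAt ℝ ∞ (fun y => e (ϖ y)) (S p.proj) := by
    rw [← contMDiffAt_iff_contDiffAt]
    refine ContMDiffAt.comp_of_eq (contMDiffAt_extChartAt (x := p.proj)) ?_ hright.self_of_nhds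
    exact hϖ.smooth _ hne.self_of_nhds
  have hDK : ContMDiffAt (cotangentModel E) 𝓘(ℝ, V →L[ℝ] E) ∞
      (fun p' : CotangentBundle E L => fderiv ℝ (fun y => e (ϖ y)) (S p'.proj)) p :=
    ContMDiffAt.comp p (hK.fderiv_right (m := ∞) (by simp)).contMDiffAt hS1
  exact ContMDiffAt.comp p
    ((InnerProductSpace.toDual ℝ V).symm.toContinuousLinearEquiv.contDiff.contDiffAt.contMDiffAt)
    ((contMDiffAt_covectorComponents p).clm_comp hDK)

/-- The differential at `p` of a map `Φ` from `T^*L` to `V × V`, with values in `V × V`. -/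
def liftDeriv (Φ : CotangentBundle E L → V × V) (p : CotangentBundle E L) :
    TangentSpace (cotangentModel E) p →L[ℝ] V × V :=
  mfderiv (cotangentModel E) 𝓘(ℝ, V × V) Φ p

omit [CompleteSpace V] in
theorem mfderiv_comp_liftDeriv {W : Type*} [NormedAddCommGroup W] [NormedSpace ℝ W]
    {Φ : CotangentBundle E L → V × V} {p : CotangentBundle E L}
    (hΦ : MDifferentiableAt (cotangentModel E) 𝓘(ℝ, V × V) Φ p) {f : V × V → W}
    (hf : DifferentiableAt ℝ f (Φ p)) (v : TangentSpace (cotangentModel E) p) :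
    (mfderiv (cotangentModel E) 𝓘(ℝ, W) (f ∘ Φ) p v : W) = fderiv ℝ f (Φ p) (liftDeriv Φ p v) := by
  have h := mfderiv_comp p hf.mdifferentiableAt hΦ
  rw [mfderiv_eq_fderiv] at h
  exact DFunLike.congr_fun h v

variable (g r ϖ) in
/-- The differential of `cotangentProj` at `z`. -/
def cotangentProjDeriv (z : V × V) :
    V × V →L[ℝ] TangentSpace (cotangentModel E) (cotangentProj g r ϖ z) :=
  mfderiv 𝓘(ℝ, V × V) (cotangentModel E) (cotangentProj g r ϖ) z

variable (g r ϖ) in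
/-- `Φ` is a smooth local inverse of `cotangentProj`, defined near the image of `z` and with values
in the cotangent bundle of the sphere, under which the Liouville form is `∑ y_i dx_i`. -/
structure IsCotangentLift (z : V × V) (Φ : CotangentBundle E L → V × V) : Prop where
  smooth : ∀ᶠ p in 𝓝 (cotangentProj g r ϖ z), ContMDiffAt (cotangentModel E) 𝓘(ℝ, V × V) ∞ Φ p
  mem : ∀ᶠ p in 𝓝 (cotangentProj g r ϖ z), Φ p ∈ sphereCotangent V
  right_inv : ∀ᶠ p in 𝓝 (cotangentProj g r ϖ z), cotangentProj g r ϖ (Φ p) = p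
  left_inv : ∀ᶠ z' in 𝓝 z, Φ (cotangentProj g r ϖ z') = sphereRetraction z'
  liouville : ∀ᶠ p in 𝓝 (cotangentProj g r ϖ z), ∀ v : TangentSpace (cotangentModel E) p,
    liouvilleForm p v = ⟪(Φ p).2, (liftDeriv Φ p v).1⟫

omit [IsManifold 𝓘(ℝ, E) ∞ L] in
theorem IsRoundSection.cotangentLift_mem (hϖ : IsRoundQuotient g r G ϖ) {p : CotangentBundle E L}
    (h1 : ‖S p.proj‖ = 1) (h3 : IsRoundSection g r ϖ (S p.proj) S) :
    cotangentLift ϖ S p ∈ sphereCotangent V := by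
  refine ⟨h1, ?_⟩
  rw [real_inner_comm, inner_cotangentLift_snd]
  have h4 := h3.modelDeriv_self hϖ h1
  exact (congrArg (p.2 : E →L[ℝ] ℝ) h4).trans (map_zero _)

omit [IsManifold 𝓘(ℝ, E) ∞ L] in
theorem IsRoundSection.cotangentProj_cotangentLift (hϖ : IsRoundQuotient g r G ϖ)
    {p : CotangentBundle E L} (h1 : ‖S p.proj‖ = 1) (h2 : ϖ (S p.proj) = p.proj)
    (h3 : IsRoundSection g r ϖ (S p.proj) S) : cotangentProj g r ϖ (cotangentLift ϖ S p) = p := by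
  refine cotangentBundle_ext h2 fun v => ?_
  have h4 : (cotangentProj g r ϖ (cotangentLift ϖ S p)).2 =
      (innerSL ℝ (cotangentLift ϖ S p).2).comp (ambientDeriv S (ϖ (S p.proj))) := by
    rw [← h3.sectionDeriv_eq hϖ (ne_zero_of_norm_eq_one h1)]
    rfl
  rw [h4]
  refine (inner_cotangentLift_snd p _).trans ?_
  exact congrArg (p.2 : E →L[ℝ] ℝ) (h3.modelDeriv_ambientDeriv hϖ h1 v)

theorem IsRoundSection.isCotangentLift (hϖ : IsRoundQuotient g r G ϖ) (hz : ‖z.1‖ = 1)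
    (hS : IsRoundSection g r ϖ z.1 S) : IsCotangentLift g r ϖ z (cotangentLift ϖ S) := by
  have h0 := ne_zero_of_norm_eq_one hz
  have hSz : S (ϖ z.1) = z.1 := by simpa [hz] using hS.apply_eq hϖ h0
  have hproj : Filter.Tendsto (fun p : CotangentBundle E L => p.proj)
      (𝓝 (cotangentProj g r ϖ z)) (𝓝 (ϖ z.1)) :=
    (contMDiff_cotangentProj (cotangentProj g r ϖ z)).continuousAt
  -- Near `z`, the unit vector `S q` over a point `q` of `L` lies in the sheet of `S`.
  have hsec : ∀ᶠ q in 𝓝 (ϖ z.1), IsRoundSection g r ϖ (S q) S := by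
    have h := hS.smooth.self_of_nhds.continuousAt
    rw [ContinuousAt, hSz] at h
    exact h.eventually (hS.eventually_nhds hϖ h0)
  have hbase : ∀ᶠ p in 𝓝 (cotangentProj g r ϖ z), ContMDiffAt 𝓘(ℝ, E) 𝓘(ℝ, V) ∞ S p.proj ∧
      ‖S p.proj‖ = 1 ∧ ϖ (S p.proj) = p.proj ∧ IsRoundSection g r ϖ (S p.proj) S :=
    hproj.eventually (hS.smooth.and (hS.norm_eq.and (hS.right_inv.and hsec)))
  refine ⟨?_, ?_, ?_, ?_, ?_⟩
  · filter_upwards [hbase] with p hp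
    exact hp.2.2.2.contMDiffAt_cotangentLift hϖ hp.2.1 hp.2.2.1.symm
  · filter_upwards [hbase] with p hp
    exact hp.2.2.2.cotangentLift_mem hϖ hp.2.1
  · filter_upwards [hbase] with p hp
    exact hp.2.2.2.cotangentProj_cotangentLift hϖ hp.2.1 hp.2.2.1
  · have hfst : Filter.Tendsto (fun z : V × V => z.1) (𝓝 z) (𝓝 z.1) := continuousAt_fst
    filter_upwards [hfst.eventually (hS.eventually_nhds hϖ h0),
      hfst.eventually (eventually_ne_nhds h0)] with z' h1 h2
    have h3 : ‖‖z'.1‖⁻¹ • z'.1‖ = 1 := norm_smul_inv_norm h2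
    have h4 : S (ϖ z'.1) = ‖z'.1‖⁻¹ • z'.1 := h1.apply_eq hϖ h2
    refine Prod.ext h4 (ext_inner_right ℝ fun a => ?_)
    have h5 := (h1.normalize hϖ h2).ambientDeriv_modelDeriv hϖ h3 a
    rw [inner_cotangentLift_snd]
    change ⟪z'.2, sectionDeriv g r ϖ z'.1 (modelDeriv (E := E) ϖ (S (ϖ z'.1)) a)⟫ = _
    rw [h1.sectionDeriv_eq hϖ h2, h4]
    rw [hϖ.homog _ h2] at h5
    refine (congrArg (fun w => ⟪z'.2, w⟫) h5).trans ?_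
    simp only [sphereRetraction, inner_sub_left, inner_sub_right, real_inner_smul_left,
      real_inner_smul_right, real_inner_comm z'.1 z'.2]
    ring
  · filter_upwards [hbase] with p hp v
    obtain ⟨hS1, h1, h2, h3⟩ := hp
    have hL := h3.contMDiffAt_cotangentLift hϖ h1 h2.symm
    have h4 : (liftDeriv (cotangentLift ϖ S) p v).1 = ambientDeriv S p.proj
        (mfderiv (cotangentModel E) 𝓘(ℝ, E) (fun q : CotangentBundle E L => q.proj) p v) := by
      have h5 := mfderiv_comp p (I' := 𝓘(ℝ, E)) (hS1.mdifferentiableAt (by simp))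
        ((contMDiff_cotangentProj (E := E) (L := L) p).mdifferentiableAt (by simp))
      have h6 := mfderiv_comp_liftDeriv (hL.mdifferentiableAt (by simp))
        (f := fun w : V × V => w.1) differentiableAt_fst v
      rw [fderiv_fst] at h6
      exact h6.symm.trans (DFunLike.congr_fun h5 v)
    rw [inner_cotangentLift_snd, h4]
    have h5 : ∀ q : L, q = p.proj → ∀ w : E,
        (ambientDeriv (E := E) S p.proj w : V) = ambientDeriv (E := E) S q w := by
      rintro q rfl w; rfl
    have h6 : ∀ w : E, modelDeriv (E := E) ϖ (S p.proj) (ambientDeriv (E := E) S p.proj w) = w :=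
      fun w => (congrArg (modelDeriv (E := E) ϖ (S p.proj)) (h5 _ h2 w)).trans
        (h3.modelDeriv_ambientDeriv hϖ h1 w)
    exact (congrArg (p.2 : E →L[ℝ] ℝ) (h6 _)).symm

variable {Φ : CotangentBundle E L → V × V}

theorem IsRoundQuotient.exists_isCotangentLift (hϖ : IsRoundQuotient g r G ϖ)
    (hz : z ∈ sphereCotangent V) : ∃ Φ, IsCotangentLift g r ϖ z Φ := by
  obtain ⟨S, hS⟩ := hϖ.exists_section z.1 (ne_zero_of_norm_eq_one hz.1)
  exact ⟨_, hS.isCotangentLift hϖ hz.1⟩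

omit [CompleteSpace V] in
theorem IsCotangentLift.apply_eq (hz : z ∈ sphereCotangent V) (hΦ : IsCotangentLift g r ϖ z Φ) :
    Φ (cotangentProj g r ϖ z) = z := by
  rw [hΦ.left_inv.self_of_nhds, sphereRetraction_of_mem hz]

omit [CompleteSpace V] in
theorem IsCotangentLift.mdifferentiableAt (hΦ : IsCotangentLift g r ϖ z Φ) :
    MDifferentiableAt (cotangentModel E) 𝓘(ℝ, V × V) Φ (cotangentProj g r ϖ z) :=
  hΦ.smooth.self_of_nhds.mdifferentiableAt (by simp)

omit [CompleteSpace V] in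
theorem IsRoundQuotient.mdifferentiableAt_cotangentProj (hϖ : IsRoundQuotient g r G ϖ)
    (hz : z ∈ sphereCotangent V) :
    MDifferentiableAt 𝓘(ℝ, V × V) (cotangentModel E) (cotangentProj g r ϖ) z :=
  (hϖ.contMDiffAt_cotangentProj (ne_zero_of_norm_eq_one hz.1)).mdifferentiableAt (by simp)

omit [CompleteSpace V] in
theorem IsCotangentLift.liftDeriv_cotangentProjDeriv (hϖ : IsRoundQuotient g r G ϖ)
    (hz : z ∈ sphereCotangent V) (hΦ : IsCotangentLift g r ϖ z Φ) {a : V × V}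
    (ha : a ∈ sphereCotangentTangent z) :
    liftDeriv Φ (cotangentProj g r ϖ z) (cotangentProjDeriv g r ϖ z a) = a := by
  have h1 := mfderiv_comp z hΦ.mdifferentiableAt (hϖ.mdifferentiableAt_cotangentProj hz)
  have h2 : Φ ∘ cotangentProj g r ϖ =ᶠ[𝓝 z] sphereRetraction := hΦ.left_inv
  rw [h2.mfderiv_eq, mfderiv_eq_fderiv] at h1
  exact (DFunLike.congr_fun h1 a).symm.trans (fderiv_sphereRetraction hz ha)

omit [CompleteSpace V] in
theorem IsCotangentLift.cotangentProjDeriv_liftDeriv (hϖ : IsRoundQuotient g r G ϖ)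
    (hz : z ∈ sphereCotangent V) (hΦ : IsCotangentLift g r ϖ z Φ)
    (v : TangentSpace (cotangentModel E) (cotangentProj g r ϖ z)) :
    cotangentProjDeriv g r ϖ z (liftDeriv Φ (cotangentProj g r ϖ z) v) = v := by
  have h1 := mfderiv_comp_of_eq (I'' := cotangentModel E)
    (hϖ.mdifferentiableAt_cotangentProj hz) hΦ.mdifferentiableAt (hΦ.apply_eq hz)
  have h2 : cotangentProj g r ϖ ∘ Φ =ᶠ[𝓝 (cotangentProj g r ϖ z)] id := hΦ.right_inv
  rw [h2.mfderiv_eq, mfderiv_id] at h1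
  have h3 : ∀ z' : V × V, z' = z → ∀ w : V × V,
      (cotangentProjDeriv (E := E) g r ϖ z w : E × (E →L[ℝ] ℝ)) =
        (cotangentProjDeriv (E := E) g r ϖ z' w : E × (E →L[ℝ] ℝ)) := by
    rintro z' rfl w; rfl
  exact (h3 _ (hΦ.apply_eq hz) _).trans (DFunLike.congr_fun h1 v).symm

omit [CompleteSpace V] in
theorem IsCotangentLift.liftDeriv_mem (hz : z ∈ sphereCotangent V)
    (hΦ : IsCotangentLift g r ϖ z Φ)
    (v : TangentSpace (cotangentModel E) (cotangentProj g r ϖ z)) :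
    liftDeriv Φ (cotangentProj g r ϖ z) v ∈ sphereCotangentTangent z := by
  have h1 : HasFDerivAt (fun w : V × V => ⟪w.1, w.1⟫) _ z :=
    (hasFDerivAt_fst (𝕜 := ℝ)).inner ℝ (hasFDerivAt_fst (𝕜 := ℝ))
  have h2 : HasFDerivAt (fun w : V × V => ⟪w.1, w.2⟫) _ z :=
    (hasFDerivAt_fst (𝕜 := ℝ)).inner ℝ (hasFDerivAt_snd (𝕜 := ℝ))
  have hconst : ∀ (f : V × V → ℝ) (c : ℝ), DifferentiableAt ℝ f z →
      (∀ w ∈ sphereCotangent V, f w = c) →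
      fderiv ℝ f z (liftDeriv Φ (cotangentProj g r ϖ z) v) = 0 := by
    intro f c hf hc
    have hf' : DifferentiableAt ℝ f (Φ (cotangentProj g r ϖ z)) := by rwa [hΦ.apply_eq hz]
    have h := mfderiv_comp_liftDeriv hΦ.mdifferentiableAt hf' v
    have h' : f ∘ Φ =ᶠ[𝓝 (cotangentProj g r ϖ z)] fun _ => c := by
      filter_upwards [hΦ.mem] with p hp using hc _ hp
    rw [hΦ.apply_eq hz] at h
    rw [← h, h'.mfderiv_eq, mfderiv_const]
    rfl
  have h3 := hconst _ 1 h1.differentiableAt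
    (fun w hw => by rw [real_inner_self_eq_norm_sq, hw.1, one_pow])
  have h4 := hconst _ 0 h2.differentiableAt (fun w hw => hw.2)
  rw [h1.fderiv] at h3
  rw [h2.fderiv] at h4
  simp only [ContinuousLinearMap.comp_apply, ContinuousLinearMap.prod_apply, fderivInnerCLM_apply,
    ContinuousLinearMap.coe_fst', ContinuousLinearMap.coe_snd'] at h3 h4
  rw [real_inner_comm] at h3
  constructor
  · rw [real_inner_comm]; linarith
  · rw [real_inner_comm z.2] at h4; linarith

omit [CompleteSpace V] in
theorem IsCotangentLift.liouvilleForm_eq (hz : z ∈ sphereCotangent V)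
    (hΦ : IsCotangentLift g r ϖ z Φ)
    (v : TangentSpace (cotangentModel E) (cotangentProj g r ϖ z)) :
    liouvilleForm (cotangentProj g r ϖ z) v =
      ⟪z.2, (liftDeriv Φ (cotangentProj g r ϖ z) v).1⟫ := by
  rw [hΦ.liouville.self_of_nhds v, hΦ.apply_eq hz]

omit [CompleteSpace V] in
theorem IsCotangentLift.exteriorDerivative_eq (hΦ : IsCotangentLift g r ϖ z Φ)
    (v w : TangentSpace (cotangentModel E) (cotangentProj g r ϖ z)) :
    exteriorDerivative (cotangentModel E) liouvilleForm (cotangentProj g r ϖ z) v w =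
      ⟪(liftDeriv Φ (cotangentProj g r ϖ z) v).2, (liftDeriv Φ (cotangentProj g r ϖ z) w).1⟫ -
      ⟪(liftDeriv Φ (cotangentProj g r ϖ z) w).2, (liftDeriv Φ (cotangentProj g r ϖ z) v).1⟫ :=
  exteriorDerivative_eq_of_pullback (cotangentModel E) hΦ.smooth.self_of_nhds hΦ.liouville v w

end Lift

/-! ### The flow on the cotangent bundle of the quotient -/

section SignSymmetry

open scoped RealInnerProductSpace

variable {V : Type*} [NormedAddCommGroup V] [InnerProductSpace ℝ V]
  {E : Type*} [NormedAddCommGroup E] [NormedSpace ℝ E]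
  {L : Type*} [TopologicalSpace L] [ChartedSpace E L]

variable {g : ∀ x : L, TangentSpace 𝓘(ℝ, E) x → TangentSpace 𝓘(ℝ, E) x → ℝ} {r : ℝ} {G : Set ℝ}
  {ϖ : V → L} {x : V} {S S' : L → V} {z z' : V × V} {ε : ℝ}

theorem IsRoundQuotient.apply_smul (hϖ : IsRoundQuotient g r G ϖ) (hε : ε ∈ G) (hx : x ≠ 0) :
    ϖ (ε • x) = ϖ x := by
  have hε1 : |ε| = 1 := by rcases hϖ.sign ε hε with rfl | rfl <;> simp
  have hε0 : ε ≠ 0 := by rintro rfl; simp at hε1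
  have h1 : ‖‖x‖⁻¹ • x‖ = 1 := norm_smul_inv_norm hx
  have h2 : ‖‖ε • x‖⁻¹ • ε • x‖ = 1 := norm_smul_inv_norm (smul_ne_zero hε0 hx)
  rw [← hϖ.homog x hx, ← hϖ.homog (ε • x) (smul_ne_zero hε0 hx),
    hϖ.fibre _ _ h2 h1]
  refine ⟨ε, hε, ?_⟩
  rw [norm_smul, Real.norm_eq_abs, hε1, one_mul, smul_comm]

theorem IsRoundSection.smul (hϖ : IsRoundQuotient g r G ϖ) (hε : ε ∈ G) (hx : x ≠ 0)
    (hS : IsRoundSection g r ϖ x S) : IsRoundSection g r ϖ (ε • x) (fun q => ε • S q) := by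
  have hε1 : |ε| = 1 := by rcases hϖ.sign ε hε with rfl | rfl <;> simp
  have hε2 : ε * ε = 1 := by rcases hϖ.sign ε hε with rfl | rfl <;> simp
  have hε0 : ε ≠ 0 := by rintro rfl; simp at hε1
  have hq := hϖ.apply_smul hε hx
  have hnorm : ∀ y : V, ‖ε • y‖ = ‖y‖ := fun y => by rw [norm_smul, Real.norm_eq_abs, hε1, one_mul]
  refine ⟨?_, ?_, ?_, ?_, ?_⟩
  · rw [hq]
    filter_upwards [hS.smooth] with q h using
      (contDiff_const_smul ε).contMDiff.contMDiffAt.comp q h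
  · rw [hq]
    filter_upwards [hS.norm_eq] with q h using by rw [hnorm, h]
  · rw [hq]
    filter_upwards [hS.right_inv, hS.norm_eq] with q h h'
    rw [hϖ.apply_smul hε (ne_zero_of_norm_eq_one h'), h]
  · have hc : Filter.Tendsto (fun y : V => ε • y) (𝓝 (‖ε • x‖⁻¹ • ε • x)) (𝓝 (‖x‖⁻¹ • x)) := by
      have h : ‖x‖⁻¹ • x = ε • (‖ε • x‖⁻¹ • ε • x) := by
        rw [hnorm, smul_comm, smul_smul ε ε, hε2, one_smul]
      rw [h]
      exact (continuous_const_smul ε).continuousAt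
    have hne : ‖ε • x‖⁻¹ • ε • x ≠ 0 :=
      smul_ne_zero (inv_ne_zero (norm_ne_zero_iff.2 (smul_ne_zero hε0 hx))) (smul_ne_zero hε0 hx)
    filter_upwards [hc.eventually hS.left_inv, eventually_ne_nhds hne] with y h h'
    rw [hϖ.apply_smul hε h', hnorm] at h
    rw [h, smul_comm, smul_smul ε ε, hε2, one_smul]
  · rw [hq]
    filter_upwards [hS.metric, hS.smooth] with q h h' v w
    have hd : ∀ v : TangentSpace 𝓘(ℝ, E) q,
        ambientDeriv (fun q => ε • S q) q v = ε • ambientDeriv S q v := fun v =>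
      DFunLike.congr_fun (const_smul_mfderiv (h'.mdifferentiableAt (by simp)) ε) v
    rw [hd, hd, h, real_inner_smul_left, real_inner_smul_right, ← mul_assoc ε, hε2, one_mul]

theorem IsRoundQuotient.cotangentProj_smul (hϖ : IsRoundQuotient g r G ϖ) (hε : ε ∈ G)
    (hz : z.1 ≠ 0) : cotangentProj g r ϖ (ε • z) = cotangentProj g r ϖ z := by
  have hε2 : ε * ε = 1 := by rcases hϖ.sign ε hε with rfl | rfl <;> simp
  have hε0 : ε ≠ 0 := by rintro rfl; simp at hε2
  obtain ⟨S, hS⟩ := hϖ.exists_section z.1 hz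
  have hS' := hS.smul hϖ hε hz
  have hq : ϖ (ε • z.1) = ϖ z.1 := hϖ.apply_smul hε hz
  refine cotangentBundle_ext hq fun v => ?_
  have h1 := hS.sectionDeriv_eq hϖ hz
  have h2 := hS'.sectionDeriv_eq hϖ (smul_ne_zero hε0 hz)
  have h3 : ∀ q, q = ϖ z.1 → (ambientDeriv (E := E) (fun q => ε • S q) q : E →L[ℝ] V) v =
      ε • (ambientDeriv (E := E) S (ϖ z.1) : E →L[ℝ] V) v := by
    rintro q rfl
    exact DFunLike.congr_fun
      (const_smul_mfderiv (hS.smooth.self_of_nhds.mdifferentiableAt (by simp)) ε) v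
  have h4 : (sectionDeriv (E := E) g r ϖ (ε • z.1) : E →L[ℝ] V) v =
      ε • (sectionDeriv (E := E) g r ϖ z.1 : E →L[ℝ] V) v := by
    rw [h1, h2]
    exact h3 _ hq
  change ⟪ε • z.2, (sectionDeriv (E := E) g r ϖ (ε • z.1) : E →L[ℝ] V) v⟫ =
    ⟪z.2, (sectionDeriv (E := E) g r ϖ z.1 : E →L[ℝ] V) v⟫
  rw [h4, real_inner_smul_left, real_inner_smul_right, ← mul_assoc, hε2, one_mul]

end SignSymmetry

section CotangentQuotient

open scoped RealInnerProductSpace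

variable {V : Type*} [NormedAddCommGroup V] [InnerProductSpace ℝ V]
  {E : Type*} [NormedAddCommGroup E] [NormedSpace ℝ E]
  {L : Type*} [TopologicalSpace L] [ChartedSpace E L]

variable {g : ∀ x : L, TangentSpace 𝓘(ℝ, E) x → TangentSpace 𝓘(ℝ, E) x → ℝ} {r : ℝ} {G : Set ℝ}
  {ϖ : V → L} {x : V} {S S' : L → V} {z z' : V × V} {ε : ℝ}

theorem IsRoundSection.cotangentProj_snd (hϖ : IsRoundQuotient g r G ϖ) (hz : z.1 ≠ 0)
    (hS : IsRoundSection g r ϖ z.1 S) (v : TangentSpace 𝓘(ℝ, E) (ϖ z.1)) :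
    (cotangentProj g r ϖ z).2 v = ⟪z.2, ambientDeriv S (ϖ z.1) v⟫ := by
  rw [← hS.sectionDeriv_eq hϖ hz]
  rfl

/-- The length of the covector `(x, y)` is `|y| / r`: the supremum is attained at the vector which
lifts to `y / (r |y|)`. -/
theorem IsRoundQuotient.covectorLength_cotangentProj (hϖ : IsRoundQuotient g r G ϖ) (hr : 0 < r)
    (hz : z ∈ sphereCotangent V) : covectorLength g (cotangentProj g r ϖ z) = ‖z.2‖ / r := by
  have h0 := ne_zero_of_norm_eq_one hz.1
  obtain ⟨S, hS⟩ := hϖ.exists_section z.1 h0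
  refine IsGreatest.csSup_eq ⟨⟨modelDeriv (E := E) ϖ z.1 ((r * ‖z.2‖)⁻¹ • z.2), ?_, ?_⟩, ?_⟩
  · refine (hS.metric.self_of_nhds _ _).trans_le ?_
    rw [hS.ambientDeriv_modelDeriv hϖ hz.1, real_inner_smul_right, hz.2, mul_zero, zero_smul,
      sub_zero, real_inner_self_eq_norm_sq, norm_smul, norm_inv, norm_mul, norm_norm,
      Real.norm_eq_abs, abs_of_pos hr, ← mul_pow]
    refine pow_le_one₀ (by positivity) ?_
    rcases eq_or_ne ‖z.2‖ 0 with h | h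
    · simp [h]
    · field_simp
      rfl
  · refine (hS.cotangentProj_snd hϖ h0 _).trans ?_
    rw [hS.ambientDeriv_modelDeriv hϖ hz.1, real_inner_smul_right, hz.2, mul_zero, zero_smul,
      sub_zero, real_inner_smul_right, real_inner_self_eq_norm_sq]
    rcases eq_or_ne ‖z.2‖ 0 with h | h
    · simp [h]
    · field_simp
  · rintro s ⟨v, hv, rfl⟩
    have hv' := (hS.metric.self_of_nhds v v).symm.trans_le hv
    rw [real_inner_self_eq_norm_sq, ← mul_pow, sq_le_one_iff₀ (by positivity)] at hv'
    refine (hS.cotangentProj_snd hϖ h0 v).trans_le ((real_inner_le_norm _ _).trans ?_)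
    rw [le_div_iff₀ hr, mul_assoc]
    exact mul_le_of_le_one_right (norm_nonneg _) (by rwa [mul_comm])

theorem IsRoundQuotient.cotangentProj_mem_iff (hϖ : IsRoundQuotient g r G ϖ)
    (hz : z ∈ sphereCotangent V) :
    cotangentProj g r ϖ z ∈ nonzeroCovectors E L ↔ z.2 ≠ 0 := by
  have h0 := ne_zero_of_norm_eq_one hz.1
  obtain ⟨S, hS⟩ := hϖ.exists_section z.1 h0
  rw [nonzeroCovectors, Set.mem_ofPred_eq, not_iff_not]
  constructor
  · intro h
    have h1 := hS.cotangentProj_snd hϖ h0 (modelDeriv (E := E) ϖ z.1 z.2)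
    rw [hS.ambientDeriv_modelDeriv hϖ hz.1, hz.2, zero_smul, sub_zero] at h1
    have h2 : (cotangentProj g r ϖ z).2 (modelDeriv (E := E) ϖ z.1 z.2) = 0 :=
      DFunLike.congr_fun h _
    exact inner_self_eq_zero.1 (h1.symm.trans h2)
  · intro h
    refine ContinuousLinearMap.ext fun v => ?_
    refine (hS.cotangentProj_snd hϖ h0 v).trans ?_
    rw [h, inner_zero_left]
    rfl

end CotangentQuotient

section QuotientFlow

open scoped RealInnerProductSpace

variable {V : Type*} [NormedAddCommGroup V] [InnerProductSpace ℝ V] [CompleteSpace V]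
  {E : Type*} [NormedAddCommGroup E] [NormedSpace ℝ E]
  {L : Type*} [TopologicalSpace L] [ChartedSpace E L] [IsManifold 𝓘(ℝ, E) ∞ L]

variable {g : ∀ x : L, TangentSpace 𝓘(ℝ, E) x → TangentSpace 𝓘(ℝ, E) x → ℝ} {r : ℝ} {G : Set ℝ}
  {ϖ : V → L} {x : V} {S S' : L → V} {z z' : V × V} {ε : ℝ}

/-- The fibres of `cotangentProj` are the orbits of `G`. -/
theorem IsRoundQuotient.cotangentProj_eq_iff (hϖ : IsRoundQuotient g r G ϖ)
    (hz : z ∈ sphereCotangent V) (hz' : z' ∈ sphereCotangent V) :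
    cotangentProj g r ϖ z = cotangentProj g r ϖ z' ↔ ∃ ε ∈ G, z = ε • z' := by
  have h0' := ne_zero_of_norm_eq_one hz'.1
  constructor
  · intro h
    obtain ⟨ε, hε, h1⟩ := (hϖ.fibre _ _ hz.1 hz'.1).1 (congrArg (fun p => p.proj) h)
    have hε2 : ε * ε = 1 := by rcases hϖ.sign ε hε with rfl | rfl <;> simp
    refine ⟨ε, hε, ?_⟩
    rw [← hϖ.cotangentProj_smul hε h0'] at h
    -- Both lifts have the same base point, so the same section inverts `cotangentProj` at them.
    have hw : ε • z' ∈ sphereCotangent V := by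
      constructor
      · rw [Prod.smul_fst, ← h1, hz.1]
      · rw [Prod.smul_fst, Prod.smul_snd, real_inner_smul_left, real_inner_smul_right, hz'.2,
          mul_zero, mul_zero]
    obtain ⟨S, hS⟩ := hϖ.exists_section z.1 (ne_zero_of_norm_eq_one hz.1)
    have hS' : IsRoundSection g r ϖ (ε • z').1 S := by rwa [Prod.smul_fst, ← h1]
    rw [← (hS.isCotangentLift hϖ hz.1).apply_eq hz, h, (hS'.isCotangentLift hϖ hw.1).apply_eq hw]
  · rintro ⟨ε, hε, rfl⟩
    exact hϖ.cotangentProj_smul hε h0'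

omit [IsManifold 𝓘(ℝ, E) ∞ L] in
theorem IsRoundQuotient.exists_cotangentProj_eq (hϖ : IsRoundQuotient g r G ϖ)
    (p : CotangentBundle E L) : ∃ z ∈ sphereCotangent V, cotangentProj g r ϖ z = p := by
  obtain ⟨x, hx, hp⟩ := hϖ.surj p.proj
  obtain ⟨S, hS⟩ := hϖ.exists_section x (ne_zero_of_norm_eq_one hx)
  have hSp : S p.proj = x := by
    rw [← hp]
    simpa [hx] using hS.apply_eq hϖ (ne_zero_of_norm_eq_one hx)
  rw [← hSp] at hx hS hp
  exact ⟨_, hS.cotangentLift_mem hϖ hx, hS.cotangentProj_cotangentLift hϖ hx hp⟩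

omit [IsManifold 𝓘(ℝ, E) ∞ L] in
theorem IsRoundQuotient.mem_of_covectorLength_pos (hϖ : IsRoundQuotient g r G ϖ) (hr : 0 < r)
    {p : CotangentBundle E L}
    (hp : 0 < covectorLength g p) : p ∈ nonzeroCovectors E L := by
  obtain ⟨z, hz, rfl⟩ := hϖ.exists_cotangentProj_eq p
  rw [hϖ.covectorLength_cotangentProj hr hz] at hp
  rw [hϖ.cotangentProj_mem_iff hz]
  rintro h0
  simp [h0] at hp

variable (g r ϖ) in
/-- A representative in the cotangent bundle of the sphere of a covector of the quotient. -/
def cotangentRep (p : CotangentBundle E L) : V × V :=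
  Function.invFunOn (cotangentProj g r ϖ) (sphereCotangent V) p

variable (g r ϖ) in
/-- The flow on `T^*L` induced by `lengthFlow`. -/
def quotientFlow (t : ℝ) (p : CotangentBundle E L) : CotangentBundle E L :=
  cotangentProj g r ϖ (lengthFlow r t (cotangentRep g r ϖ p))

variable (g r ϖ) in
/-- The vector field on `T^*L` induced by `lengthField`. -/
def quotientField (p : CotangentBundle E L) : TangentSpace (cotangentModel E) p :=
  (cotangentProjDeriv (E := E) g r ϖ (cotangentRep g r ϖ p) (lengthField r (cotangentRep g r ϖ p)) :
    E × (E →L[ℝ] ℝ))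

omit [IsManifold 𝓘(ℝ, E) ∞ L] in
theorem IsRoundQuotient.cotangentRep_mem (hϖ : IsRoundQuotient g r G ϖ)
    (p : CotangentBundle E L) : cotangentRep g r ϖ p ∈ sphereCotangent V :=
  Function.invFunOn_mem (hϖ.exists_cotangentProj_eq p)

omit [IsManifold 𝓘(ℝ, E) ∞ L] in
theorem IsRoundQuotient.cotangentProj_cotangentRep (hϖ : IsRoundQuotient g r G ϖ)
    (p : CotangentBundle E L) : cotangentProj g r ϖ (cotangentRep g r ϖ p) = p :=
  Function.invFunOn_eq (hϖ.exists_cotangentProj_eq p)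

theorem IsRoundQuotient.exists_cotangentRep_eq (hϖ : IsRoundQuotient g r G ϖ)
    (hz : z ∈ sphereCotangent V) :
    ∃ ε ∈ G, cotangentRep g r ϖ (cotangentProj g r ϖ z) = ε • z :=
  (hϖ.cotangentProj_eq_iff (hϖ.cotangentRep_mem _) hz).1 (hϖ.cotangentProj_cotangentRep _)

omit [IsManifold 𝓘(ℝ, E) ∞ L] in
/-- To prove a property of all nonzero covectors, it suffices to consider those represented by
`(x, y)` with `y ≠ 0`. -/
theorem IsRoundQuotient.exists_rep_of_mem (hϖ : IsRoundQuotient g r G ϖ)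
    {p : CotangentBundle E L} (hp : p ∈ nonzeroCovectors E L) :
    ∃ z ∈ sphereCotangent V, z.2 ≠ 0 ∧ cotangentProj g r ϖ z = p := by
  obtain ⟨z, hz, rfl⟩ := hϖ.exists_cotangentProj_eq p
  exact ⟨z, hz, (hϖ.cotangentProj_mem_iff hz).1 hp, rfl⟩

theorem IsRoundQuotient.quotientFlow_cotangentProj (hϖ : IsRoundQuotient g r G ϖ)
    (hz : z ∈ sphereCotangent V) (h0 : z.2 ≠ 0) (t : ℝ) :
    quotientFlow g r ϖ t (cotangentProj g r ϖ z) = cotangentProj g r ϖ (lengthFlow r t z) := by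
  obtain ⟨ε, hε, h⟩ := hϖ.exists_cotangentRep_eq hz
  rw [quotientFlow, h, lengthFlow_smul (hϖ.sign ε hε), hϖ.cotangentProj_smul hε]
  exact ne_zero_of_norm_eq_one (lengthFlow_mem hz h0 t).1

theorem IsRoundQuotient.quotientField_cotangentProj (hϖ : IsRoundQuotient g r G ϖ)
    (hz : z ∈ sphereCotangent V) :
    quotientField g r ϖ (cotangentProj g r ϖ z) =
      cotangentProjDeriv (E := E) g r ϖ z (lengthField r z) := by
  obtain ⟨ε, hε, h⟩ := hϖ.exists_cotangentRep_eq hz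
  have h1 := ne_zero_of_norm_eq_one hz.1
  have hε2 : ε * ε = 1 := by rcases hϖ.sign ε hε with rfl | rfl <;> simp
  have hε1 : |ε| = 1 := by rcases hϖ.sign ε hε with rfl | rfl <;> simp
  have hε0 : ε ≠ 0 := by rintro rfl; simp at hε1
  have hsm : MDifferentiableAt 𝓘(ℝ, V × V) (cotangentModel E) (cotangentProj g r ϖ) (ε • z) :=
    (hϖ.contMDiffAt_cotangentProj (smul_ne_zero hε0 h1)).mdifferentiableAt (by simp)
  have hlin : MDifferentiableAt 𝓘(ℝ, V × V) 𝓘(ℝ, V × V) (fun w : V × V => ε • w) z :=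
    (differentiableAt_id.const_smul ε).mdifferentiableAt
  have h2 := mfderiv_comp z hsm hlin
  have h3 : cotangentProj g r ϖ ∘ (fun w : V × V => ε • w) =ᶠ[𝓝 z] cotangentProj g r ϖ := by
    filter_upwards [continuousAt_fst.eventually (eventually_ne_nhds h1)] with w hw
    exact hϖ.cotangentProj_smul hε hw
  rw [h3.mfderiv_eq, mfderiv_eq_fderiv] at h2
  have h4 : (cotangentProjDeriv (E := E) g r ϖ z (lengthField r z) : E × (E →L[ℝ] ℝ)) =
      (cotangentProjDeriv (E := E) g r ϖ (ε • z) (ε • lengthField r z) : E × (E →L[ℝ] ℝ)) := by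
    have h5 := DFunLike.congr_fun h2 (lengthField r z)
    have h6 : fderiv ℝ (fun w : V × V => ε • w) z (lengthField r z) = ε • lengthField r z := by
      have h := ((hasFDerivAt_id (𝕜 := ℝ) z).const_smul ε).fderiv
      exact (DFunLike.congr_fun h _).trans (by simp)
    refine Eq.trans h5 ?_
    exact congrArg (cotangentProjDeriv (E := E) g r ϖ (ε • z)) h6
  have h7 : lengthField r (ε • z) = ε • lengthField r z := by
    simp only [lengthField, Prod.smul_snd, Prod.smul_fst, norm_smul, Real.norm_eq_abs, hε1, one_mul]
    ext1
    · simp [smul_comm ε]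
    · simp [smul_comm ε]
  have h8 : ∀ w : V × V, w = ε • z →
      (cotangentProjDeriv (E := E) g r ϖ w (lengthField r w) : E × (E →L[ℝ] ℝ)) =
      (cotangentProjDeriv (E := E) g r ϖ (ε • z) (ε • lengthField r z) : E × (E →L[ℝ] ℝ)) := by
    rintro w rfl
    rw [h7]
  exact (h8 _ h).trans h4.symm

theorem IsRoundQuotient.isOpen_nonzeroCovectors (hϖ : IsRoundQuotient g r G ϖ) :
    IsOpen (nonzeroCovectors E L) := by
  rw [isOpen_iff_mem_nhds]
  intro p hp
  obtain ⟨z, hz, h0, rfl⟩ := hϖ.exists_rep_of_mem hp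
  obtain ⟨Φ, hΦ⟩ := hϖ.exists_isCotangentLift hz
  have h := (continuous_snd.continuousAt.comp hΦ.smooth.self_of_nhds.continuousAt).eventually
    (eventually_ne_nhds (b := 0) (by simpa [hΦ.apply_eq hz] using h0))
  filter_upwards [h, hΦ.mem, hΦ.right_inv] with p h1 h2 h3
  rw [← h3, hϖ.cotangentProj_mem_iff h2]
  exact h1

theorem IsRoundQuotient.isCompleteFlowOn_quotientFlow (hϖ : IsRoundQuotient g r G ϖ) :
    IsCompleteFlowOn (cotangentModel E) (nonzeroCovectors E L) (quotientField g r ϖ)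
      (quotientFlow g r ϖ) where
  mapsTo t p hp := by
    obtain ⟨z, hz, h0, rfl⟩ := hϖ.exists_rep_of_mem hp
    rw [hϖ.quotientFlow_cotangentProj hz h0, hϖ.cotangentProj_mem_iff (lengthFlow_mem hz h0 t),
      ← norm_ne_zero_iff, norm_lengthFlow_snd hz]
    exact norm_ne_zero_iff.2 h0
  zero p hp := by
    obtain ⟨z, hz, h0, rfl⟩ := hϖ.exists_rep_of_mem hp
    rw [hϖ.quotientFlow_cotangentProj hz h0, lengthFlow_zero]
  add s t p hp := by
    obtain ⟨z, hz, h0, rfl⟩ := hϖ.exists_rep_of_mem hp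
    have h1 : (lengthFlow r t z).2 ≠ 0 := by
      rw [← norm_ne_zero_iff, norm_lengthFlow_snd hz]; exact norm_ne_zero_iff.2 h0
    rw [hϖ.quotientFlow_cotangentProj hz h0, hϖ.quotientFlow_cotangentProj hz h0,
      hϖ.quotientFlow_cotangentProj (lengthFlow_mem hz h0 t) h1, lengthFlow_add hz h0]
  smooth := by
    rintro ⟨t, p⟩ ⟨-, hp⟩
    obtain ⟨z, hz, h0, rfl⟩ := hϖ.exists_rep_of_mem hp
    obtain ⟨Φ, hΦ⟩ := hϖ.exists_isCotangentLift hz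
    have hΦz := hΦ.apply_eq hz
    apply ContMDiffAt.contMDiffWithinAt
    have hsnd : Filter.Tendsto (fun q : ℝ × CotangentBundle E L => q.2)
        (𝓝 (t, cotangentProj g r ϖ z)) (𝓝 (cotangentProj g r ϖ z)) := continuousAt_snd
    have hΦ2 : ContMDiffAt (𝓘(ℝ, ℝ).prod (cotangentModel E)) 𝓘(ℝ, V × V) ∞
        (fun q : ℝ × CotangentBundle E L => Φ q.2) (t, cotangentProj g r ϖ z) :=
      ContMDiffAt.comp (t, cotangentProj g r ϖ z) hΦ.smooth.self_of_nhds contMDiffAt_snd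
    have hne : ∀ᶠ q : ℝ × CotangentBundle E L in 𝓝 (t, cotangentProj g r ϖ z), (Φ q.2).2 ≠ 0 := by
      have h := (continuous_snd.continuousAt.comp hΦ2.continuousAt)
      exact h.eventually (eventually_ne_nhds (by simpa [hΦz] using h0))
    have hev : (fun q : ℝ × CotangentBundle E L => quotientFlow g r ϖ q.1 q.2)
        =ᶠ[𝓝 (t, cotangentProj g r ϖ z)]
        fun q => cotangentProj g r ϖ (lengthFlow r q.1 (Φ q.2)) := by
      filter_upwards [hsnd.eventually hΦ.mem, hsnd.eventually hΦ.right_inv, hne] with q h1 h2 h3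
      rw [← hϖ.quotientFlow_cotangentProj h1 h3, h2]
    refine ContMDiffAt.congr_of_eventuallyEq ?_ hev
    refine ContMDiffAt.comp_of_eq (y := lengthFlow r t z)
      (hϖ.contMDiffAt_cotangentProj (ne_zero_of_norm_eq_one (lengthFlow_mem hz h0 t).1)) ?_
      (by simp [hΦz])
    refine ContMDiffAt.comp_of_eq (g := fun q : ℝ × (V × V) => lengthFlow r q.1 q.2)
      (f := fun q : ℝ × CotangentBundle E L => (q.1, Φ q.2)) (y := (t, z))
      (contDiffAt_lengthFlow r t h0).contMDiffAt ?_ (by simp [hΦz])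
    exact contMDiffAt_fst.prodMk_space hΦ2
  integral p hp t := by
    obtain ⟨z, hz, h0, rfl⟩ := hϖ.exists_rep_of_mem hp
    have hzt := lengthFlow_mem (r := r) hz h0 t
    have h1 := (hϖ.mdifferentiableAt_cotangentProj hzt).hasMFDerivAt.comp t
      (hasDerivAt_lengthFlow (r := r) hz h0 t).hasFDerivAt.hasMFDerivAt
    have h2 : (fun t => quotientFlow g r ϖ t (cotangentProj g r ϖ z)) =
        cotangentProj g r ϖ ∘ fun t => lengthFlow r t z :=
      funext fun t => hϖ.quotientFlow_cotangentProj hz h0 t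
    have h3 : ∀ f : ℝ → CotangentBundle E L, f = cotangentProj g r ϖ ∘ (fun t => lengthFlow r t z) →
        HasMFDerivAt 𝓘(ℝ, ℝ) (cotangentModel E) f t
          ((1 : ℝ →L[ℝ] ℝ).smulRight (quotientField g r ϖ (f t))) := by
      rintro f rfl
      have h4 := hϖ.quotientField_cotangentProj hzt
      have h5 : ∀ s : ℝ, (s • (quotientField g r ϖ (cotangentProj g r ϖ (lengthFlow r t z)) :
          E × (E →L[ℝ] ℝ)) : E × (E →L[ℝ] ℝ)) = (cotangentProjDeriv (E := E) g r ϖ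
            (lengthFlow r t z) (s • lengthField r (lengthFlow r t z)) : E × (E →L[ℝ] ℝ)) := by
        intro s
        rw [map_smul, h4]
      refine h1.congr_mfderiv (ContinuousLinearMap.ext fun s : ℝ => ?_)
      refine Eq.trans ?_ (h5 s).symm
      exact congrArg (cotangentProjDeriv (E := E) g r ϖ (lengthFlow r t z)) rfl
    exact h3 _ h2

end QuotientFlow

/-! ### The Hamiltonian vector field and the contact level sets -/

section Hamiltonian

open scoped RealInnerProductSpace

variable {V : Type*} [NormedAddCommGroup V] [InnerProductSpace ℝ V] [CompleteSpace V]
  {E : Type*} [NormedAddCommGroup E] [NormedSpace ℝ E]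
  {L : Type*} [TopologicalSpace L] [ChartedSpace E L] [IsManifold 𝓘(ℝ, E) ∞ L]

variable {g : ∀ x : L, TangentSpace 𝓘(ℝ, E) x → TangentSpace 𝓘(ℝ, E) x → ℝ} {r : ℝ} {G : Set ℝ}
  {ϖ : V → L} {z : V × V} {ε : ℝ} {Φ : CotangentBundle E L → V × V}

/-- The differential at `p` of a function on `T^*L`, as a real-valued linear map. -/
def realDeriv (f : CotangentBundle E L → ℝ) (p : CotangentBundle E L) :
    TangentSpace (cotangentModel E) p →L[ℝ] ℝ :=
  mfderiv (cotangentModel E) 𝓘(ℝ, ℝ) f p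

omit [CompleteSpace V] in
theorem hasFDerivAt_length (r : ℝ) (h0 : z.2 ≠ 0) :
    HasFDerivAt (fun w : V × V => ‖w.2‖ / r)
      ((1 / (r * ‖z.2‖)) • (innerSL ℝ z.2).comp (ContinuousLinearMap.snd ℝ V V)) z := by
  have h1 := (hasFDerivAt_snd (𝕜 := ℝ) (p := z)).norm_sq.sqrt (by simpa using h0)
  simp only [Real.sqrt_sq (norm_nonneg _)] at h1
  have h2 := h1.mul_const r⁻¹
  refine (h2.congr_fderiv ?_).congr_of_eventuallyEq (Filter.Eventually.of_forall fun w => ?_)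
  · ext <;> simp
    field_simp
  · exact div_eq_mul_inv _ _

omit [CompleteSpace V] in
theorem IsCotangentLift.covectorLength_eventuallyEq (hϖ : IsRoundQuotient g r G ϖ) (hr : 0 < r)
    (hΦ : IsCotangentLift g r ϖ z Φ) :
    covectorLength g =ᶠ[𝓝 (cotangentProj g r ϖ z)] (fun w : V × V => ‖w.2‖ / r) ∘ Φ := by
  filter_upwards [hΦ.mem, hΦ.right_inv] with p h1 h2
  conv_lhs => rw [← h2]
  exact hϖ.covectorLength_cotangentProj hr h1

theorem IsRoundQuotient.contMDiffAt_covectorLength (hϖ : IsRoundQuotient g r G ϖ) (hr : 0 < r)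
    {p : CotangentBundle E L} (hp : p ∈ nonzeroCovectors E L) :
    ContMDiffAt (cotangentModel E) 𝓘(ℝ, ℝ) ∞ (covectorLength g) p := by
  obtain ⟨z, hz, h0, rfl⟩ := hϖ.exists_rep_of_mem hp
  obtain ⟨Φ, hΦ⟩ := hϖ.exists_isCotangentLift hz
  refine ContMDiffAt.congr_of_eventuallyEq ?_ (hΦ.covectorLength_eventuallyEq hϖ hr)
  refine ContMDiffAt.comp_of_eq (y := z) ?_ hΦ.smooth.self_of_nhds (hΦ.apply_eq hz)
  exact ((contDiffAt_snd.norm ℝ h0).div_const r).contMDiffAt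

omit [CompleteSpace V] in
theorem IsCotangentLift.realDeriv_covectorLength (hϖ : IsRoundQuotient g r G ϖ) (hr : 0 < r)
    (hz : z ∈ sphereCotangent V) (h0 : z.2 ≠ 0) (hΦ : IsCotangentLift g r ϖ z Φ)
    (v : TangentSpace (cotangentModel E) (cotangentProj g r ϖ z)) :
    realDeriv (covectorLength g) (cotangentProj g r ϖ z) v =
      ⟪z.2, (liftDeriv Φ (cotangentProj g r ϖ z) v).2⟫ / (r * ‖z.2‖) := by
  have h1 := hasFDerivAt_length r h0
  have h2 := mfderiv_comp_liftDeriv hΦ.mdifferentiableAt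
    (f := fun w : V × V => ‖w.2‖ / r) (by rw [hΦ.apply_eq hz]; exact h1.differentiableAt) v
  rw [hΦ.apply_eq hz, h1.fderiv] at h2
  have h3 : realDeriv (covectorLength g) (cotangentProj g r ϖ z) =
      realDeriv ((fun w : V × V => ‖w.2‖ / r) ∘ Φ) (cotangentProj g r ϖ z) :=
    (hΦ.covectorLength_eventuallyEq hϖ hr).mfderiv_eq
  rw [h3]
  refine Eq.trans h2 ?_
  simp only [smul_apply, ContinuousLinearMap.comp_apply, smul_eq_mul,
    innerSL_apply_apply, ContinuousLinearMap.coe_snd']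
  ring

omit [CompleteSpace V] in
theorem IsCotangentLift.canonicalForm_eq (hΦ : IsCotangentLift g r ϖ z Φ)
    (v w : TangentSpace (cotangentModel E) (cotangentProj g r ϖ z)) :
    canonicalForm (cotangentProj g r ϖ z) v w =
      ⟪(liftDeriv Φ (cotangentProj g r ϖ z) w).2, (liftDeriv Φ (cotangentProj g r ϖ z) v).1⟫ -
      ⟪(liftDeriv Φ (cotangentProj g r ϖ z) v).2, (liftDeriv Φ (cotangentProj g r ϖ z) w).1⟫ := by
  rw [canonicalForm, hΦ.exteriorDerivative_eq, neg_sub]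

/-- In the coordinates `(x, y)` the Hamiltonian equation for `|y| / r` is solved by `lengthField`. -/
theorem IsRoundQuotient.isHamiltonianVectorField (hϖ : IsRoundQuotient g r G ϖ) (hr : 0 < r) :
    IsHamiltonianVectorField (cotangentModel E) canonicalForm (nonzeroCovectors E L)
      (covectorLength g) (quotientField g r ϖ) where
  smooth p hp := (hϖ.contMDiffAt_covectorLength hr hp).contMDiffWithinAt
  eq p hp v := by
    obtain ⟨z, hz, h0, rfl⟩ := hϖ.exists_rep_of_mem hp
    obtain ⟨Φ, hΦ⟩ := hϖ.exists_isCotangentLift hz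
    refine (hΦ.realDeriv_covectorLength hϖ hr hz h0 v).trans ?_
    rw [hΦ.canonicalForm_eq,
      hϖ.quotientField_cotangentProj hz,
      hΦ.liftDeriv_cotangentProjDeriv hϖ hz (lengthField_mem hz h0)]
    have h1 := (hΦ.liftDeriv_mem hz v).1
    have h3 : ‖z.2‖ ≠ 0 := norm_ne_zero_iff.2 h0
    simp only [lengthField, real_inner_smul_left, real_inner_smul_right, h1]
    rw [real_inner_comm]
    field_simp
    ring

/-- The canonical form is nondegenerate. -/
theorem IsRoundQuotient.eq_zero_of_canonicalForm_eq_zero (hϖ : IsRoundQuotient g r G ϖ)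
    (p : CotangentBundle E L) (v : TangentSpace (cotangentModel E) p)
    (h : ∀ w, canonicalForm p v w = 0) : v = 0 := by
  obtain ⟨z, hz, rfl⟩ := hϖ.exists_cotangentProj_eq p
  obtain ⟨Φ, hΦ⟩ := hϖ.exists_isCotangentLift hz
  have hxx : ⟪z.1, z.1⟫ = 1 := by rw [real_inner_self_eq_norm_sq, hz.1, one_pow]
  rw [← hΦ.cotangentProjDeriv_liftDeriv hϖ hz v]
  have hv := hΦ.liftDeriv_mem hz v
  have key : ∀ b ∈ sphereCotangentTangent z,
      ⟪b.2, (liftDeriv Φ (cotangentProj g r ϖ z) v).1⟫ =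
        ⟪(liftDeriv Φ (cotangentProj g r ϖ z) v).2, b.1⟫ := by
    intro b hb
    have h1 := h (cotangentProjDeriv g r ϖ z b)
    rw [hΦ.canonicalForm_eq, hΦ.liftDeriv_cotangentProjDeriv hϖ hz hb] at h1
    linarith
  generalize liftDeriv Φ (cotangentProj g r ϖ z) v = a at hv key ⊢
  have ha1 : a.1 = 0 := by
    have h1 := key (0, a.1) ⟨inner_zero_right _, by simp [hv.1]⟩
    simpa using h1
  have ha2 : a.2 = 0 := by
    have hv2 : ⟪z.1, a.2⟫ = 0 := by have := hv.2; rw [ha1] at this; simpa using this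
    have h1 := key (a.2, -⟪z.2, a.2⟫ • z.1)
      ⟨hv2, by rw [real_inner_smul_right, hxx]; ring⟩
    rw [ha1, inner_zero_right] at h1
    exact inner_self_eq_zero.1 h1.symm
  have ha : a = 0 := Prod.ext ha1 ha2
  rw [ha, map_zero]

theorem IsRoundQuotient.hamiltonianVectorField_unique (hϖ : IsRoundQuotient g r G ϖ) (hr : 0 < r)
    {Y : ∀ p : CotangentBundle E L, TangentSpace (cotangentModel E) p}
    (hY : IsHamiltonianVectorField (cotangentModel E) canonicalForm (nonzeroCovectors E L)
      (covectorLength g) Y) {p : CotangentBundle E L} (hp : p ∈ nonzeroCovectors E L) :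
    Y p = quotientField g r ϖ p := by
  rw [← sub_eq_zero]
  refine hϖ.eq_zero_of_canonicalForm_eq_zero p _ fun w => ?_
  have h1 : realDeriv (covectorLength g) p w = - canonicalForm p (Y p) w := hY.eq p hp w
  have h2 : realDeriv (covectorLength g) p w = - canonicalForm p (quotientField g r ϖ p) w :=
    (hϖ.isHamiltonianVectorField hr).eq p hp w
  obtain ⟨z, hz, h0, rfl⟩ := hϖ.exists_rep_of_mem hp
  obtain ⟨Φ, hΦ⟩ := hϖ.exists_isCotangentLift hz
  rw [hΦ.canonicalForm_eq] at h1 h2 ⊢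
  rw [map_sub, Prod.fst_sub, Prod.snd_sub, inner_sub_left, inner_sub_right]
  linarith

/-- The level sets are the zero sets of `h - a` on the open set of nonzero covectors. At `(x, y)` the
tangent vectors `(a, b)` of the level set in the kernel of the Liouville form are those with
`a ⟂ y` and `b ⟂ y`, and they are then orthogonal to `x` as well. -/
theorem IsRoundQuotient.isContactHypersurface (hϖ : IsRoundQuotient g r G ϖ) (hr : 0 < r) {a : ℝ}
    (ha : 0 < a) :
    IsContactHypersurface (cotangentModel E) liouvilleForm
      {p : CotangentBundle E L | covectorLength g p = a} := by
  have hU : ∀ p : CotangentBundle E L, covectorLength g p = a → p ∈ nonzeroCovectors E L := by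
    intro p hp
    exact hϖ.mem_of_covectorLength_pos hr (by rwa [hp])
  have hderiv : ∀ p ∈ nonzeroCovectors E L,
      realDeriv (fun p => covectorLength g p - a) p = realDeriv (covectorLength g) p := by
    intro p hp
    have h := (hϖ.contMDiffAt_covectorLength hr hp).mdifferentiableAt (by simp)
    have h2 := (h.hasMFDerivAt.sub (hasMFDerivAt_const a p)).mfderiv
    exact h2.trans (sub_zero (realDeriv (covectorLength g) p))
  intro p hp
  refine ⟨nonzeroCovectors E L, fun p => covectorLength g p - a, hϖ.isOpen_nonzeroCovectors,
    hU p hp, ?_, ?_, ?_, ?_⟩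
  · intro q hq
    exact ((hϖ.contMDiffAt_covectorLength hr hq).sub contMDiffAt_const).contMDiffWithinAt
  · intro q hq h
    replace h : realDeriv (covectorLength g) q = 0 := (hderiv q hq).symm.trans h
    obtain ⟨z, hz, h0, rfl⟩ := hϖ.exists_rep_of_mem hq
    obtain ⟨Φ, hΦ⟩ := hϖ.exists_isCotangentLift hz
    -- The differential of the length does not vanish on the tangent vector `(0, y)`.
    have hb : ((0, z.2) : V × V) ∈ sphereCotangentTangent z := by
      constructor <;> simp [hz.2]
    have h1 := hΦ.realDeriv_covectorLength hϖ hr hz h0 (cotangentProjDeriv g r ϖ z (0, z.2))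
    rw [hΦ.liftDeriv_cotangentProjDeriv hϖ hz hb, h] at h1
    have h3 : ‖z.2‖ ≠ 0 := norm_ne_zero_iff.2 h0
    have h4 : (0 : ℝ) = ⟪z.2, z.2⟫ / (r * ‖z.2‖) := h1
    rw [real_inner_self_eq_norm_sq] at h4
    have : 0 < ‖z.2‖ ^ 2 / (r * ‖z.2‖) := by positivity
    linarith
  · intro q _
    exact sub_eq_zero.symm
  · rintro q ⟨-, hq⟩
    change (∃ v, realDeriv (fun p => covectorLength g p - a) q v = 0 ∧ liouvilleForm q v ≠ 0) ∧
      ∀ v, realDeriv (fun p => covectorLength g p - a) q v = 0 → liouvilleForm q v = 0 →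
        (∀ w, realDeriv (fun p => covectorLength g p - a) q w = 0 → liouvilleForm q w = 0 →
          exteriorDerivative (cotangentModel E) liouvilleForm q v w = 0) → v = 0
    rw [hderiv q hq]
    obtain ⟨z, hz, h0, rfl⟩ := hϖ.exists_rep_of_mem hq
    obtain ⟨Φ, hΦ⟩ := hϖ.exists_isCotangentLift hz
    have hxx : ⟪z.1, z.1⟫ = 1 := by rw [real_inner_self_eq_norm_sq, hz.1, one_pow]
    have h3 : ‖z.2‖ ≠ 0 := norm_ne_zero_iff.2 h0
    have hker : ∀ v, realDeriv (covectorLength g) (cotangentProj g r ϖ z) v = 0 ↔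
        ⟪z.2, (liftDeriv Φ (cotangentProj g r ϖ z) v).2⟫ = 0 := by
      intro v
      rw [hΦ.realDeriv_covectorLength hϖ hr hz h0, div_eq_zero_iff]
      exact or_iff_left (mul_ne_zero hr.ne' h3)
    constructor
    · -- The lift of the geodesic through `(x, y)` stays in the level set, and its direction is
      -- not in the kernel of the Liouville form.
      have hb : ((z.2, -⟪z.2, z.2⟫ • z.1) : V × V) ∈ sphereCotangentTangent z := by
        constructor
        · exact hz.2
        · simp only [real_inner_smul_right, hxx]; ring
      refine ⟨cotangentProjDeriv g r ϖ z (z.2, -⟪z.2, z.2⟫ • z.1), ?_, ?_⟩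
      · rw [hker, hΦ.liftDeriv_cotangentProjDeriv hϖ hz hb, real_inner_smul_right,
          real_inner_comm z.1, hz.2, mul_zero]
      · rw [hΦ.liouvilleForm_eq hz, hΦ.liftDeriv_cotangentProjDeriv hϖ hz hb]
        exact fun h => h0 (inner_self_eq_zero.1 h)
    · intro v hv1 hv2 hv3
      rw [hker] at hv1
      rw [hΦ.liouvilleForm_eq hz] at hv2
      rw [← hΦ.cotangentProjDeriv_liftDeriv hϖ hz v]
      have hv := hΦ.liftDeriv_mem hz v
      have key : ∀ b ∈ sphereCotangentTangent z, ⟪z.2, b.2⟫ = 0 → ⟪z.2, b.1⟫ = 0 →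
          ⟪(liftDeriv Φ (cotangentProj g r ϖ z) v).2, b.1⟫ -
            ⟪b.2, (liftDeriv Φ (cotangentProj g r ϖ z) v).1⟫ = 0 := by
        intro b hb hb2 hb1
        have h1 := hv3 (cotangentProjDeriv g r ϖ z b)
        rw [hker, hΦ.liouvilleForm_eq hz, hΦ.exteriorDerivative_eq,
          hΦ.liftDeriv_cotangentProjDeriv hϖ hz hb] at h1
        exact h1 hb2 hb1
      generalize liftDeriv Φ (cotangentProj g r ϖ z) v = b at hv1 hv2 hv key ⊢
      -- `(b.2, -b.1)` is again tangent, and pairing with it gives `|b.1| ^ 2 + |b.2| ^ 2`.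
      have h1 := key (b.2, -b.1) ⟨by have := hv.2; linarith, by
        rw [inner_neg_right, hv.1, hv1]; simp⟩ (by rw [inner_neg_right, hv2, neg_zero]) hv1
      rw [inner_neg_left, real_inner_self_eq_norm_sq, real_inner_self_eq_norm_sq] at h1
      have hb1 : b.1 = 0 := by
        rw [← norm_eq_zero]; nlinarith [sq_nonneg ‖b.1‖, sq_nonneg ‖b.2‖]
      have hb2 : b.2 = 0 := by
        rw [← norm_eq_zero]; nlinarith [sq_nonneg ‖b.1‖, sq_nonneg ‖b.2‖]
      have hb : b = 0 := Prod.ext hb1 hb2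
      rw [hb, map_zero]

end Hamiltonian

/-! ### The circle action -/

section CircleAction

open scoped RealInnerProductSpace

variable {V : Type*} [NormedAddCommGroup V] [InnerProductSpace ℝ V] [CompleteSpace V]
  {E : Type*} [NormedAddCommGroup E] [NormedSpace ℝ E]
  {L : Type*} [TopologicalSpace L] [ChartedSpace E L] [IsManifold 𝓘(ℝ, E) ∞ L]

variable {g : ∀ x : L, TangentSpace 𝓘(ℝ, E) x → TangentSpace 𝓘(ℝ, E) x → ℝ} {r : ℝ} {G : Set ℝ}
  {ϖ : V → L} {z : V × V} {T : ℝ} {p : CotangentBundle E L}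

/-- The hypothesis `hT` describes the times at which the rotation by `t / r` is a sign in `G`. -/
theorem IsRoundQuotient.quotientFlow_eq_self_iff (hϖ : IsRoundQuotient g r G ϖ)
    (hT : ∀ t : ℝ, (∃ ε ∈ G, Real.cos (t / r) = ε ∧ Real.sin (t / r) = 0) ↔ ∃ k : ℤ, t = k * T)
    (hp : p ∈ nonzeroCovectors E L) (t : ℝ) :
    quotientFlow g r ϖ t p = p ↔ ∃ k : ℤ, t = k * T := by
  obtain ⟨z, hz, h0, rfl⟩ := hϖ.exists_rep_of_mem hp
  rw [hϖ.quotientFlow_cotangentProj hz h0, hϖ.cotangentProj_eq_iff (lengthFlow_mem hz h0 t) hz,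
    ← hT]
  simp only [lengthFlow_eq_smul_iff hz h0]

theorem IsRoundQuotient.covectorLength_quotientFlow (hϖ : IsRoundQuotient g r G ϖ) (hr : 0 < r)
    (hp : p ∈ nonzeroCovectors E L) (t : ℝ) :
    covectorLength g (quotientFlow g r ϖ t p) = covectorLength g p := by
  obtain ⟨z, hz, h0, rfl⟩ := hϖ.exists_rep_of_mem hp
  rw [hϖ.quotientFlow_cotangentProj hz h0, hϖ.covectorLength_cotangentProj hr hz,
    hϖ.covectorLength_cotangentProj hr (lengthFlow_mem hz h0 t), norm_lengthFlow_snd hz]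

/-- The flow is by symplectomorphisms. -/
theorem IsRoundQuotient.canonicalForm_quotientFlow (hϖ : IsRoundQuotient g r G ϖ)
    (hp : p ∈ nonzeroCovectors E L) (t : ℝ) (v w : TangentSpace (cotangentModel E) p) :
    canonicalForm (quotientFlow g r ϖ t p)
      (mfderiv (cotangentModel E) (cotangentModel E) (quotientFlow g r ϖ t) p v)
      (mfderiv (cotangentModel E) (cotangentModel E) (quotientFlow g r ϖ t) p w) =
      canonicalForm p v w := by
  have hsm : MDifferentiableAt (cotangentModel E) (cotangentModel E) (quotientFlow g r ϖ t) p := by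
    have h1 := hϖ.isCompleteFlowOn_quotientFlow.smooth.contMDiffAt (x := (t, p))
      ((isOpen_univ.prod hϖ.isOpen_nonzeroCovectors).mem_nhds ⟨trivial, hp⟩)
    have h2 : ContMDiffAt (cotangentModel E) (cotangentModel E) ∞ (quotientFlow g r ϖ t) p :=
      ContMDiffAt.comp p (g := fun q : ℝ × CotangentBundle E L => quotientFlow g r ϖ q.1 q.2)
        (f := fun p => (t, p)) h1 (contMDiffAt_const.prodMk contMDiffAt_id)
    exact h2.mdifferentiableAt (by simp)
  obtain ⟨z, hz, h0, rfl⟩ := hϖ.exists_rep_of_mem hp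
  have hz' := lengthFlow_mem (r := r) hz h0 t
  obtain ⟨Φ, hΦ⟩ := hϖ.exists_isCotangentLift hz
  obtain ⟨Φ', hΦ'⟩ := hϖ.exists_isCotangentLift hz'
  have hq := hϖ.quotientFlow_cotangentProj hz h0 t
  have hΦz := hΦ.apply_eq hz
  have hfl : ContDiffAt ℝ ∞ (lengthFlow r t) z :=
    (contDiffAt_lengthFlow r t h0).comp z (f := fun z => (t, z)) (by fun_prop)
  -- The two lifts intertwine the flow on `T^*L` with `lengthFlow`.
  have hev : Φ' ∘ quotientFlow g r ϖ t =ᶠ[𝓝 (cotangentProj g r ϖ z)] lengthFlow r t ∘ Φ := by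
    have hc : Filter.Tendsto Φ (𝓝 (cotangentProj g r ϖ z)) (𝓝 z) := by
      have h := hΦ.smooth.self_of_nhds.continuousAt
      rwa [ContinuousAt, hΦz] at h
    filter_upwards [hΦ.mem, hΦ.right_inv,
      hc.eventually (continuousAt_snd.eventually (eventually_ne_nhds h0)),
      hc.eventually (hfl.continuousAt.eventually hΦ'.left_inv)] with q h1 h2 h3 h4
    change Φ' (quotientFlow g r ϖ t q) = lengthFlow r t (Φ q)
    conv_lhs => rw [← h2]
    rw [hϖ.quotientFlow_cotangentProj h1 h3, h4, sphereRetraction_of_mem (lengthFlow_mem h1 h3 t)]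
  have hd : ∀ v : TangentSpace (cotangentModel E) (cotangentProj g r ϖ z),
      liftDeriv Φ' (quotientFlow g r ϖ t (cotangentProj g r ϖ z))
        (mfderiv (cotangentModel E) (cotangentModel E) (quotientFlow g r ϖ t)
          (cotangentProj g r ϖ z) v) =
      fderiv ℝ (lengthFlow r t) z (liftDeriv Φ (cotangentProj g r ϖ z) v) := by
    intro v
    have h1 : MDifferentiableAt (cotangentModel E) 𝓘(ℝ, V × V) Φ'
        (quotientFlow g r ϖ t (cotangentProj g r ϖ z)) := by
      rw [hq]; exact hΦ'.mdifferentiableAt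
    have h2 := mfderiv_comp (cotangentProj g r ϖ z) h1 hsm
    have h3 := mfderiv_comp_liftDeriv hΦ.mdifferentiableAt (f := lengthFlow r t)
      (by rw [hΦz]; exact hfl.differentiableAt (by simp)) v
    rw [hev.mfderiv_eq] at h2
    rw [hΦz] at h3
    exact (DFunLike.congr_fun h2 v).symm.trans h3
  have hcan : ∀ q : CotangentBundle E L, q = cotangentProj g r ϖ (lengthFlow r t z) →
      ∀ a b : TangentSpace (cotangentModel E) q, canonicalForm q a b =
        ⟪(liftDeriv Φ' q b).2, (liftDeriv Φ' q a).1⟫ -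
          ⟪(liftDeriv Φ' q a).2, (liftDeriv Φ' q b).1⟫ := by
    rintro q rfl a b
    exact hΦ'.canonicalForm_eq a b
  rw [hcan _ hq, hd, hd, hΦ.canonicalForm_eq]
  have h := lengthFlow_symplectic (r := r) hz h0 t (hΦ.liftDeriv_mem hz v) (hΦ.liftDeriv_mem hz w)
  linarith

variable (g r ϖ) in
/-- The action of the circle `ℝ / Tℤ` induced by the flow `quotientFlow`: the time is the one that
corresponds to the argument of `c` in `(-π, π]`. Where the flow has period `T`, any other choice of
the argument gives the same value. -/
def quotientAction (T : ℝ) (c : Circle) (p : CotangentBundle E L) : CotangentBundle E L :=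
  quotientFlow g r ϖ (T * Complex.arg c / (2 * Real.pi)) p

theorem IsRoundQuotient.quotientAction_exp (hϖ : IsRoundQuotient g r G ϖ) (hT0 : T ≠ 0)
    (hT : ∀ t : ℝ, (∃ ε ∈ G, Real.cos (t / r) = ε ∧ Real.sin (t / r) = 0) ↔ ∃ k : ℤ, t = k * T)
    (hp : p ∈ nonzeroCovectors E L) (t : ℝ) :
    quotientAction g r ϖ T (Circle.exp (2 * Real.pi * t / T)) p = quotientFlow g r ϖ t p := by
  have h1 := Circle.exp_arg (Circle.exp (2 * Real.pi * t / T))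
  rw [Circle.exp_eq_exp] at h1
  obtain ⟨m, hm⟩ := h1
  have h2 : T * (2 * Real.pi * t / T + m * (2 * Real.pi)) / (2 * Real.pi) = t + m * T := by
    field_simp
  rw [quotientAction, hm, h2, hϖ.isCompleteFlowOn_quotientFlow.add _ _ p hp,
    (hϖ.quotientFlow_eq_self_iff hT hp _).2 ⟨m, rfl⟩]

theorem exp_two_pi_mul_div (hT0 : T ≠ 0) (c : Circle) :
    Circle.exp (2 * Real.pi * (T * Complex.arg c / (2 * Real.pi)) / T) = c := by
  conv_rhs => rw [← Circle.exp_arg c]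
  congr 1
  field_simp

/-- The argument is smooth near `1`, hence `c ↦ arg (c / c₀)` is smooth near `c₀`, also where the
argument itself jumps. -/
theorem contMDiffAt_arg_mul_inv (c₀ : Circle) :
    ContMDiffAt (𝓡 1) 𝓘(ℝ, ℝ) ∞ (fun c : Circle => Complex.arg (c * c₀⁻¹ : Circle)) c₀ := by
  have h1 : ContDiffAt ℝ ∞ (fun w : ℂ => Complex.arg (w * (c₀⁻¹ : Circle))) (c₀ : ℂ) := by
    have h2 : ContDiffAt ℝ ∞ Complex.log ((c₀ : ℂ) * (c₀⁻¹ : Circle)) := by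
      refine (Complex.contDiffAt_log ?_).restrict_scalars ℝ
      rw [← Circle.coe_mul, mul_inv_cancel]
      simp
    refine (Complex.imCLM.contDiff.contDiffAt.comp (c₀ : ℂ) (ContDiffAt.comp (c₀ : ℂ)
      (f := fun w : ℂ => w * (c₀⁻¹ : Circle)) h2 (by fun_prop))).congr_of_eventuallyEq ?_
    exact Filter.Eventually.of_forall fun w => (Complex.log_im _).symm
  have := Fact.mk Complex.finrank_real_complex
  have h3 : ContMDiffAt (𝓡 1) 𝓘(ℝ, ℂ) ∞ (fun c : Circle => (c : ℂ)) c₀ :=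
    contMDiff_coe_sphere c₀
  exact ContMDiffAt.comp c₀ h1.contMDiffAt h3

theorem IsRoundQuotient.isHamiltonianCircleAction (hϖ : IsRoundQuotient g r G ϖ) (hr : 0 < r)
    (hT0 : T ≠ 0)
    (hT : ∀ t : ℝ, (∃ ε ∈ G, Real.cos (t / r) = ε ∧ Real.sin (t / r) = 0) ↔ ∃ k : ℤ, t = k * T) :
    IsHamiltonianCircleAction (cotangentModel E) canonicalForm (nonzeroCovectors E L) T
      (covectorLength g) (quotientAction g r ϖ T) where
  mapsTo c := hϖ.isCompleteFlowOn_quotientFlow.mapsTo _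
  one p hp := by
    simpa [quotientAction] using hϖ.isCompleteFlowOn_quotientFlow.zero p hp
  mul c d p hp := by
    set s := T * Complex.arg c / (2 * Real.pi) with hs
    set t := T * Complex.arg d / (2 * Real.pi) with ht
    have h : c * d = Circle.exp (2 * Real.pi * (s + t) / T) := by
      rw [mul_add, add_div, Circle.exp_add, hs, ht, exp_two_pi_mul_div hT0, exp_two_pi_mul_div hT0]
    rw [h, hϖ.quotientAction_exp hT0 hT hp, hϖ.isCompleteFlowOn_quotientFlow.add _ _ p hp]
    rfl
  smooth := by
    rintro ⟨c₀, p₀⟩ ⟨-, hp₀⟩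
    apply ContMDiffAt.contMDiffWithinAt
    set t₀ := T * Complex.arg c₀ / (2 * Real.pi) with ht₀
    -- A smooth choice near `c₀` of the time that corresponds to a point of the circle.
    let τ : Circle → ℝ := fun c => T * Complex.arg (c * c₀⁻¹ : Circle) / (2 * Real.pi) + t₀
    have hτ : ∀ c, Circle.exp (2 * Real.pi * τ c / T) = c := by
      intro c
      rw [mul_add, add_div, Circle.exp_add, ht₀, exp_two_pi_mul_div hT0, exp_two_pi_mul_div hT0,
        inv_mul_cancel_right]
    have hτ0 : ContMDiffAt (𝓡 1) 𝓘(ℝ, ℝ) ∞ τ c₀ := by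
      have h1 : ContDiffAt ℝ ∞ (fun s : ℝ => T * s / (2 * Real.pi) + t₀)
        (Complex.arg (c₀ * c₀⁻¹ : Circle)) := by fun_prop
      exact ContMDiffAt.comp c₀ h1.contMDiffAt (contMDiffAt_arg_mul_inv c₀)
    have h1 := hϖ.isCompleteFlowOn_quotientFlow.smooth.contMDiffAt (x := (τ c₀, p₀))
      ((isOpen_univ.prod hϖ.isOpen_nonzeroCovectors).mem_nhds ⟨trivial, hp₀⟩)
    have h2 : ContMDiffAt ((𝓡 1).prod (cotangentModel E)) (𝓘(ℝ, ℝ).prod (cotangentModel E)) ∞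
        (fun q : Circle × CotangentBundle E L => (τ q.1, q.2)) (c₀, p₀) :=
      (ContMDiffAt.comp (c₀, p₀) hτ0 contMDiffAt_fst).prodMk contMDiffAt_snd
    refine ContMDiffAt.congr_of_eventuallyEq (ContMDiffAt.comp (c₀, p₀) h1 h2) ?_
    filter_upwards [continuousAt_snd.eventually (hϖ.isOpen_nonzeroCovectors.mem_nhds hp₀)] with q hq
    change quotientAction g r ϖ T q.1 q.2 = quotientFlow g r ϖ (τ q.1) q.2
    rw [← hϖ.quotientAction_exp hT0 hT hq, hτ]
  symplectic c p hp v w := hϖ.canonicalForm_quotientFlow hp _ v w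
  invariant c p hp := hϖ.covectorLength_quotientFlow hr hp _
  moment := by
    refine ⟨quotientField g r ϖ, hϖ.isHamiltonianVectorField hr, fun p hp => ?_⟩
    have h : (fun t : ℝ => quotientAction g r ϖ T (Circle.exp (2 * Real.pi * t / T)) p) =
        fun t => quotientFlow g r ϖ t p := funext fun t => hϖ.quotientAction_exp hT0 hT hp t
    rw [h]
    exact hϖ.isCompleteFlowOn_quotientFlow.integral p hp

theorem IsRoundQuotient.image_quotientFlow_level (hϖ : IsRoundQuotient g r G ϖ) (hr : 0 < r)
    {a : ℝ} (ha : 0 < a) (t : ℝ) :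
    quotientFlow g r ϖ t '' {p : CotangentBundle E L | covectorLength g p = a} =
      {p | covectorLength g p = a} := by
  have hU : ∀ p : CotangentBundle E L, covectorLength g p = a → p ∈ nonzeroCovectors E L :=
    fun p hp => hϖ.mem_of_covectorLength_pos hr (by rwa [hp])
  apply Set.Subset.antisymm
  · rintro _ ⟨p, hp, rfl⟩
    exact (hϖ.covectorLength_quotientFlow hr (hU p hp) t).trans hp
  · intro p hp
    refine ⟨quotientFlow g r ϖ (-t) p, (hϖ.covectorLength_quotientFlow hr (hU p hp) _).trans hp, ?_⟩
    rw [← hϖ.isCompleteFlowOn_quotientFlow.add _ _ p (hU p hp), add_neg_cancel,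
      hϖ.isCompleteFlowOn_quotientFlow.zero p (hU p hp)]

end CircleAction

/-! ### Geodesics -/

section Geodesics

open scoped RealInnerProductSpace

variable {V : Type*} [NormedAddCommGroup V] [InnerProductSpace ℝ V] [CompleteSpace V]
  {E : Type*} [NormedAddCommGroup E] [NormedSpace ℝ E]
  {L : Type*} [TopologicalSpace L] [ChartedSpace E L] [IsManifold 𝓘(ℝ, E) ∞ L]

variable {g : ∀ x : L, TangentSpace 𝓘(ℝ, E) x → TangentSpace 𝓘(ℝ, E) x → ℝ} {r : ℝ} {G : Set ℝ}
  {ϖ : V → L} {x : V} {S : L → V} {γ : ℝ → L} {t₀ : ℝ}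

omit [CompleteSpace V] in
theorem IsRoundSection.metricInChart_eventuallyEq (hS : IsRoundSection g r ϖ x S) :
    ∀ᶠ y in 𝓝 (extChartAt 𝓘(ℝ, E) (ϖ x) (ϖ x)), ∀ a b : E, metricInChart g (ϖ x) y a b =
      r ^ 2 * ⟪fderiv ℝ (fun y => S ((extChartAt 𝓘(ℝ, E) (ϖ x)).symm y)) y a,
        fderiv ℝ (fun y => S ((extChartAt 𝓘(ℝ, E) (ϖ x)).symm y)) y b⟫ := by
  have h1 := (continuousAt_extChartAt_symm (I := 𝓘(ℝ, E)) (ϖ x)).tendsto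
  rw [extChartAt_to_inv] at h1
  filter_upwards [h1.eventually hS.metric, h1.eventually hS.smooth,
    (extChartAt_target_mem_nhds (I := 𝓘(ℝ, E)) (ϖ x)),
    eventually_mem_nhds_iff.2 (extChartAt_target_mem_nhds (I := 𝓘(ℝ, E)) (ϖ x))] with y h2 h3 h4 h5 a b
  have h6 := mfderiv_comp y (I'' := 𝓘(ℝ, V)) (h3.mdifferentiableAt (by simp))
    (((contMDiffOn_extChartAt_symm (n := ∞) (I := 𝓘(ℝ, E)) (ϖ x)).contMDiffAt h5).mdifferentiableAt
      (by simp))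
  rw [mfderiv_eq_fderiv] at h6
  refine (h2 _ _).trans ?_
  exact congrArg₂ (fun a b => r ^ 2 * ⟪a, b⟫) (DFunLike.congr_fun h6 a).symm
    (DFunLike.congr_fun h6 b).symm

omit [CompleteSpace V] in
/-- The geodesic equation of `L` says that the tangential acceleration of the lift to the sphere
vanishes. -/
theorem IsRoundSection.eulerLagrange_iff (hϖ : IsRoundQuotient g r G ϖ) (hr : r ≠ 0)
    (hx : ‖x‖ = 1) (hS : IsRoundSection g r ϖ x S) (hγ : ContMDiffAt 𝓘(ℝ, ℝ) 𝓘(ℝ, E) ∞ γ t₀)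
    (hxγ : γ t₀ = ϖ x) :
    (let u : ℝ → E := fun t => extChartAt 𝓘(ℝ, E) (γ t₀) (γ t)
    ∀ b : E, deriv (fun t => metricInChart g (γ t₀) (u t) (deriv u t) b) t₀ =
      (1 / 2) * fderiv ℝ (fun y => metricInChart g (γ t₀) y (deriv u t₀) (deriv u t₀)) (u t₀) b) ↔
    ∀ b : V, ⟪x, b⟫ = 0 → ⟪deriv (deriv (fun t => S (γ t))) t₀, b⟫ = 0 := by
  let u : ℝ → E := fun t => extChartAt 𝓘(ℝ, E) (γ t₀) (γ t)
  change (∀ b : E, deriv (fun t => metricInChart g (γ t₀) (u t) (deriv u t) b) t₀ =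
    (1 / 2) * fderiv ℝ (fun y => metricInChart g (γ t₀) y (deriv u t₀) (deriv u t₀)) (u t₀) b) ↔ _
  have h0 := ne_zero_of_norm_eq_one hx
  have hγc := hγ.continuousAt
  rw [ContinuousAt, hxγ] at hγc
  have hmet := hS.metricInChart_eventuallyEq
  have hsrc : ∀ᶠ q in 𝓝 (ϖ x), (extChartAt 𝓘(ℝ, E) (ϖ x)).symm (extChartAt 𝓘(ℝ, E) (ϖ x) q) = q := by
    filter_upwards [extChartAt_source_mem_nhds (I := 𝓘(ℝ, E)) (ϖ x)] with q hq
    exact (extChartAt 𝓘(ℝ, E) (ϖ x)).left_inv hq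
  have hSx : S (ϖ x) = x := by simpa [hx] using hS.apply_eq hϖ h0
  have hF : ContDiffAt ℝ ∞ (fun y => S ((extChartAt 𝓘(ℝ, E) (ϖ x)).symm y))
      (extChartAt 𝓘(ℝ, E) (ϖ x) (ϖ x)) := by
    rw [← contMDiffAt_iff_contDiffAt]
    refine ContMDiffAt.comp_of_eq hS.smooth.self_of_nhds ?_ (extChartAt_to_inv (ϖ x))
    exact (contMDiffOn_extChartAt_symm (ϖ x)).contMDiffAt (extChartAt_target_mem_nhds (ϖ x))
  have hu' : u = fun t => extChartAt 𝓘(ℝ, E) (ϖ x) (γ t) := by rw [← hxγ]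
  have hu0 : u t₀ = extChartAt 𝓘(ℝ, E) (ϖ x) (ϖ x) := by rw [hu', ← hxγ]
  have hu : ContDiffAt ℝ ∞ u t₀ := by
    rw [← contMDiffAt_iff_contDiffAt]
    exact ContMDiffAt.comp t₀ (contMDiffAt_extChartAt (x := γ t₀)) hγ
  have hK : ContDiffAt ℝ ∞ (fun y => extChartAt 𝓘(ℝ, E) (ϖ x) (ϖ y)) x := by
    rw [← contMDiffAt_iff_contDiffAt]
    exact ContMDiffAt.comp x (contMDiffAt_extChartAt (x := ϖ x)) (hϖ.smooth x h0)
  rw [hxγ, hu0]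
  set e := extChartAt 𝓘(ℝ, E) (ϖ x)
  set F : E → V := fun y => S (e.symm y) with hFdef
  have hacc : (fun t => F (u t)) =ᶠ[𝓝 t₀] fun t => S (γ t) := by
    filter_upwards [hγc.eventually hsrc] with t ht
    rw [hu']
    exact congrArg S ht
  have huc : Filter.Tendsto u (𝓝 t₀) (𝓝 (e (ϖ x))) := hu0 ▸ hu.continuousAt
  rw [← hu0] at hF
  have hEL := eulerLagrange_eq_inner_acceleration hF hu
  rw [hacc.deriv.deriv_eq, hu0] at hEL
  have h1 : ∀ b : E, deriv (fun t => metricInChart g (ϖ x) (u t) (deriv u t) b) t₀ =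
      r ^ 2 * deriv (fun t => ⟪fderiv ℝ F (u t) (deriv u t), fderiv ℝ F (u t) b⟫) t₀ := by
    intro b
    rw [← deriv_const_mul_field]
    apply Filter.EventuallyEq.deriv_eq
    filter_upwards [huc.eventually hmet] with t ht using ht _ _
  have h2 : ∀ a b : E, fderiv ℝ (fun y => metricInChart g (ϖ x) y a a) (e (ϖ x)) b =
      r ^ 2 * fderiv ℝ (fun y => ⟪fderiv ℝ F y a, fderiv ℝ F y a⟫) (e (ϖ x)) b := by
    intro a b
    have h3 : (fun y => metricInChart g (ϖ x) y a a) =ᶠ[𝓝 (e (ϖ x))]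
        fun y => r ^ 2 * ⟪fderiv ℝ F y a, fderiv ℝ F y a⟫ := by
      filter_upwards [hmet] with y hy using hy _ _
    have h4 : DifferentiableAt ℝ (fun y => fderiv ℝ F y a) (e (ϖ x)) := by
      rw [← hu0]
      exact ((hF.fderiv_right (m := ∞) (by simp)).differentiableAt (by simp)).clm_apply
        (differentiableAt_const a)
    rw [h3.fderiv_eq, fderiv_const_mul (h4.inner ℝ h4)]
    rfl
  have h5 : ∀ b : E, (deriv (fun t => metricInChart g (ϖ x) (u t) (deriv u t) b) t₀ =
      (1 / 2) * fderiv ℝ (fun y => metricInChart g (ϖ x) y (deriv u t₀) (deriv u t₀))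
        (e (ϖ x)) b) ↔ ⟪deriv (deriv (fun t => S (γ t))) t₀, fderiv ℝ F (e (ϖ x)) b⟫ = 0 := by
    intro b
    rw [h1, h2, ← hEL b, ← mul_assoc, mul_comm (1 / 2 : ℝ) (r ^ 2), mul_assoc,
      mul_right_inj' (pow_ne_zero 2 hr), sub_eq_zero]
  simp only [h5]
  rw [hu0] at hF
  -- The image of the differential of `F` is the tangent space of the sphere at `x`.
  constructor
  · intro h b hb
    have h6 : (fun y => F (e (ϖ y))) =ᶠ[𝓝 x] fun y => ‖y‖⁻¹ • y := by
      filter_upwards [(hϖ.smooth x h0).continuousAt.eventually hsrc,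
        hS.comp_eventuallyEq hϖ h0] with y hy hy'
      exact (congrArg S hy).trans hy'
    have h7 := fderiv_comp (𝕜 := ℝ) x (g := F) (f := fun y => e (ϖ y))
      (hF.differentiableAt (by simp)) (hK.differentiableAt (by simp))
    have h8 := fderiv_normalize hx b
    rw [← h6.fderiv_eq, hb, zero_smul, sub_zero] at h8
    have h9 := h (fderiv ℝ (fun y => e (ϖ y)) x b)
    have h10 : fderiv ℝ F (e (ϖ x)) (fderiv ℝ (fun y => e (ϖ y)) x b) = b :=
      (DFunLike.congr_fun h7 b).symm.trans h8
    rwa [h10] at h9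
  · intro h b
    apply h
    have h6 : (fun y => ⟪F y, F y⟫) =ᶠ[𝓝 (e (ϖ x))] fun _ => (1 : ℝ) := by
      have h := (continuousAt_extChartAt_symm (I := 𝓘(ℝ, E)) (ϖ x)).tendsto
      rw [extChartAt_to_inv] at h
      filter_upwards [h.eventually hS.norm_eq] with y hy
      rw [real_inner_self_eq_norm_sq]
      change ‖S (e.symm y)‖ ^ 2 = 1
      rw [hy, one_pow]
    have h7 := fderiv_inner_apply ℝ (hF.differentiableAt (by simp)) (hF.differentiableAt (by simp)) b
    have h8 : F (e (ϖ x)) = x := by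
      rw [hFdef]
      exact (congrArg S (extChartAt_to_inv (ϖ x))).trans hSx
    rw [h6.fderiv_eq, h8, real_inner_comm x] at h7
    simp at h7
    linarith

omit [CompleteSpace V] [IsManifold 𝓘(ℝ, E) ∞ L] in
theorem ambientDeriv_curveVelocity {t : ℝ} (hS : ContMDiffAt 𝓘(ℝ, E) 𝓘(ℝ, V) ∞ S (γ t))
    (hγ : ContMDiffAt 𝓘(ℝ, ℝ) 𝓘(ℝ, E) ∞ γ t) :
    ambientDeriv S (γ t) (curveVelocity (E := E) γ t) = deriv (fun t => S (γ t)) t := by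
  have h := mfderiv_comp t (hS.mdifferentiableAt (by simp)) (hγ.mdifferentiableAt (by simp))
  rw [mfderiv_eq_fderiv] at h
  exact (DFunLike.congr_fun h (1 : ℝ)).symm

omit [CompleteSpace V] [IsManifold 𝓘(ℝ, E) ∞ L] in
theorem IsRoundSection.eq_cotangentProj (hϖ : IsRoundQuotient g r G ϖ) (hx : x ≠ 0)
    (hS : IsRoundSection g r ϖ x S) {p : CotangentBundle E L} (hp : p.proj = ϖ x) {y : V}
    (h : ∀ v : TangentSpace 𝓘(ℝ, E) p.proj, p.2 v = ⟪y, ambientDeriv S p.proj v⟫) :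
    p = cotangentProj g r ϖ (x, y) := by
  refine cotangentBundle_ext hp fun v => ?_
  have h1 := hS.cotangentProj_snd (z := (x, y)) hϖ hx v
  have h2 : ∀ q, q = ϖ x → (ambientDeriv (E := E) S q : E →L[ℝ] V) v =
      (ambientDeriv (E := E) S (ϖ x) : E →L[ℝ] V) v := by
    rintro q rfl; rfl
  exact (h v).trans ((congrArg (fun w => ⟪y, w⟫) (h2 _ hp)).trans h1.symm)

omit [CompleteSpace V] in
/-- A curve on the sphere without tangential acceleration projects to a geodesic of `L`; as the
metric is `r ^ 2` times the induced one, the covector dual to its velocity is `r ^ 2 c'`. -/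
theorem IsRoundQuotient.isCogeodesic (hϖ : IsRoundQuotient g r G ϖ) (hr : r ≠ 0) {c : ℝ → V}
    (hc : ContDiff ℝ ∞ c) (hn : ∀ t, ‖c t‖ = 1)
    (hgeo : ∀ t b, ⟪c t, b⟫ = 0 → ⟪deriv (deriv c) t, b⟫ = 0) :
    IsCogeodesic g (fun t => cotangentProj g r ϖ (c t, r ^ 2 • deriv c t)) := by
  have h0 : ∀ t, c t ≠ 0 := fun t => ne_zero_of_norm_eq_one (hn t)
  have hγ : ContMDiff 𝓘(ℝ, ℝ) 𝓘(ℝ, E) ∞ (fun t => ϖ (c t)) := fun t =>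
    ContMDiffAt.comp t (hϖ.smooth _ (h0 t)) hc.contDiffAt.contMDiffAt
  have hlift : ∀ t S, IsRoundSection g r ϖ (c t) S → (fun s => S (ϖ (c s))) =ᶠ[𝓝 t] c := by
    intro t S hS
    filter_upwards [hc.continuous.continuousAt.eventually (hS.comp_eventuallyEq hϖ (h0 t))] with s hs
    rw [hs, hn, inv_one, one_smul]
  refine ⟨⟨hγ, fun t => ?_⟩, fun t v => ?_⟩
  · obtain ⟨S, hS⟩ := hϖ.exists_section (c t) (h0 t)
    refine (hS.eulerLagrange_iff hϖ hr (hn t) (hγ t) rfl).2 fun b hb => ?_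
    rw [(hlift t S hS).deriv.deriv_eq]
    exact hgeo t b hb
  · obtain ⟨S, hS⟩ := hϖ.exists_section (c t) (h0 t)
    have h1 := hS.cotangentProj_snd (z := (c t, r ^ 2 • deriv c t)) hϖ (h0 t) v
    have h2 := ambientDeriv_curveVelocity (t := t) hS.smooth.self_of_nhds (hγ t)
    rw [(hlift t S hS).deriv_eq] at h2
    have h3 := hS.metric.self_of_nhds (curveVelocity (fun s => ϖ (c s)) t) v
    refine h1.trans (Eq.trans ?_ h3.symm)
    rw [real_inner_smul_left]
    exact congrArg (fun a => r ^ 2 * ⟪a, ambientDeriv S (ϖ (c t)) v⟫) h2.symm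

theorem IsRoundQuotient.exists_isCogeodesic (hϖ : IsRoundQuotient g r G ϖ) (hr : r ≠ 0)
    {p : CotangentBundle E L} (hp : p ∈ nonzeroCovectors E L) : ∃ Γ, IsCogeodesic g Γ ∧ Γ 0 = p := by
  obtain ⟨⟨x, y⟩, ⟨hx, hxy⟩, hy, rfl⟩ := hϖ.exists_rep_of_mem hp
  simp only at hx hxy hy
  have hy0 : ‖y‖ ≠ 0 := norm_ne_zero_iff.2 hy
  -- The great circle through `x` with velocity `r ^ (-2) y`, which is dual to the covector `y`.
  set k : ℝ := ‖y‖ / r ^ 2 with hk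
  set c : ℝ → V := fun s => Real.cos (k * s) • x + Real.sin (k * s) • ‖y‖⁻¹ • y with hcdef
  have hks : ∀ s, HasDerivAt (fun s => k * s) k s := fun s => by
    simpa using (hasDerivAt_id s).const_mul k
  have hd1 : deriv c = fun s => (-Real.sin (k * s) * k) • x + (Real.cos (k * s) * k) • ‖y‖⁻¹ • y :=
    funext fun s => (((hks s).cos.smul_const x).add ((hks s).sin.smul_const _)).deriv
  have hd2 : deriv (deriv c) = fun s => (-(k ^ 2)) • c s := by
    rw [hd1]
    funext s
    refine (((((hks s).sin.neg).mul_const k).smul_const x).add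
      (((hks s).cos.mul_const k).smul_const (‖y‖⁻¹ • y))).deriv.trans ?_
    rw [hcdef]
    module
  have hn : ∀ s, ‖c s‖ = 1 := by
    intro s
    have h : ‖c s‖ ^ 2 = 1 := by
      rw [← real_inner_self_eq_norm_sq]
      simp only [hcdef, inner_add_left, inner_add_right, real_inner_smul_left,
        real_inner_smul_right, real_inner_comm x y, hxy]
      rw [real_inner_self_eq_norm_sq, real_inner_self_eq_norm_sq, hx]
      have h : ‖y‖⁻¹ * (‖y‖⁻¹ * ‖y‖ ^ 2) = 1 := by field_simp
      linear_combination Real.cos_sq_add_sin_sq (k * s) + Real.sin (k * s) ^ 2 * h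
    nlinarith [norm_nonneg (c s)]
  refine ⟨_, hϖ.isCogeodesic hr (c := c) ?_ hn ?_, ?_⟩
  · simp only [hcdef]
    fun_prop
  · intro t b hb
    rw [hd2]
    simp only [real_inner_smul_left, hb, mul_zero]
  · have h1 : c 0 = x := by simp [hcdef]
    have h2 : r ^ 2 • deriv c 0 = y := by
      rw [hd1, hk]
      simp only [mul_zero, Real.sin_zero, neg_zero, zero_mul, zero_smul, zero_add, Real.cos_zero,
        one_mul, smul_smul]
      rw [show r ^ 2 * (‖y‖ / r ^ 2 * ‖y‖⁻¹) = 1 by field_simp, one_smul]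
    rw [h1, h2]

/-- Along a cogeodesic the length is locally constant, and flowing back for the elapsed time gives
a locally constant curve. -/
theorem IsRoundQuotient.eventually_quotientFlow_cogeodesic (hϖ : IsRoundQuotient g r G ϖ)
    (hr : 0 < r) {Γ : ℝ → CotangentBundle E L} (hΓ : IsCogeodesic g Γ) (t₀ : ℝ) :
    ∀ᶠ t in 𝓝 t₀, covectorLength g (Γ t) = covectorLength g (Γ t₀) ∧
      (0 < covectorLength g (Γ t₀) → quotientFlow g r ϖ (t * covectorLength g (Γ t)) (Γ t) =
        quotientFlow g r ϖ (t₀ * covectorLength g (Γ t₀)) (Γ t₀)) := by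
  obtain ⟨⟨hγ, hEL⟩, hvel⟩ := hΓ
  obtain ⟨x, hx, hxγ⟩ := hϖ.surj (Γ t₀).proj
  have h0 := ne_zero_of_norm_eq_one hx
  obtain ⟨S, hS⟩ := hϖ.exists_section x h0
  have hSx : S (ϖ x) = x := by simpa [hx] using hS.apply_eq hϖ h0
  have hγc : Filter.Tendsto (fun t => (Γ t).proj) (𝓝 t₀) (𝓝 (ϖ x)) := by
    rw [hxγ]; exact (hγ t₀).continuousAt
  have hsec : ∀ᶠ q in 𝓝 (ϖ x), IsRoundSection g r ϖ (S q) S := by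
    have h := hS.smooth.self_of_nhds.continuousAt
    rw [ContinuousAt, hSx] at h
    exact h.eventually (hS.eventually_nhds hϖ h0)
  set c : ℝ → V := fun t => S (Γ t).proj with hcdef
  have hnear : ∀ᶠ t in 𝓝 t₀, ContMDiffAt 𝓘(ℝ, E) 𝓘(ℝ, V) ∞ S (Γ t).proj ∧ ‖c t‖ = 1 ∧
      (Γ t).proj = ϖ (c t) ∧ IsRoundSection g r ϖ (c t) S := by
    filter_upwards [hγc.eventually hS.smooth, hγc.eventually hS.norm_eq,
      hγc.eventually hS.right_inv, hγc.eventually hsec] with t h1 h2 h3 h4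
    exact ⟨h1, h2, h3.symm, h4⟩
  have hc : ∀ᶠ t in 𝓝 t₀, ContDiffAt ℝ ∞ c t := by
    filter_upwards [hnear] with t ht
    rw [← contMDiffAt_iff_contDiffAt]
    exact ContMDiffAt.comp t ht.1 (hγ t)
  have hn : ∀ᶠ t in 𝓝 t₀, ‖c t‖ = 1 := hnear.mono fun t ht => ht.2.1
  have hgeo : ∀ᶠ t in 𝓝 t₀, ∀ b, ⟪c t, b⟫ = 0 → ⟪deriv (deriv c) t, b⟫ = 0 := by
    filter_upwards [hnear] with t ht
    exact (ht.2.2.2.eulerLagrange_iff hϖ hr.ne' ht.2.1 (hγ t) ht.2.2.1).1 (hEL t)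
  have hrep : ∀ᶠ t in 𝓝 t₀, (c t, r ^ 2 • deriv c t) ∈ sphereCotangent V ∧
      Γ t = cotangentProj g r ϖ (c t, r ^ 2 • deriv c t) := by
    filter_upwards [hnear, hc, hn.eventually_nhds] with t ht hct hnt
    refine ⟨⟨ht.2.1, ?_⟩, ?_⟩
    · have h1 : (fun s => ⟪c s, c s⟫) =ᶠ[𝓝 t] fun _ => (1 : ℝ) := by
        filter_upwards [hnt] with s hs
        rw [real_inner_self_eq_norm_sq, hs, one_pow]
      have h2 : HasDerivAt c (deriv c t) t := (hct.differentiableAt (by simp)).hasDerivAt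
      have h3 := (h2.inner ℝ h2).deriv
      rw [h1.deriv_eq, deriv_const, real_inner_comm (c t)] at h3
      rw [real_inner_smul_right]
      have h4 : ⟪c t, deriv c t⟫ = 0 := by linarith
      rw [h4, mul_zero]
    · refine ht.2.2.2.eq_cotangentProj hϖ (ne_zero_of_norm_eq_one ht.2.1) ht.2.2.1 fun v => ?_
      have h1 : g (Γ t).proj (curveVelocity (fun s => (Γ s).proj) t) v = r ^ 2 *
          ⟪ambientDeriv S (Γ t).proj (curveVelocity (E := E) (fun s => (Γ s).proj) t),
            ambientDeriv S (Γ t).proj v⟫ := by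
        have h := ht.2.2.2.metric
        rw [← ht.2.2.1] at h
        exact h.self_of_nhds _ _
      have h2 := ambientDeriv_curveVelocity (t := t) (γ := fun s => (Γ s).proj) ht.1 (hγ t)
      rw [hvel, h1, real_inner_smul_left]
      exact congrArg (fun a => r ^ 2 * ⟪a, ambientDeriv S (Γ t).proj v⟫) h2
  have hlen : ∀ t, (c t, r ^ 2 • deriv c t) ∈ sphereCotangent V →
      Γ t = cotangentProj g r ϖ (c t, r ^ 2 • deriv c t) →
      covectorLength g (Γ t) = r * ‖deriv c t‖ := by
    intro t h1 h2
    rw [h2, hϖ.covectorLength_cotangentProj hr h1, norm_smul, Real.norm_of_nonneg (by positivity)]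
    field_simp
  have hz₀ := hrep.self_of_nhds
  filter_upwards [hrep, eventually_lengthFlow_eq_of_acceleration hr.ne' hc hn hgeo]
    with t ht ⟨h1, h2⟩
  have hl := hlen t ht.1 ht.2
  have hl₀ := hlen t₀ hz₀.1 hz₀.2
  refine ⟨by rw [hl, hl₀, h1], fun hpos => ?_⟩
  rw [hl₀] at hpos
  have h3 : deriv c t₀ ≠ 0 := norm_ne_zero_iff.1 (pos_of_mul_pos_right hpos hr.le).ne'
  have h4 : deriv c t ≠ 0 := by rwa [← norm_ne_zero_iff, h1, norm_ne_zero_iff]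
  rw [hl, hl₀, ht.2, hz₀.2,
    hϖ.quotientFlow_cotangentProj ht.1 (smul_ne_zero (pow_ne_zero 2 hr.ne') h4),
    hϖ.quotientFlow_cotangentProj hz₀.1 (smul_ne_zero (pow_ne_zero 2 hr.ne') h3), h2 h3]

theorem IsRoundQuotient.quotientFlow_eq_cogeodesic (hϖ : IsRoundQuotient g r G ϖ) (hr : 0 < r)
    {Γ : ℝ → CotangentBundle E L} (hΓ : IsCogeodesic g Γ) (h0 : Γ 0 ∈ nonzeroCovectors E L)
    (t : ℝ) : quotientFlow g r ϖ t (Γ 0) = Γ (-(t / covectorLength g (Γ 0))) := by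
  have hloc := hϖ.eventually_quotientFlow_cogeodesic hr hΓ
  have hpos : 0 < covectorLength g (Γ 0) := by
    obtain ⟨z, hz, hz0, h⟩ := hϖ.exists_rep_of_mem h0
    rw [← h, hϖ.covectorLength_cotangentProj hr hz]
    exact div_pos (norm_pos_iff.2 hz0) hr
  have hlen : ∀ s, covectorLength g (Γ s) = covectorLength g (Γ 0) := fun s =>
    ((IsLocallyConstant.iff_eventually_eq _).2 fun a => (hloc a).mono fun _ h => h.1
      ).apply_eq_of_preconnectedSpace s 0
  have hflow : ∀ s, quotientFlow g r ϖ (s * covectorLength g (Γ s)) (Γ s) =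
      quotientFlow g r ϖ (0 * covectorLength g (Γ 0)) (Γ 0) := fun s =>
    ((IsLocallyConstant.iff_eventually_eq
      (fun s => quotientFlow g r ϖ (s * covectorLength g (Γ s)) (Γ s))).2 fun a =>
        (hloc a).mono fun _ h => h.2 (by rwa [hlen])).apply_eq_of_preconnectedSpace s 0
  set s := -(t / covectorLength g (Γ 0)) with hs
  have hmem : Γ s ∈ nonzeroCovectors E L := hϖ.mem_of_covectorLength_pos hr (by rwa [hlen])
  have h1 := hflow s
  have h2 : s * covectorLength g (Γ 0) = -t := by rw [hs]; field_simp
  rw [hlen, h2, zero_mul, hϖ.isCompleteFlowOn_quotientFlow.zero _ h0] at h1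
  rw [← h1, ← hϖ.isCompleteFlowOn_quotientFlow.add _ _ _ hmem, add_neg_cancel,
    hϖ.isCompleteFlowOn_quotientFlow.zero _ hmem]

/-- The length flow of a quotient of the round sphere of radius `r` by a group `G` of signs is a
circle action: `lengthFlow r t` is the rotation by the angle `t / r` in the plane of `x` and `y`,
and this is a sign belonging to `G` exactly when `t` is a multiple of `T`. -/
theorem IsRoundQuotient.lengthFlowIsCircleAction (hϖ : IsRoundQuotient g r G ϖ) (hr : 0 < r)
    {T : ℝ} (hT0 : T ≠ 0)
    (hT : ∀ t : ℝ, (∃ ε ∈ G, Real.cos (t / r) = ε ∧ Real.sin (t / r) = 0) ↔ ∃ k : ℤ, t = k * T) :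
    LengthFlowIsCircleAction g T (quotientField g r ϖ) (quotientFlow g r ϖ)
      (quotientAction g r ϖ T) where
  hamiltonian := hϖ.isHamiltonianVectorField hr
  unique _ hY _ hp := hϖ.hamiltonianVectorField_unique hr hY hp
  flow := hϖ.isCompleteFlowOn_quotientFlow
  period _ hp := hϖ.quotientFlow_eq_self_iff hT hp
  action := hϖ.isHamiltonianCircleAction hr hT0 hT
  action_eq_flow t _ hp := hϖ.quotientAction_exp hT0 hT hp t
  exists_cogeodesic _ hp := hϖ.exists_isCogeodesic hr.ne' hp
  eq_cogeodesic _ hΓ h0 := hϖ.quotientFlow_eq_cogeodesic hr hΓ h0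
  level_invariant _ ha :=
    ⟨hϖ.image_quotientFlow_level hr ha, fun _ => hϖ.image_quotientFlow_level hr ha _⟩
  level_contact _ ha := hϖ.isContactHypersurface hr ha

end Geodesics

/-! ### Spheres and projective spaces -/

section Sphere

/-- The retraction `x ↦ x / |x|` of `ℝ^(n+1) ∖ {0}` onto the unit sphere; its value at `0` is
arbitrary. -/
def sphereProj (n : ℕ) (x : EuclideanSpace ℝ (Fin (n + 1))) : RoundSphere n :=
  if h : x ≠ 0 then ⟨‖x‖⁻¹ • x, mem_sphere_zero_iff_norm.2 (norm_smul_inv_norm h)⟩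
  else ⟨EuclideanSpace.single 0 1, by simp⟩

variable {n : ℕ} {r : ℝ} {x y : EuclideanSpace ℝ (Fin (n + 1))}

theorem coe_sphereProj (hx : x ≠ 0) :
    (sphereProj n x : EuclideanSpace ℝ (Fin (n + 1))) = ‖x‖⁻¹ • x := by
  rw [sphereProj, dif_pos hx]

theorem coe_sphereProj_of_norm (hx : ‖x‖ = 1) :
    (sphereProj n x : EuclideanSpace ℝ (Fin (n + 1))) = x := by
  rw [coe_sphereProj (ne_zero_of_norm_eq_one hx), hx, inv_one, one_smul]

theorem norm_coe_roundSphere (q : RoundSphere n) : ‖(q : EuclideanSpace ℝ (Fin (n + 1)))‖ = 1 :=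
  mem_sphere_zero_iff_norm.1 q.2

theorem sphereProj_coe (q : RoundSphere n) : sphereProj n q = q :=
  Subtype.ext (coe_sphereProj_of_norm (norm_coe_roundSphere q))

theorem sphereProj_normalize (hx : x ≠ 0) : sphereProj n (‖x‖⁻¹ • x) = sphereProj n x := by
  rw [← coe_sphereProj hx, sphereProj_coe]

theorem contMDiffAt_coe_roundSphere (q : RoundSphere n) :
    ContMDiffAt (𝓡 n) 𝓘(ℝ, EuclideanSpace ℝ (Fin (n + 1))) ∞
      (fun q : RoundSphere n => (q : EuclideanSpace ℝ (Fin (n + 1)))) q := by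
  have := Fact.mk (@finrank_euclideanSpace_fin ℝ _ (n + 1))
  exact contMDiff_coe_sphere q

theorem contMDiffAt_sphereProj (hx : x ≠ 0) :
    ContMDiffAt 𝓘(ℝ, EuclideanSpace ℝ (Fin (n + 1))) (𝓡 n) ∞ (sphereProj n) x := by
  have := Fact.mk (@finrank_euclideanSpace_fin ℝ _ (n + 1))
  let U : TopologicalSpace.Opens (EuclideanSpace ℝ (Fin (n + 1))) := ⟨{0}ᶜ, isOpen_compl_singleton⟩
  -- `ContMDiff.codRestrict_sphere` needs a map that is smooth on a whole manifold, here the complement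
  -- of the origin.
  have h1 : ContMDiff 𝓘(ℝ, EuclideanSpace ℝ (Fin (n + 1))) 𝓘(ℝ, EuclideanSpace ℝ (Fin (n + 1))) ∞
      (fun y : U => (sphereProj n y : EuclideanSpace ℝ (Fin (n + 1)))) := by
    have h2 : (fun y : U => (sphereProj n y : EuclideanSpace ℝ (Fin (n + 1)))) =
        fun y : U => ‖(y : EuclideanSpace ℝ (Fin (n + 1)))‖⁻¹ • (y : EuclideanSpace ℝ (Fin (n + 1))) :=
      funext fun y => coe_sphereProj y.2
    rw [h2]
    intro y
    exact ContMDiffAt.comp y (g := fun y : EuclideanSpace ℝ (Fin (n + 1)) => ‖y‖⁻¹ • y)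
      (contDiffAt_normalize y.2).contMDiffAt contMDiff_subtype_val.contMDiffAt
  have h3 := h1.codRestrict_sphere (n := n) (fun y => (sphereProj n y).2)
  exact (contMDiffAt_subtype_iff (U := U) (x := ⟨x, hx⟩)).1 (h3 ⟨x, hx⟩)

/-- For the sphere the inclusion into the ambient space is a global section. -/
theorem isRoundQuotient_sphere (n : ℕ) (r : ℝ) :
    IsRoundQuotient (L := RoundSphere n) (sphereMetric n r) r {1} (sphereProj n) where
  sign := by simp
  smooth _ hx := contMDiffAt_sphereProj hx
  homog _ hx := sphereProj_normalize hx
  surj q := ⟨q, norm_coe_roundSphere q, sphereProj_coe q⟩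
  fibre x y hx hy := by
    rw [← Subtype.coe_inj, coe_sphereProj_of_norm hx, coe_sphereProj_of_norm hy]
    simp
  exists_section x hx := by
    refine ⟨fun q => q, .of_forall contMDiffAt_coe_roundSphere, .of_forall norm_coe_roundSphere,
      .of_forall sphereProj_coe, ?_, .of_forall fun q v w => rfl⟩
    have h : ‖x‖⁻¹ • x ≠ 0 := ne_zero_of_norm_eq_one (norm_smul_inv_norm hx)
    filter_upwards [eventually_ne_nhds h] with y hy using coe_sphereProj hy

end Sphere

section ProjectiveSpace

open scoped RealInnerProductSpace

variable {n : ℕ} {r : ℝ}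

theorem signGroup_coe (σ : Metric.sphere (0 : ℝ) 1) : (σ : ℝ) = 1 ∨ (σ : ℝ) = -1 := by
  have h := σ.2
  rwa [mem_sphere_zero_iff_norm, Real.norm_eq_abs, abs_eq zero_le_one] at h

/-- The metric of the projective space is read through the local inverses of the quotient map. -/
theorem projectiveMetric_eq_localInverse (z : RoundSphere n) {q : RealProjectiveSpace n}
    (hq : q ∈ ((isLocalHomeomorph_antipodalProj n).localInverseAt z).source)
    (v w : TangentSpace (𝓡 n) q) :
    projectiveMetric n r q v w = r ^ 2 *
      ⟪ambientDeriv (fun q => ((isLocalHomeomorph_antipodalProj n).localInverseAt z q :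
          EuclideanSpace ℝ (Fin (n + 1)))) q v,
        ambientDeriv (fun q => ((isLocalHomeomorph_antipodalProj n).localInverseAt z q :
          EuclideanSpace ℝ (Fin (n + 1)))) q w⟫ := by
  set hf := isLocalHomeomorph_antipodalProj n
  set s := hf.localInverseAt z with hs
  have hsq : antipodalProj n (s q) = q := hf.apply_localInverseAt_of_mem hq
  have hd : MDifferentiableAt (𝓡 n) (𝓡 n) s q :=
    (contMDiffAt_localInverse n z hq).mdifferentiableAt (by simp)
  have h1 : ∀ v : TangentSpace (𝓡 n) q,
      ambientDeriv (fun q => (s q : EuclideanSpace ℝ (Fin (n + 1)))) q v =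
      sphereDifferential n (s q) (mfderiv (𝓡 n) (𝓡 n) s q v) := fun v =>
    DFunLike.congr_fun (mfderiv_comp q
      ((contMDiffAt_coe_roundSphere (s q)).mdifferentiableAt (by simp)) hd) v
  have h2 : antipodalProj n ∘ s =ᶠ[𝓝 q] id := by
    filter_upwards [s.open_source.mem_nhds hq] with q' hq'
    exact hf.apply_localInverseAt_of_mem hq'
  have h3 := mfderiv_comp q (I'' := 𝓡 n)
    ((contMDiff_antipodalProj n (s q)).mdifferentiableAt (by simp)) hd
  rw [h2.mfderiv_eq, mfderiv_id] at h3
  have h4 := projectiveMetric_pullback n r (s q) (mfderiv (𝓡 n) (𝓡 n) s q v)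
    (mfderiv (𝓡 n) (𝓡 n) s q w)
  have h5 : ∀ q', q' = q → ∀ v w : EuclideanSpace ℝ (Fin n),
      projectiveMetric n r q' v w = projectiveMetric n r q v w := by
    rintro q' rfl v w; rfl
  have h6 := h5 _ hsq (mfderiv (𝓡 n) (𝓡 n) (antipodalProj n) (s q) (mfderiv (𝓡 n) (𝓡 n) s q v))
    (mfderiv (𝓡 n) (𝓡 n) (antipodalProj n) (s q) (mfderiv (𝓡 n) (𝓡 n) s q w))
  rw [h1, h1]
  refine Eq.trans ?_ (h6.symm.trans h4)
  exact congrArg₂ (projectiveMetric n r q) (DFunLike.congr_fun h3 v) (DFunLike.congr_fun h3 w)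

/-- For the projective space the sections are the local inverses of the quotient map. -/
theorem isRoundQuotient_projectiveSpace (n : ℕ) (r : ℝ) :
    IsRoundQuotient (L := RealProjectiveSpace n) (projectiveMetric n r) r {1, -1}
      (fun x => antipodalProj n (sphereProj n x)) where
  sign := by simp
  smooth x hx := ContMDiffAt.comp x ((contMDiff_antipodalProj n _).of_le (by simp))
    (contMDiffAt_sphereProj hx)
  homog _ hx := by rw [sphereProj_normalize hx]
  surj q := by
    obtain ⟨y, rfl⟩ := Quotient.exists_rep q
    exact ⟨y, norm_coe_roundSphere y, congrArg (antipodalProj n) (sphereProj_coe y)⟩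
  fibre x y hx hy := by
    have h : ∀ σ : Metric.sphere (0 : ℝ) 1, σ • sphereProj n y = sphereProj n x ↔
        (σ : ℝ) • y = x := by
      intro σ
      rw [← Subtype.coe_inj, coe_sphereProj_of_norm hx]
      change (σ : ℝ) • (sphereProj n y : EuclideanSpace ℝ (Fin (n + 1))) = x ↔ _
      rw [coe_sphereProj_of_norm hy]
    rw [antipodalProj_eq_iff]
    simp only [h]
    constructor
    · rintro ⟨σ, hσ⟩
      exact ⟨σ, signGroup_coe σ, hσ.symm⟩
    · rintro ⟨ε, hε, hx⟩
      refine ⟨⟨ε, ?_⟩, hx.symm⟩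
      rcases hε with rfl | rfl <;> simp
  exists_section x hx := by
    set hf := isLocalHomeomorph_antipodalProj n
    set z := sphereProj n x with hz
    set s := hf.localInverseAt z
    have hsource : ∀ᶠ q in 𝓝 (antipodalProj n z), q ∈ s.source :=
      s.open_source.mem_nhds hf.apply_self_mem_localInverseAt_source
    refine ⟨fun q => s q, ?_, .of_forall fun q => norm_coe_roundSphere _, ?_, ?_, ?_⟩
    · filter_upwards [hsource] with q hq
      exact ContMDiffAt.comp q (contMDiffAt_coe_roundSphere (s q))
        ((contMDiffAt_localInverse n z hq).of_le (by simp))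
    · filter_upwards [hsource] with q hq
      rw [sphereProj_coe]
      exact hf.apply_localInverseAt_of_mem hq
    · have h0 : ‖x‖⁻¹ • x ≠ 0 := ne_zero_of_norm_eq_one (norm_smul_inv_norm hx)
      have hc : Filter.Tendsto (sphereProj n) (𝓝 (‖x‖⁻¹ • x)) (𝓝 z) := by
        have h := (contMDiffAt_sphereProj h0).continuousAt
        rwa [ContinuousAt, sphereProj_normalize hx] at h
      filter_upwards [hc.eventually (s.open_target.mem_nhds hf.self_mem_localInverseAt_target),
        hc.eventually (hf.continuous.continuousAt.eventually hsource),
        eventually_ne_nhds h0] with y h1 h2 h3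
      rw [← coe_sphereProj h3]
      exact congrArg Subtype.val (hf.injOn_localInverseAt_target (s.map_source h2) h1
        (hf.apply_localInverseAt_of_mem h2))
    · filter_upwards [hsource] with q hq v w
      exact projectiveMetric_eq_localInverse z hq v w

end ProjectiveSpace

end

theorem mainTheorem10 (n : ℕ) (r : ℝ) (hr : 0 < r) :
    (∃ X φ ρ, LengthFlowIsCircleAction (L := RoundSphere n)
      (sphereMetric n r) (2 * Real.pi * r) X φ ρ) ∧
    (∃ X φ ρ, LengthFlowIsCircleAction (L := RealProjectiveSpace n)
      (projectiveMetric n r) (Real.pi * r) X φ ρ) := by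
  have hpi := Real.pi_pos
  refine ⟨⟨_, _, _, (isRoundQuotient_sphere n r).lengthFlowIsCircleAction hr (by positivity)
    fun t => ?_⟩, ⟨_, _, _, (isRoundQuotient_projectiveSpace n r).lengthFlowIsCircleAction hr
      (by positivity) fun t => ?_⟩⟩
  · have h : (∃ ε ∈ ({1} : Set ℝ), Real.cos (t / r) = ε ∧ Real.sin (t / r) = 0) ↔
        Real.cos (t / r) = 1 := by
      refine ⟨?_, fun h => ⟨1, rfl, h, Real.sin_eq_zero_iff_cos_eq.2 (.inl h)⟩⟩
      rintro ⟨_, rfl, h, -⟩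
      exact h
    rw [h, Real.cos_eq_one_iff]
    refine exists_congr fun k => ?_
    rw [eq_div_iff hr.ne', eq_comm, mul_assoc]
  · have h : (∃ ε ∈ ({1, -1} : Set ℝ), Real.cos (t / r) = ε ∧ Real.sin (t / r) = 0) ↔
        Real.sin (t / r) = 0 :=
      ⟨fun ⟨_, _, _, h⟩ => h, fun h => ⟨_, Real.sin_eq_zero_iff_cos_eq.1 h, rfl, h⟩⟩
    rw [h, Real.sin_eq_zero_iff]
    refine exists_congr fun k => ?_
    rw [eq_div_iff hr.ne', eq_comm, mul_assoc]
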